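/- Let \(n\ge 1\). Let \(s_k\in\mathbb{Q}[g_2,g_3][B]\) (\(k\le n\)) be defined by \(s_k=0\) for \(k<0\), \(s_0=1\) and the recursion, for \(\mu=n-1,n-2,\ldots,0\), \[ 0=2(n-\mu)(2\mu+1)(n+\mu+1)\,s_{n-\mu}-4(\mu+1)B\,s_{n-\mu-1}+\tfrac12 g_2(\mu+1)(\mu+2)(2\mu+3)\,s_{n-\mu-2}-g_3(\mu+1)(\mu+2)(\mu+3)\,s_{n-\mu-3}, \] so that \(s_1=B/(2n-1)\), and put \[ \ell_n(B)=\ell_n(B,g_2,g_3)=4B\,s_n^2+4g_3\,s_{n-2}s_n-g_2\,s_{n-1}s_n-g_3\,s_{n-1}^2 . \] For a lattice \(\Lambda\subset\mathbb{C}\) let \(E=\mathbb{C}/\Lambda\), with Weierstrass coordinates \((x,y)=(\wp,\wp')\), \(y^2=4x^3-g_2(\Lambda)x-g_3(\Lambda)\), and let \(X_n\subset \mathrm{Sym}^nE\) be the locally closed subvariety of all unordered \(n\)-tuples \(\{(x_i,y_i)\}_{i=1}^n\) of points of \(E\smallsetminus E[2]\) with \(x_i\ne x_j\) for \(i\neq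 j\) and \(\sum_{i=1}^n x_i^r y_i=0\) for \(r=0,1,\ldots,n-2\). (1) For every lattice \(\Lambda\), the polynomial \(\ell_n(B)=\ell_n(B,g_2(\Lambda),g_3(\Lambda))\in\mathbb{C}[B]\) has degree \(2n+1\), and \(X_n\) has a natural projective compactification \(\hat X_n\), namely the (possibly singular) projective hyperelliptic curve defined by \[ C^2=\ell_n(B). \] That is, let \(\hat X_n\subset\mathbb{P}^{n+2}\) be the closed subvariety, with homogeneous coordinates \([Z_0:\cdots:Z_{n+1}:W]\), given by \(Z_iZ_j=Z_kZ_l\) (\(i+j=k+l\)) and by the quadric \(W^2=\sum_m c_m Z_{\lfloor m/2\rfloor}Z_{\lceil m/2\rceil}\), where \(\ell_n(B)=\sum_m c_mB^m\). Then: * \(\hat X_n\) is irreducible of dimension one. It is covered by two affine open subvarieties: the plane curve \(C^2=\ell_n(B)\), embedded by \((B,C)\mapsto[1:B:\cdots:B^{n+1}:C]\), and the plane curve \(v^2=u\cdot u^{2n+1}\ell_n(1/u)\), embedded by \((u,v)\mapsto[u^{n+1}:\cdots:u:1:v]\). The complement of the first is the single point \((u,v)=(0,0)\). * \(B\) extends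 to a surjective morphism \(\hat\pi:\hat X_n\to\mathbb{P}^1\), and \((B,C)\mapsto(B,-C)\) extends to an involution \(\hat\iota\) of \(\hat X_n\). The fibres of \(\hat\pi\) are exactly the orbits of \(\hat\iota\). * For \(\{(x_i,y_i)\}\in X_n\), the number \(C=y_i\prod_{j\ne i}(x_i-x_j)\) does not depend on \(i\), and with \(B=(2n-1)\sum_i x_i\) one has \(C^2=\ell_n(B)\). The map \(\{(x_i,y_i)\}\mapsto(B,C)\) is an isomorphism of algebraic varieties from \(X_n\) onto a dense Zariski open subvariety of \(\hat X_n\), namely the part \(C\neq0\) of the affine curve \(C^2=\ell_n(B)\). This is the complement in \(\hat X_n\) of the fixed points of \(\hat\iota\). (2) The polynomial \(\ell_n\) has degree \(2n+1\) in \(B\), and its discriminant \(\mathrm{disc}_B(\ell_n)\in\mathbb{Q}[g_2,g_3]\) is a nonzero polynomial, homogeneous of weight \(2n(2n+1)\) when \(g_2,g_3\) are given weights \(2,3\). For every lattice \(\Lambda\), the discriminant of \(\ell_n(B,g_2(\Lambda),g_3(\Lambda))\) is \(\mathrm{disc}_B(\ell_n)\) evaluated at \((g_2(\Lambda),g_3(\Lambda))\).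 The function \(\tau\mapsto \mathrm{disc}_B(\ell_n)\big(g_2(\Lambda_\tau),g_3(\Lambda_\tau)\big)\), with \(\Lambda_\tau=\mathbb{Z}+\mathbb{Z}\tau\) and \(\tau\in\mathbb{H}\), is a nonzero modular form of weight \(4n(2n+1)\) for the full modular group \(\mathrm{SL}_2(\mathbb{Z})\), holomorphic on \(\mathbb{H}\) and at the cusps. -/

import Mathlib

open Polynomial
open scoped LinearAlgebra.Projectivization MatrixGroups Topology

noncomputable section

/-! ### Classical complex varieties as spaces with functions -/

/-- A Zariski topology together with the regular functions on subsets. Only the values of a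
function on `V` matter for `IsRegularOn V`. -/
structure VarietyStructure (X : Type*) where
  top : TopologicalSpace X
  IsRegularOn : Set X → (X → ℂ) → Prop

namespace VarietyStructure

/-- The structure given by a graded family of "forms" `F d` on `X`: the basic open sets are the
nonvanishing loci of forms, and regular functions are locally quotients of two forms of
the same degree. For an affine variety, every `F d` is the set of polynomial functions. -/
def ofForms {X : Type*} (F : ℕ → Set (X → ℂ)) : VarietyStructure X where
  top := TopologicalSpace.generateFrom {U | ∃ d, ∃ b ∈ F d, U = {x | b x ≠ 0}}
  IsRegularOn V f := ∀ x ∈ V, ∃ d, ∃ a ∈ F d, ∃ b ∈ F d,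
    b x ≠ 0 ∧ ∀ y ∈ V, b y ≠ 0 → f y = a y / b y

/-- The reduced subvariety structure on `X`, regarded inside projective space through `e`. -/
def projective {X ι : Type*} (e : X → ℙ ℂ (ι → ℂ)) : VarietyStructure X :=
  ofForms fun d => {h | ∃ p : MvPolynomial ι ℂ, p.IsHomogeneous d ∧
    h = fun x => MvPolynomial.eval (e x).rep p}

/-- The reduced subvariety structure on `X`, regarded inside affine space through `e`. -/
def affine {X ι : Type*} (e : X → ι → ℂ) : VarietyStructure X :=
  ofForms fun _ => {h | ∃ p : MvPolynomial ι ℂ, h = fun x => MvPolynomial.eval (e x) p}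

/-- Morphisms of varieties: continuous maps that pull regular functions on open sets back to
regular functions. -/
def IsMorphism {X Y : Type*} (S : VarietyStructure X) (T : VarietyStructure Y) (φ : X → Y) :
    Prop :=
  Continuous[S.top, T.top] φ ∧ ∀ V : Set Y, IsOpen[T.top] V → ∀ f : Y → ℂ,
    T.IsRegularOn V f → S.IsRegularOn (φ ⁻¹' V) (f ∘ φ)

/-- `φ` is an isomorphism of varieties from `X` onto a Zariski open subvariety of `Y`. -/
def IsOpenImmersion {X Y : Type*} (S : VarietyStructure X) (T : VarietyStructure Y)
    (φ : X → Y) : Prop :=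
  @Topology.IsOpenEmbedding X Y S.top T.top φ ∧ ∀ V : Set X, IsOpen[S.top] V → ∀ f : Y → ℂ,
    (T.IsRegularOn (φ '' V) f ↔ S.IsRegularOn V (f ∘ φ))

end VarietyStructure

/-! ### The polynomials `s_k` and `ℓ_n` -/

/-- `ℚ[g₂, g₃]`; the variable `0` is `g₂` and the variable `1` is `g₃`. -/
abbrev InvariantRing : Type := MvPolynomial (Fin 2) ℚ

/-- One step of the recursion: `s_k` in terms of `s_{k-1}, s_{k-2}, s_{k-3}`, with `μ = n - k`. -/
def lameStep (n k : ℕ) (s₁ s₂ s₃ : InvariantRing[X]) : InvariantRing[X] :=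
  let μ : ℚ := (n : ℚ) - k
  (2 * (n - μ) * (2 * μ + 1) * (n + μ + 1))⁻¹ •
    ((4 * (μ + 1)) • (X * s₁)
      - (1 / 2 * (μ + 1) * (μ + 2) * (2 * μ + 3)) • (C (MvPolynomial.X 0) * s₂)
      + ((μ + 1) * (μ + 2) * (μ + 3)) • (C (MvPolynomial.X 1) * s₃))

def lameSNat (n : ℕ) : ℕ → InvariantRing[X]
  | 0 => 1
  | 1 => lameStep n 1 1 0 0
  | 2 => lameStep n 2 (lameSNat n 1) 1 0
  | k + 3 => lameStep n (k + 3) (lameSNat n (k + 2)) (lameSNat n (k + 1)) (lameSNat n k)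

/-- The polynomials `s_k ∈ ℚ[g₂, g₃][B]` attached to `n`, with `s_k = 0` for `k < 0`. -/
def lameS (n : ℕ) : ℤ → InvariantRing[X]
  | Int.ofNat k => lameSNat n k
  | Int.negSucc _ => 0

theorem lameS_zero (n : ℕ) : lameS n 0 = 1 := by
  show lameSNat n 0 = 1
  rw [lameSNat]

theorem lameS_neg (n : ℕ) (k : ℤ) (hk : k < 0) : lameS n k = 0 := by
  obtain ⟨m, rfl⟩ := Int.eq_negSucc_of_lt_zero hk
  rfl

theorem lameS_eq_step (n k : ℕ) (hk : 1 ≤ k) :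
    lameS n k = lameStep n k (lameS n (k - 1)) (lameS n (k - 2)) (lameS n (k - 3)) := by
  match k, hk with
  | 1, _ =>
    show lameSNat n 1 = _
    rw [lameS_neg n (((1 : ℕ) : ℤ) - 2) (by norm_num),
      lameS_neg n (((1 : ℕ) : ℤ) - 3) (by norm_num)]
    show _ = lameStep n 1 (lameS n 0) 0 0
    rw [lameS_zero, lameSNat]
  | 2, _ =>
    show lameSNat n 2 = _
    rw [lameS_neg n (((2 : ℕ) : ℤ) - 3) (by norm_num)]
    show _ = lameStep n 2 (lameSNat n 1) (lameS n 0) 0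
    rw [lameS_zero]
    rfl
  | k + 3, _ =>
    have h1 : (((k + 3 : ℕ) : ℤ) - 1) = ((k + 2 : ℕ) : ℤ) := by push_cast; ring
    have h2 : (((k + 3 : ℕ) : ℤ) - 2) = ((k + 1 : ℕ) : ℤ) := by push_cast; ring
    have h3 : (((k + 3 : ℕ) : ℤ) - 3) = (k : ℤ) := by push_cast; ring
    rw [h1, h2, h3]
    show lameSNat n (k + 3) =
      lameStep n (k + 3) (lameSNat n (k + 2)) (lameSNat n (k + 1)) (lameSNat n k)
    rw [lameSNat]

/-- The defining recursion, for `μ = n - 1, …, 0`. -/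
theorem lameS_recursion (n μ : ℕ) (hμ : μ < n) :
    0 = (2 * ((n : ℚ) - μ) * (2 * μ + 1) * (n + μ + 1)) • lameS n (n - μ)
      - (4 * ((μ : ℚ) + 1)) • (X * lameS n (n - μ - 1))
      + (1 / 2 * ((μ : ℚ) + 1) * (μ + 2) * (2 * μ + 3)) •
          (C (MvPolynomial.X 0) * lameS n (n - μ - 2))
      - (((μ : ℚ) + 1) * (μ + 2) * (μ + 3)) • (C (MvPolynomial.X 1) * lameS n (n - μ - 3)) := by
  have h : ((n : ℤ) - μ) = ((n - μ : ℕ) : ℤ) := by omega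
  have hq : (n : ℚ) - ((n - μ : ℕ) : ℚ) = μ := by
    rw [Nat.cast_sub hμ.le]; ring
  have hne : (2 * ((n : ℚ) - μ) * (2 * μ + 1) * (n + μ + 1)) ≠ 0 := by
    have : (0 : ℚ) < (n : ℚ) - μ := by
      have : (μ : ℚ) < n := by exact_mod_cast hμ
      linarith
    positivity
  rw [h, lameS_eq_step n (n - μ) (by omega), lameStep]
  simp only [hq]
  rw [smul_smul, mul_inv_cancel₀ hne, one_smul]
  abel

/-- `ℓ_n(B) = 4 B s_n² + 4 g₃ s_{n-2} s_n - g₂ s_{n-1} s_n - g₃ s_{n-1}²`, in `ℚ[g₂, g₃][B]`. -/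
def lamePoly (n : ℕ) : InvariantRing[X] :=
  4 * X * lameS n n ^ 2 + 4 * C (MvPolynomial.X 1) * lameS n (n - 2) * lameS n n
    - C (MvPolynomial.X 0) * lameS n (n - 1) * lameS n n
    - C (MvPolynomial.X 1) * lameS n (n - 1) ^ 2

/-- The substitution `g₂ = g₂(Λ)`, `g₃ = g₃(Λ)`. -/
def invariantsAt (L : PeriodPair) : InvariantRing →ₐ[ℚ] ℂ := MvPolynomial.aeval ![L.g₂, L.g₃]

/-- `ℓ_n(B, g₂(Λ), g₃(Λ)) ∈ ℂ[B]`. -/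
def lamePolyAt (n : ℕ) (L : PeriodPair) : ℂ[X] := (lamePoly n).map (invariantsAt L).toRingHom

/-! ### The Liouville curve in the symmetric product of the elliptic curve -/

/-- The elliptic curve `E = ℂ / Λ`. -/
abbrev EllipticTorus (L : PeriodPair) : Type := ℂ ⧸ L.lattice

/-- The Weierstrass coordinate `x = ℘` on `E` (meaningful away from the origin). -/
def weierstrassX (L : PeriodPair) : EllipticTorus L → ℂ :=
  Quotient.lift L.weierstrassP (by
    intro a b h
    have h' : a - b ∈ L.lattice := (Submodule.quotientRel_def L.lattice).mp h
    have := L.weierstrassP_add_coe b ⟨a - b, h'⟩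
    simpa using this)

/-- The Weierstrass coordinate `y = ℘'` on `E` (meaningful away from the origin). -/
def weierstrassY (L : PeriodPair) : EllipticTorus L → ℂ :=
  Quotient.lift L.derivWeierstrassP (by
    intro a b h
    have h' : a - b ∈ L.lattice := (Submodule.quotientRel_def L.lattice).mp h
    have := L.derivWeierstrassP_add_coe b ⟨a - b, h'⟩
    simpa using this)

/-- The point `{a_1, …, a_n}` of the symmetric product. -/
def symPoint {E : Type*} {n : ℕ} (a : Fin n → E) : Sym E n :=
  ⟨Finset.univ.val.map a, by simp⟩

/-- The Liouville curve `X_n ⊂ Symⁿ E`. -/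
def liouvilleCurve (n : ℕ) (L : PeriodPair) : Set (Sym (EllipticTorus L) n) :=
  {s | ∃ a : Fin n → EllipticTorus L, s = symPoint a ∧
    (∀ i, 2 • a i ≠ 0) ∧
    (∀ i j, i ≠ j → weierstrassX L (a i) ≠ weierstrassX L (a j)) ∧
    ∀ r : ℕ, r + 2 ≤ n → ∑ i, weierstrassX L (a i) ^ r * weierstrassY L (a i) = 0}

/-- The structure of `X_n` as a locally closed subvariety of `Symⁿ(E ∖ {0})`, whose coordinate
ring consists of the `S_n`-invariant polynomials in the Weierstrass coordinates `(x_i, y_i)`. -/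
def liouvilleStructure (n : ℕ) (L : PeriodPair) : VarietyStructure (liouvilleCurve n L) :=
  VarietyStructure.ofForms fun _ => {h | ∃ p : MvPolynomial (Fin n × Fin 2) ℂ,
    (∀ σ : Equiv.Perm (Fin n), MvPolynomial.rename (Prod.map σ id) p = p) ∧
    ∀ (a : Fin n → EllipticTorus L) (ha : symPoint a ∈ liouvilleCurve n L),
      h ⟨symPoint a, ha⟩ = MvPolynomial.eval
        (fun k => ![weierstrassX L (a k.1), weierstrassY L (a k.1)] k.2) p}

/-- `B = (2n - 1) ∑ x_i`. -/
def paramB {n : ℕ} (L : PeriodPair) (a : Fin n → EllipticTorus L) : ℂ :=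
  (2 * n - 1) * ∑ i, weierstrassX L (a i)

/-- `C = y_i ∏_{j ≠ i} (x_i - x_j)`. -/
def paramC {n : ℕ} (L : PeriodPair) (a : Fin n → EllipticTorus L) (i : Fin n) : ℂ :=
  weierstrassY L (a i) *
    ∏ j ∈ Finset.univ.erase i, (weierstrassX L (a i) - weierstrassX L (a j))

/-! ### The projective hyperelliptic curve -/

/-- The affine plane curve `w² = f(t)`. -/
def doubleCover (f : ℂ[X]) : Set (ℂ × ℂ) := {p | p.2 ^ 2 = f.eval p.1}

def doubleCoverStructure (f : ℂ[X]) : VarietyStructure (doubleCover f) :=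
  VarietyStructure.affine fun p => ![p.1.1, p.1.2]

/-- Homogeneous coordinates `Z_0, …, Z_{n+1}, W` on `ℙ^{n+2}`. -/
abbrev HypCoord (n : ℕ) : Type := Fin (n + 2) ⊕ Unit

def coordZ (n m : ℕ) (hm : m < n + 2) : MvPolynomial (HypCoord n) ℂ :=
  MvPolynomial.X (Sum.inl ⟨m, hm⟩)

/-- The quadric `W² - ∑_m f_m Z_{⌊m/2⌋} Z_{⌈m/2⌉}`, the homogeneous form of `C² = f(B)`. -/
def hypQuadric (n : ℕ) (f : ℂ[X]) : MvPolynomial (HypCoord n) ℂ :=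
  MvPolynomial.X (Sum.inr ()) ^ 2 - ∑ m : Fin (2 * n + 3),
    MvPolynomial.C (f.coeff m) *
      (coordZ n (m / 2) (by omega) * coordZ n ((m + 1) / 2) (by omega))

/-- The equations `Z_i Z_j = Z_k Z_l` for `i + j = k + l`, and `hypQuadric`. -/
def hypEquations (n : ℕ) (f : ℂ[X]) : Set (MvPolynomial (HypCoord n) ℂ) :=
  {p | ∃ i j k l : Fin (n + 2), (i : ℕ) + j = k + l ∧
    p = MvPolynomial.X (Sum.inl i) * MvPolynomial.X (Sum.inl j)
      - MvPolynomial.X (Sum.inl k) * MvPolynomial.X (Sum.inl l)} ∪ {hypQuadric n f}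

theorem isHomogeneous_of_mem_hypEquations {n : ℕ} {f : ℂ[X]} {p : MvPolynomial (HypCoord n) ℂ}
    (hp : p ∈ hypEquations n f) : p.IsHomogeneous 2 := by
  have hX : ∀ i j : HypCoord n,
      (MvPolynomial.X i * MvPolynomial.X j : MvPolynomial (HypCoord n) ℂ).IsHomogeneous 2 :=
    fun i j => (MvPolynomial.isHomogeneous_X ℂ i).mul (MvPolynomial.isHomogeneous_X ℂ j)
  rcases hp with ⟨i, j, k, l, -, rfl⟩ | rfl
  · exact (hX _ _).sub (hX _ _)
  · refine MvPolynomial.IsHomogeneous.sub ?_ (MvPolynomial.IsHomogeneous.sum _ _ _ ?_)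
    · rw [pow_two]; exact hX _ _
    · intro m _
      have h := (MvPolynomial.isHomogeneous_C (HypCoord n) (f.coeff m)).mul
        (hX (Sum.inl ⟨m / 2, by omega⟩) (Sum.inl ⟨(m + 1) / 2, by omega⟩))
      rw [zero_add] at h
      exact h

/-- The common zero locus in projective space of a set of homogeneous polynomials. -/
def projZeroLocus {ι : Type*} (T : Set (MvPolynomial ι ℂ)) : Set (ℙ ℂ (ι → ℂ)) :=
  {P | ∀ p ∈ T, MvPolynomial.eval P.rep p = 0}

/-- The projective hyperelliptic model of `C² = f(B)`, for `f` of degree at most `2n + 2`: the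
closed subvariety of `ℙ^{n+2}` parametrised by `[1 : B : ⋯ : B^{n+1} : C]`. -/
def hypModel (n : ℕ) (f : ℂ[X]) : Set (ℙ ℂ (HypCoord n → ℂ)) := projZeroLocus (hypEquations n f)

def hypStructure (n : ℕ) (f : ℂ[X]) : VarietyStructure (hypModel n f) :=
  VarietyStructure.projective Subtype.val

/-- The point `[1 : B : ⋯ : B^{n+1} : C]`. -/
def finitePoint (n : ℕ) (p : ℂ × ℂ) : ℙ ℂ (HypCoord n → ℂ) :=
  Projectivization.mk ℂ (Sum.elim (fun i : Fin (n + 2) => p.1 ^ (i : ℕ)) (fun _ => p.2))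
    (fun h => by simpa using congrFun h (Sum.inl 0))

/-- The point `[u^{n+1} : ⋯ : u : 1 : v]`. It is `finitePoint n (1 / u, v / u^{n+1})` for
`u ≠ 0`. -/
def pointNearInfinity (n : ℕ) (p : ℂ × ℂ) : ℙ ℂ (HypCoord n → ℂ) :=
  Projectivization.mk ℂ
    (Sum.elim (fun i : Fin (n + 2) => p.1 ^ (n + 1 - (i : ℕ))) (fun _ => p.2))
    (fun h => by simpa using congrFun h (Sum.inl (Fin.last (n + 1))))

/-- The projective line, with homogeneous coordinates `[Z_0 : Z_1]`. -/
abbrev ProjLine : Type := ℙ ℂ (Fin 2 → ℂ)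

def projLineStructure : VarietyStructure ProjLine := VarietyStructure.projective id

/-- The point `[1 : B]` of the projective line. -/
def linePoint (B : ℂ) : ProjLine :=
  Projectivization.mk ℂ ![1, B] (fun h => by simpa using congrFun h 0)

/-! ### The lattice attached to a point of the upper half plane -/

/-- The lattice `Λ_τ = ℤ + ℤτ`. -/
def latticeOf (τ : UpperHalfPlane) : PeriodPair where
  ω₁ := 1
  ω₂ := τ
  indep := by
    rw [LinearIndependent.pair_iff]
    intro s t h
    have him := congrArg Complex.im h
    have hre := congrArg Complex.re h
    have hτ : (τ : ℂ).im ≠ 0 := τ.im_ne_zero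
    simp at him hre
    rcases him with ht | ht
    · subst ht
      simpa using hre
    · exact absurd ht hτ

end

/-! Put p = 4x³ - g₂x - g₃ and Q = ∏ (x - x_i). The equations ∑ x_i^r y_i = 0 for r ≤ n - 2 say that
y_i Q'(x_i) is one constant C. Let ΔF = pF'' + p'F'/2 be the second derivative along E of a
polynomial F in x = ℘. Then 2QΔQ - pQ'² + C² has a double zero at every x_i and degree at most 2n +
1, so it is Q² times a linear polynomial 4(αx + β). Differentiating this relation shows that Q is
killed by the third order operator belonging to products of two solutions of Lamé's equation f'' =
(αx + β)f. Comparison of coefficients forces α = n(n + 1) and β = B, and it determines Q as Q_B = ∑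
(-1)^k s_k(B) x^{n-k}: the recursion for s_k is the differential equation read coefficientwise. The
first integral of the equation, evaluated at x = 0, is -ℓ_n(B); hence C² = ℓ_n(B)
(`prod_X_sub_C_eq_lameProduct`, `lameForm_lameProduct`).

Conversely, at a root of Q_B the first integral reads p Q_B'² = ℓ_n(B) = C². If C ≠ 0, the roots are
simple and y_i = C / Q_B'(x_i) defines a point of X_n (`exists_isLiouvilleTuple`). Symmetric
functions of the x_i are polynomials in B, and C y_i is a polynomial in the x_j, so invariant
functions on X_n become polynomials in B and C after multiplication by a power of C
(`exists_eval_invariant`). This makes the bijection an isomorphism onto the part C ≠ 0.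

On the projective model, Z_i Z_j = Z_k Z_l cuts out a rational normal curve, and the odd degree of
ℓ_n leaves a single point at infinity. Its topology is cofinite, since a function a(B) + b(B) C has
norm a² - b² ℓ_n, which is nonzero by parity unless a = b = 0. Irreducibility and dimension one
follow.

For the discriminant it suffices that ℓ_n has simple roots for one pair of invariants; (4, 0) is
used. When ℓ_n(B) = 0, Q_B is the square of a Lamé function f = √A · R, and f is an eigenfunction of
a self-adjoint problem over [-1, 0]. Lagrange's identity shows first that B is real, then that it is
a simple root (`derivative_lameEllAt_ne_zero`). With B, g₂, g₃ of weights 1, 2, 3, ℓ_n is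
homogeneous of weight 2n + 1; this gives the weight of the discriminant, and modularity follows
because g₂ and g₃ are multiples of E₄ and E₆. The modular form is nonzero at τ = i, where g₃ = 0 and
g₂ ≠ 0. -/

noncomputable section

/-! ### Elliptic functions and the Weierstrass parametrisation -/

/-- An elliptic function without poles has no zeros either, unless it vanishes identically. -/
theorem PeriodPair.meromorphicOrderAt_eq_zero_or_top (L : PeriodPair) {g : ℂ → ℂ}
    (hg : Meromorphic g) (hper : ∀ z, ∀ l ∈ L.lattice, g (z + l) = g z)
    (hord : ∀ z, 0 ≤ meromorphicOrderAt g z) (z : ℂ) :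
    meromorphicOrderAt g z = 0 ∨ meromorphicOrderAt g z = ⊤ := by
  have hg' : MeromorphicOn g Set.univ := fun z _ => hg z
  set h := toMeromorphicNFOn g Set.univ with hh
  have hnf := meromorphicNFOn_toMeromorphicNFOn g Set.univ
  have hho : ∀ z, meromorphicOrderAt h z = meromorphicOrderAt g z := fun z =>
    meromorphicOrderAt_toMeromorphicNFOn hg' (Set.mem_univ z)
  have han : ∀ z, AnalyticAt ℂ h z := fun z =>
    (hnf (Set.mem_univ z)).meromorphicOrderAt_nonneg_iff_analyticAt.mp (by rw [hho]; exact hord z)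
  have hgh : ∀ z, g =ᶠ[𝓝[≠] z] h := fun z =>
    (hg'.toMeromorphicNFOn_eq_self_on_nhdsNE (Set.mem_univ z)).symm
  -- `g` is periodic pointwise, but its normal form `h` is only known to agree with it on punctured
  -- neighbourhoods; periodicity of `h` follows by comparing limits.
  have hhper : ∀ z, ∀ l ∈ L.lattice, h (z + l) = h z := by
    intro z l hl
    have h1 : ContinuousAt (fun w => h (w + l)) z :=
      ContinuousAt.comp (f := fun w => w + l) (han (z + l)).continuousAt (by fun_prop)
    have h2 : ContinuousAt h z := (han z).continuousAt
    have h3 : ∀ᶠ w in 𝓝[≠] z, g (w + l) = h (w + l) := by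
      have ht : Filter.Tendsto (fun w => w + l) (𝓝[≠] z) (𝓝[≠] (z + l)) := by
        refine tendsto_nhdsWithin_of_tendsto_nhds_of_eventually_within _ ?_ ?_
        · exact (Continuous.tendsto (by fun_prop) z).mono_left nhdsWithin_le_nhds
        · filter_upwards [self_mem_nhdsWithin] with w hw
          simpa using hw
      exact ht.eventually (hgh (z + l))
    have h4 : (fun w => h (w + l)) =ᶠ[𝓝[≠] z] h := by
      filter_upwards [h3, hgh z] with w hw1 hw2
      rw [← hw1, ← hw2, hper w l hl]
    exact tendsto_nhds_unique ((h1.tendsto.mono_left nhdsWithin_le_nhds).congr' h4)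
      (h2.tendsto.mono_left nhdsWithin_le_nhds)
  have hd : Differentiable ℂ h := fun z => (han z).differentiableAt
  have hconst : ∀ w, h w = h z := fun w => hd.apply_eq_apply_of_bounded
    (IsZLattice.isCompact_range_of_periodic L.lattice _ hd.continuous hhper).isBounded w z
  have hc : h = fun _ => h z := funext hconst
  rw [← hho z, hc]
  classical
  rw [meromorphicOrderAt_const]
  by_cases h0 : h z = 0 <;> simp [h0]

namespace PeriodPair

variable (L : PeriodPair)

/-- The function `u ↦ ℘(u) - c`. -/
def wpSub (c : ℂ) (u : ℂ) : ℂ := L.weierstrassP u - c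

theorem meromorphic_wpSub (c : ℂ) : Meromorphic (L.wpSub c) := fun z =>
  (L.meromorphic_weierstrassP z).sub (MeromorphicAt.const c z)

theorem wpSub_add_lattice (c z l : ℂ) (hl : l ∈ L.lattice) : L.wpSub c (z + l) = L.wpSub c z := by
  have := L.weierstrassP_add_coe z ⟨l, hl⟩
  simp only [wpSub]
  rw [← this]

theorem analyticAt_wpSub (c : ℂ) {z : ℂ} (hz : z ∉ L.lattice) : AnalyticAt ℂ (L.wpSub c) z :=
  (L.analyticOnNhd_weierstrassP z hz).sub analyticAt_const

theorem meromorphicOrderAt_wpSub_of_mem (c : ℂ) {l : ℂ} (hl : l ∈ L.lattice) :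
    meromorphicOrderAt (L.wpSub c) l = -2 := by
  have h : L.wpSub c = L.weierstrassP + fun _ => -c := by
    ext u; simp [wpSub, sub_eq_add_neg]
  rw [h, meromorphicOrderAt_add_eq_left_of_lt (MeromorphicAt.const _ _), L.order_weierstrassP l hl]
  rw [L.order_weierstrassP l hl]
  exact lt_of_lt_of_le (b := 0) (by decide) analyticAt_const.meromorphicOrderAt_nonneg

theorem meromorphicOrderAt_wpSub_nonneg (c : ℂ) {z : ℂ} (hz : z ∉ L.lattice) :
    0 ≤ meromorphicOrderAt (L.wpSub c) z := (L.analyticAt_wpSub c hz).meromorphicOrderAt_nonneg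

theorem meromorphicOrderAt_wpSub_ne_top (c z : ℂ) : meromorphicOrderAt (L.wpSub c) z ≠ ⊤ := by
  refine (Meromorphic.exists_meromorphicOrderAt_ne_top_iff_forall (L.meromorphic_wpSub c)).mp
    ⟨0, ?_⟩ z
  rw [L.meromorphicOrderAt_wpSub_of_mem c (zero_mem _)]
  decide

theorem one_le_meromorphicOrderAt_wpSub {c z : ℂ} (hz : z ∉ L.lattice)
    (h : L.weierstrassP z = c) : 1 ≤ meromorphicOrderAt (L.wpSub c) z := by
  have ha := L.analyticAt_wpSub c hz
  rw [ha.meromorphicOrderAt_eq]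
  have : 1 ≤ analyticOrderAt (L.wpSub c) z := by
    rw [Order.one_le_iff_ne_zero, ha.analyticOrderAt_ne_zero]
    simp [wpSub, h]
  exact ENat.monotone_map_iff.mpr Nat.mono_cast this

theorem two_le_meromorphicOrderAt_wpSub {c z : ℂ} (hz : z ∉ L.lattice)
    (h : L.weierstrassP z = c) (h' : L.derivWeierstrassP z = 0) :
    2 ≤ meromorphicOrderAt (L.wpSub c) z := by
  have ha := L.analyticAt_wpSub c hz
  rw [ha.meromorphicOrderAt_eq]
  have : (2 : ℕ) ≤ analyticOrderAt (L.wpSub c) z := by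
    rw [natCast_le_analyticOrderAt_iff_iteratedDeriv_eq_zero ha]
    intro i hi
    interval_cases i
    · simp [wpSub, h]
    · have : L.wpSub c = fun u => L.weierstrassP u - c := rfl
      rw [iteratedDeriv_one, this, deriv_sub_const, L.deriv_weierstrassP, h']
  exact ENat.monotone_map_iff.mpr Nat.mono_cast this

theorem meromorphicOrderAt_wpSub_of_ne {c z : ℂ} (hz : z ∉ L.lattice)
    (h : L.weierstrassP z ≠ c) : meromorphicOrderAt (L.wpSub c) z = 0 := by
  have ha := L.analyticAt_wpSub c hz
  rw [ha.meromorphicOrderAt_eq, ha.analyticOrderAt_eq_zero.mpr (by simpa [wpSub, sub_eq_zero])]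
  rfl

/-- If ℘ omitted c, then 1/(℘ - c) would be elliptic without poles, yet with a double zero at the
origin. -/
theorem exists_weierstrassP_eq (c : ℂ) : ∃ z, z ∉ L.lattice ∧ L.weierstrassP z = c := by
  by_contra! hne
  have h0 : meromorphicOrderAt (L.wpSub c)⁻¹ 0 = 2 := by
    rw [meromorphicOrderAt_inv, L.meromorphicOrderAt_wpSub_of_mem c (zero_mem _)]
    rfl
  have := L.meromorphicOrderAt_eq_zero_or_top (g := (L.wpSub c)⁻¹)
    (fun z => (L.meromorphic_wpSub c z).inv)
    (fun z l hl => by simp [L.wpSub_add_lattice c z l hl]) (fun z => by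
      rw [meromorphicOrderAt_inv]
      by_cases hz : z ∈ L.lattice
      · rw [L.meromorphicOrderAt_wpSub_of_mem c hz]; decide
      · rw [L.meromorphicOrderAt_wpSub_of_ne hz (hne z hz)]; decide) 0
  rw [h0] at this
  revert this
  decide

/-- The order of `u ↦ ℘(u) - c` as an integer. -/
def wpOrder (c x : ℂ) : ℤ := (meromorphicOrderAt (L.wpSub c) x).untop
  (L.meromorphicOrderAt_wpSub_ne_top c x)

theorem coe_wpOrder (c x : ℂ) : (L.wpOrder c x : WithTop ℤ) = meromorphicOrderAt (L.wpSub c) x :=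
  WithTop.coe_untop _ _

theorem wpOrder_of_mem (c : ℂ) {l : ℂ} (hl : l ∈ L.lattice) : L.wpOrder c l = -2 := by
  have := L.meromorphicOrderAt_wpSub_of_mem c hl
  rw [← coe_wpOrder] at this
  exact WithTop.coe_injective this

theorem wpOrder_nonneg (c : ℂ) {z : ℂ} (hz : z ∉ L.lattice) : 0 ≤ L.wpOrder c z := by
  have := L.meromorphicOrderAt_wpSub_nonneg c hz
  rw [← coe_wpOrder] at this
  exact_mod_cast this

theorem one_le_wpOrder {c z : ℂ} (hz : z ∉ L.lattice) (h : L.weierstrassP z = c) :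
    1 ≤ L.wpOrder c z := by
  have := L.one_le_meromorphicOrderAt_wpSub hz h
  rw [← coe_wpOrder] at this
  exact_mod_cast this

theorem two_le_wpOrder {c z : ℂ} (hz : z ∉ L.lattice) (h : L.weierstrassP z = c)
    (h' : L.derivWeierstrassP z = 0) : 2 ≤ L.wpOrder c z := by
  have := L.two_le_meromorphicOrderAt_wpSub hz h h'
  rw [← coe_wpOrder] at this
  exact WithTop.coe_le_coe.mp this

/-- The order at `x` of a product of translates of `℘ - c`. -/
theorem meromorphicOrderAt_prod_wpSub {ι : Type*} (s : Finset ι) (a : ι → ℂ) (c x : ℂ) :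
    meromorphicOrderAt (∏ i ∈ s, fun u => L.wpSub c (u - a i)) x =
      ((∑ i ∈ s, L.wpOrder c (x - a i) : ℤ) : WithTop ℤ) := by
  have hm : ∀ i, MeromorphicAt (fun u => L.wpSub c (u - a i)) x := fun i =>
    MeromorphicAt.comp_analyticAt (g := fun u => u - a i) (L.meromorphic_wpSub c (x - a i))
      (by fun_prop)
  rw [meromorphicOrderAt_prod fun i _ => hm i, WithTop.coe_sum]
  refine Finset.sum_congr rfl fun i _ => ?_
  rw [coe_wpOrder]
  exact meromorphicOrderAt_comp_sub_const_eq_meromorphicOrderAt (f := L.wpSub c)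

/-- If a product of translates of `℘ - c` has no poles then it has no zeros. -/
theorem sum_wpOrder_eq_zero {ι : Type*} (s : Finset ι) (a : ι → ℂ) (c : ℂ)
    (h : ∀ x, 0 ≤ ∑ i ∈ s, L.wpOrder c (x - a i)) (x : ℂ) :
    ∑ i ∈ s, L.wpOrder c (x - a i) = 0 := by
  have := L.meromorphicOrderAt_eq_zero_or_top (g := ∏ i ∈ s, fun u => L.wpSub c (u - a i))
    (fun x => MeromorphicAt.prod fun i _ => MeromorphicAt.comp_analyticAt (g := fun u => u - a i)
      (L.meromorphic_wpSub c (x - a i)) (by fun_prop))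
    (fun z l hl => by
      simp only [Finset.prod_apply]
      refine Finset.prod_congr rfl fun i _ => ?_
      rw [add_sub_right_comm, L.wpSub_add_lattice c _ l hl])
    (fun x => by
      rw [L.meromorphicOrderAt_prod_wpSub]
      exact_mod_cast h x) x
  rw [L.meromorphicOrderAt_prod_wpSub] at this
  exact WithTop.coe_injective (this.resolve_right (WithTop.coe_ne_top))

theorem weierstrassP_eq_of_sub_mem {z w : ℂ} (h : z - w ∈ L.lattice) :
    L.weierstrassP z = L.weierstrassP w := by
  have := L.weierstrassP_add_coe w ⟨z - w, h⟩
  simpa using this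

theorem derivWeierstrassP_eq_of_sub_mem {z w : ℂ} (h : z - w ∈ L.lattice) :
    L.derivWeierstrassP z = L.derivWeierstrassP w := by
  have := L.derivWeierstrassP_add_coe w ⟨z - w, h⟩
  simpa using this

theorem mem_lattice_iff_of_sub_mem {z w : ℂ} (h : z - w ∈ L.lattice) :
    z ∈ L.lattice ↔ w ∈ L.lattice := by
  constructor <;> intro h'
  · simpa using sub_mem h' h
  · simpa using add_mem h h'

/-- With c = ℘(z), the product (℘(u) - c)(℘(u - z) - c) has no poles: each double pole meets a
double zero of the other factor, because ℘' vanishes at ±z. It would still vanish at u = -z if 2z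
were outside the lattice. Such products of translates replace the count of zeros and poles in a
period parallelogram. -/
theorem two_mul_mem_of_derivWeierstrassP_eq_zero {z : ℂ} (hz : z ∉ L.lattice)
    (h : L.derivWeierstrassP z = 0) : 2 * z ∈ L.lattice := by
  by_contra h2
  have hz' : -z ∉ L.lattice := by rwa [neg_mem_iff]
  have key : ∀ x, x - z ∈ L.lattice ∨ x + z ∈ L.lattice →
      2 ≤ L.wpOrder (L.weierstrassP z) x := by
    rintro x (hx | hx)
    · exact L.two_le_wpOrder (by rwa [L.mem_lattice_iff_of_sub_mem hx])
        (L.weierstrassP_eq_of_sub_mem hx) (by rw [L.derivWeierstrassP_eq_of_sub_mem hx, h])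
    · rw [← sub_neg_eq_add] at hx
      exact L.two_le_wpOrder (by rwa [L.mem_lattice_iff_of_sub_mem hx])
        (by rw [L.weierstrassP_eq_of_sub_mem hx, L.weierstrassP_neg])
        (by rw [L.derivWeierstrassP_eq_of_sub_mem hx, L.derivWeierstrassP_neg, h, neg_zero])
  have := L.sum_wpOrder_eq_zero Finset.univ ![0, z] (L.weierstrassP z) (fun x => by
    simp only [Fin.sum_univ_two, Matrix.cons_val_zero, Matrix.cons_val_one, sub_zero]
    by_cases hx : x ∈ L.lattice
    · have := key (x - z) (Or.inr (by simpa using hx))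
      have := L.wpOrder_of_mem (L.weierstrassP z) hx
      omega
    by_cases hx' : x - z ∈ L.lattice
    · have := key x (Or.inl hx')
      have := L.wpOrder_of_mem (L.weierstrassP z) hx'
      omega
    have := L.wpOrder_nonneg (L.weierstrassP z) hx
    have := L.wpOrder_nonneg (L.weierstrassP z) hx'
    omega) (-z)
  simp only [Fin.sum_univ_two, Matrix.cons_val_zero, Matrix.cons_val_one, sub_zero] at this
  have h1 := key (-z) (Or.inr (by simp))
  have h3 := L.wpOrder_nonneg (L.weierstrassP z) (z := -z - z) (by
    rw [← neg_mem_iff]; ring_nf; rwa [mul_comm])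
  omega

/-- Oddness and periodicity also apply to the default value of ℘' at lattice points. Hence ℘' ≠ 0
excludes all of E[2], the origin included. -/
theorem derivWeierstrassP_eq_zero_of_two_mul_mem {z : ℂ} (h : 2 * z ∈ L.lattice) :
    L.derivWeierstrassP z = 0 := by
  have := L.derivWeierstrassP_eq_of_sub_mem (z := z) (w := -z) (by ring_nf; rwa [mul_comm])
  rw [L.derivWeierstrassP_neg] at this
  exact CharZero.eq_neg_self_iff.mp this

/-- If z and w were different up to sign, then ℘ - c would vanish at ±z and ±w. The product of its
translates by 0, z, w, z + w has every double pole cancelled by two zeros, so it has order 0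
everywhere. Its first factor vanishes at -z, so another factor has a pole there, which forces 2z + w
into the lattice; likewise 2w + z at -w. The difference is z - w, a contradiction. -/
theorem sub_mem_or_add_mem_of_weierstrassP_eq {z w : ℂ} (hz : z ∉ L.lattice) (hw : w ∉ L.lattice)
    (h : L.weierstrassP z = L.weierstrassP w) (h0 : L.derivWeierstrassP z ≠ 0) :
    z - w ∈ L.lattice ∨ z + w ∈ L.lattice := by
  by_contra! hne
  obtain ⟨hs, ha⟩ := hne
  have h0' : L.derivWeierstrassP w ≠ 0 := by
    intro hw0
    have h1 := L.derivWeierstrassP_sq z hz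
    have h2 := L.derivWeierstrassP_sq w hw
    rw [h, ← h2, hw0] at h1
    simp [h0] at h1
  have h2z : 2 * z ∉ L.lattice := fun h' => h0 (L.derivWeierstrassP_eq_zero_of_two_mul_mem h')
  have h2w : 2 * w ∉ L.lattice := fun h' => h0' (L.derivWeierstrassP_eq_zero_of_two_mul_mem h')
  set c := L.weierstrassP z with hc
  have key : ∀ x, x - z ∈ L.lattice ∨ x + z ∈ L.lattice ∨ x - w ∈ L.lattice ∨
      x + w ∈ L.lattice → 1 ≤ L.wpOrder c x := by
    rintro x (hx | hx | hx | hx)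
    · exact L.one_le_wpOrder (by rwa [L.mem_lattice_iff_of_sub_mem hx])
        (L.weierstrassP_eq_of_sub_mem hx)
    · rw [← sub_neg_eq_add] at hx
      exact L.one_le_wpOrder (by rwa [L.mem_lattice_iff_of_sub_mem hx, neg_mem_iff])
        (by rw [L.weierstrassP_eq_of_sub_mem hx, L.weierstrassP_neg])
    · exact L.one_le_wpOrder (by rwa [L.mem_lattice_iff_of_sub_mem hx])
        (by rw [L.weierstrassP_eq_of_sub_mem hx, h])
    · rw [← sub_neg_eq_add] at hx
      exact L.one_le_wpOrder (by rwa [L.mem_lattice_iff_of_sub_mem hx, neg_mem_iff])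
        (by rw [L.weierstrassP_eq_of_sub_mem hx, L.weierstrassP_neg, h])
  have hsum := L.sum_wpOrder_eq_zero Finset.univ ![0, z, w, z + w] c (fun x => by
    simp only [Fin.sum_univ_four, Matrix.cons_val_zero, Matrix.cons_val_one, Matrix.cons_val,
      sub_zero]
    have hnn := fun y => L.wpOrder_nonneg c (z := y)
    by_cases hx : x ∈ L.lattice
    · have h1 := key (x - z) (Or.inr (Or.inl (by simpa using hx)))
      have h2 := key (x - w) (Or.inr (Or.inr (Or.inr (by simpa using hx))))
      have h3 := hnn (x - (z + w)) fun h' => ha (by simpa using sub_mem hx h')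
      have h4 := L.wpOrder_of_mem c hx
      omega
    by_cases hxz : x - z ∈ L.lattice
    · have h1 := key x (Or.inl hxz)
      have h2 := key (x - (z + w)) (Or.inr (Or.inr (Or.inr (by ring_nf; exact hxz))))
      have h3 := hnn (x - w) fun h' => hs (by simpa using sub_mem h' hxz)
      have h4 := L.wpOrder_of_mem c hxz
      omega
    by_cases hxw : x - w ∈ L.lattice
    · have h1 := key x (Or.inr (Or.inr (Or.inl hxw)))
      have h2 := key (x - (z + w)) (Or.inr (Or.inl (by
        ring_nf; exact hxw)))
      have h4 := L.wpOrder_of_mem c hxw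
      have h3 := hnn (x - z) hxz
      omega
    by_cases hxzw : x - (z + w) ∈ L.lattice
    · have h1 := key (x - z) (Or.inr (Or.inr (Or.inl (by rwa [sub_sub]))))
      have h2 := key (x - w) (Or.inl (by rwa [sub_sub, add_comm w z]))
      have h4 := L.wpOrder_of_mem c hxzw
      have h3 := hnn x hx
      omega
    have h1 := hnn _ hx
    have h2 := hnn _ hxz
    have h3 := hnn _ hxw
    have h4 := hnn _ hxzw
    omega)
  simp only [Fin.sum_univ_four, Matrix.cons_val_zero, Matrix.cons_val_one, Matrix.cons_val,
    sub_zero] at hsum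
  have hneg : ∀ y ∉ L.lattice, 0 ≤ L.wpOrder c (-y) := fun y hy =>
    L.wpOrder_nonneg c (by rwa [neg_mem_iff])
  have hA : 2 * z + w ∈ L.lattice := by
    by_contra hcon
    have h1 := key (-z) (Or.inr (Or.inl (by simp)))
    have h2 := hneg _ h2z
    have h3 := hneg _ ha
    have h4 := hneg _ hcon
    have := hsum (-z)
    rw [show -z - z = -(2 * z) by ring, show -z - w = -(z + w) by ring,
      show -z - (z + w) = -(2 * z + w) by ring] at this
    omega
  have hB : 2 * w + z ∈ L.lattice := by
    by_contra hcon
    have h1 := key (-w) (Or.inr (Or.inr (Or.inr (by simp))))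
    have h2 := hneg _ h2w
    have h3 := hneg _ ha
    have h4 := hneg _ hcon
    have := hsum (-w)
    rw [show -w - w = -(2 * w) by ring, show -w - z = -(z + w) by ring,
      show -w - (z + w) = -(2 * w + z) by ring] at this
    omega
  refine hs ?_
  have := sub_mem hA hB
  ring_nf at this
  exact this

end PeriodPair

/-- A point of `E` outside `E[2]` has nonzero `y`-coordinate and lies on the Weierstrass cubic. -/
theorem weierstrassY_ne_zero {L : PeriodPair} {a : EllipticTorus L} (ha : 2 • a ≠ 0) :
    weierstrassY L a ≠ 0 := by
  obtain ⟨z, rfl⟩ := Submodule.Quotient.mk_surjective _ a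
  intro h
  refine ha ?_
  rw [← Submodule.Quotient.mk_smul, Submodule.Quotient.mk_eq_zero, nsmul_eq_mul]
  by_cases hz : z ∈ L.lattice
  · simpa using add_mem hz hz |> (two_mul z ▸ ·)
  · exact_mod_cast L.two_mul_mem_of_derivWeierstrassP_eq_zero hz h

theorem two_nsmul_ne_zero_of_weierstrassY {L : PeriodPair} {a : EllipticTorus L}
    (ha : weierstrassY L a ≠ 0) : 2 • a ≠ 0 := by
  obtain ⟨z, rfl⟩ := Submodule.Quotient.mk_surjective _ a
  intro h
  rw [← Submodule.Quotient.mk_smul, Submodule.Quotient.mk_eq_zero, nsmul_eq_mul] at h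
  exact ha (L.derivWeierstrassP_eq_zero_of_two_mul_mem (by exact_mod_cast h))

theorem weierstrass_equation {L : PeriodPair} {a : EllipticTorus L} (ha : 2 • a ≠ 0) :
    weierstrassY L a ^ 2 =
      4 * weierstrassX L a ^ 3 - L.g₂ * weierstrassX L a - L.g₃ := by
  obtain ⟨z, rfl⟩ := Submodule.Quotient.mk_surjective _ a
  refine L.derivWeierstrassP_sq z fun hz => ha ?_
  rw [(Submodule.Quotient.mk_eq_zero _).mpr hz, smul_zero]

theorem exists_point_of_weierstrass_equation (L : PeriodPair) {x y : ℂ}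
    (h : y ^ 2 = 4 * x ^ 3 - L.g₂ * x - L.g₃) :
    ∃ a : EllipticTorus L, weierstrassX L a = x ∧ weierstrassY L a = y := by
  obtain ⟨z, hz, hx⟩ := L.exists_weierstrassP_eq x
  have h2 := L.derivWeierstrassP_sq z hz
  rw [hx, ← h, sq_eq_sq_iff_eq_or_eq_neg] at h2
  rcases h2 with h2 | h2
  · exact ⟨Submodule.Quotient.mk z, hx, h2⟩
  · refine ⟨Submodule.Quotient.mk (-z), (L.weierstrassP_neg z).trans hx, ?_⟩
    change L.derivWeierstrassP (-z) = y
    rw [L.derivWeierstrassP_neg, h2, neg_neg]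

/-- Equal x-coordinates leave b = ±a, and the nonzero y-coordinate decides the sign. -/
theorem point_ext {L : PeriodPair} {a b : EllipticTorus L} (ha : 2 • a ≠ 0) (hb : 2 • b ≠ 0)
    (hx : weierstrassX L a = weierstrassX L b) (hy : weierstrassY L a = weierstrassY L b) :
    a = b := by
  have hya := weierstrassY_ne_zero ha
  obtain ⟨z, rfl⟩ := Submodule.Quotient.mk_surjective _ a
  obtain ⟨w, rfl⟩ := Submodule.Quotient.mk_surjective _ b
  have hz : z ∉ L.lattice := fun hz => ha (by
    rw [(Submodule.Quotient.mk_eq_zero _).mpr hz, smul_zero])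
  have hw : w ∉ L.lattice := fun hw => hb (by
    rw [(Submodule.Quotient.mk_eq_zero _).mpr hw, smul_zero])
  rcases L.sub_mem_or_add_mem_of_weierstrassP_eq hz hw hx hya with h | h
  · exact (Submodule.Quotient.eq _).mpr h
  · have h1 := L.derivWeierstrassP_eq_of_sub_mem (z := z) (w := -w) (by simpa using h)
    rw [L.derivWeierstrassP_neg] at h1
    change L.derivWeierstrassP z = L.derivWeierstrassP w at hy
    rw [← hy] at h1
    exact absurd (CharZero.eq_neg_self_iff.mp h1) hya

/-! ### The third order equation for products of Lamé functions -/

section LameOperators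

/-- The polynomial `∑ₖ (-1)^k s_k x^{n-k}`. -/
def alternatingPoly {K : Type*} [Field K] (n : ℕ) (s : ℤ → K) : K[X] :=
  ∑ k ∈ Finset.range (n + 1), C ((-1) ^ k * s k) * X ^ (n - k)

theorem coeff_alternatingPoly {K : Type*} [Field K] (n : ℕ) (s : ℤ → K) (hs : ∀ k < 0, s k = 0) (μ : ℕ) :
    (alternatingPoly n s).coeff μ = (-1) ^ (n + μ) * s (n - μ) := by
  simp only [alternatingPoly, finsetSum_coeff, coeff_C_mul, coeff_X_pow]
  by_cases h : μ ≤ n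
  · rw [Finset.sum_eq_single (n - μ)]
    · have h1 : n - (n - μ) = μ := by omega
      have h2 : n + μ = (n - μ) + 2 * μ := by omega
      rw [h1, h2, pow_add, pow_mul, Nat.cast_sub h]
      simp
    · intro k hk hne
      rw [if_neg, mul_zero]
      have := Finset.mem_range.mp hk
      omega
    · intro hk
      exact absurd (Finset.mem_range.mpr (by omega)) hk
  · rw [hs _ (by omega), mul_zero]
    refine Finset.sum_eq_zero fun k hk => ?_
    rw [if_neg (by omega), mul_zero]

variable {K : Type*} [Field K] [CharZero K]

/-- The Weierstrass cubic `4x³ - g₂x - g₃`. -/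
def weierstrassCubic (g₂ g₃ : K) : K[X] := C 4 * X ^ 3 - C g₂ * X - C g₃

/-- The second derivative along the elliptic curve, on polynomials in `x = ℘`. -/
def curveLaplacian (p Q : K[X]) : K[X] :=
  p * derivative (derivative Q) + C (1 / 2) * derivative p * derivative Q

/-- The third order operator annihilating the products of two solutions of
`f'' = (αx + β) f`. -/
def lameProductOp (p : K[X]) (α β : K) (Q : K[X]) : K[X] :=
  derivative (curveLaplacian p Q) - 4 * derivative Q * (C α * X + C β) - 2 * C α * Q

/-- The bilinear first integral of `lameProductOp`. -/
def lameForm (p : K[X]) (α β : K) (Q T : K[X]) : K[X] :=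
  Q * curveLaplacian p T + T * curveLaplacian p Q - p * derivative Q * derivative T
    - 4 * Q * T * (C α * X + C β)

/-- With F = Q(℘), G = T(℘) and V = αx + β, the form is FG'' + GF'' - F'G' - 4VFG. For F = G = f₁f₂
with f₁, f₂ solutions of f'' = Vf, it is minus the square of their Wronskian, hence constant. -/
theorem derivative_lameForm (p : K[X]) (α β : K) (Q T : K[X]) :
    derivative (lameForm p α β Q T) = Q * lameProductOp p α β T + T * lameProductOp p α β Q := by
  have h2 : (C (1 / 2 : K)) * 2 = 1 := by
    rw [← C_ofNat, ← C_mul]; norm_num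
  simp only [lameForm, lameProductOp, curveLaplacian, derivative_sub, derivative_add,
    derivative_mul, derivative_C, derivative_X, derivative_ofNat]
  linear_combination (derivative p * derivative Q * derivative T) * h2

theorem coeff_X_mul_derivative' (Q : K[X]) (μ : ℕ) :
    (X * derivative Q).coeff μ = μ * Q.coeff μ := by
  cases μ with
  | zero => simp
  | succ k => rw [coeff_X_mul, coeff_derivative]; push_cast; ring

/-- The diagonal coefficient factors as 2(2μ + 1)(μ(μ + 1) - α). Its zeros decide which degrees a
polynomial solution can have. -/
theorem coeff_lameProductOp (g₂ g₃ α β : K) (Q : K[X]) (μ : ℕ) :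
    (lameProductOp (weierstrassCubic g₂ g₃) α β Q).coeff μ =
      (4 * μ ^ 3 + 6 * μ ^ 2 + 2 * μ - 4 * α * μ - 2 * α) * Q.coeff μ
      - 4 * β * (μ + 1) * Q.coeff (μ + 1)
      - 1 / 2 * g₂ * (μ + 1) * (μ + 2) * (2 * μ + 3) * Q.coeff (μ + 2)
      - g₃ * (μ + 1) * (μ + 2) * (μ + 3) * Q.coeff (μ + 3) := by
  set D : K[X] → K[X] := fun P => derivative P with hD
  -- Rewriting through the Euler operator X·d/dX, which multiplies the coefficient of index μ by μ,
  -- makes the coefficients readable.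
  have h : lameProductOp (weierstrassCubic g₂ g₃) α β Q =
      C 4 * (X * D (X * D (X * D Q))) + C 6 * (X * D (X * D Q)) + C 2 * (X * D Q)
      - C (4 * α) * (X * D Q) - C (2 * α) * Q - C (4 * β) * D Q
      - C g₂ * (X * D (D (D Q))) - C (3 / 2 * g₂) * D (D Q) - C g₃ * D (D (D Q)) := by
    have h2 : (C (1 / 2 : K)) * 2 = 1 := by
      rw [← C_ofNat, ← C_mul]; norm_num
    have h3 : (C (3 / 2 : K)) = 3 * C (1 / 2 : K) := by
      rw [← C_ofNat, ← C_mul]; norm_num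
    simp only [hD, lameProductOp, curveLaplacian, weierstrassCubic, derivative_sub,
      derivative_add, derivative_mul, derivative_C, derivative_X, C_mul, h3, derivative_zero,
      derivative_one, derivative_pow]
    push_cast
    simp only [C_ofNat]
    linear_combination (C g₂ * derivative (derivative Q) + 6 * X ^ 2 * derivative (derivative Q)
      + 12 * X * derivative Q) * h2
  rw [h]
  simp only [coeff_sub, coeff_add, coeff_C_mul, hD, coeff_X_mul_derivative', coeff_derivative]
  push_cast
  ring

/-- For α = n(n + 1) the diagonal coefficient is -2(n - μ)(2μ + 1)(n + μ + 1), and the coefficient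
of x^μ is, up to sign, the right side of the recursion for s_{n-μ}. -/
theorem coeff_lameProductOp_alternatingPoly (n : ℕ) (g₂ g₃ β : K) (s : ℤ → K)
    (hs : ∀ k < 0, s k = 0) (μ : ℕ) :
    (lameProductOp (weierstrassCubic g₂ g₃) (n * (n + 1)) β (alternatingPoly n s)).coeff μ =
      (-1) ^ (n + μ + 1) * (2 * ((n : K) - μ) * (2 * μ + 1) * (n + μ + 1) * s (n - μ)
        - 4 * (μ + 1) * β * s (n - μ - 1)
        + 1 / 2 * g₂ * (μ + 1) * (μ + 2) * (2 * μ + 3) * s (n - μ - 2)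
        - g₃ * (μ + 1) * (μ + 2) * (μ + 3) * s (n - μ - 3)) := by
  rw [coeff_lameProductOp]
  simp only [coeff_alternatingPoly n s hs]
  have h1 : ((n : ℤ) - (μ + 1 : ℕ)) = n - μ - 1 := by push_cast; ring
  have h2 : ((n : ℤ) - (μ + 2 : ℕ)) = n - μ - 2 := by push_cast; ring
  have h3 : ((n : ℤ) - (μ + 3 : ℕ)) = n - μ - 3 := by push_cast; ring
  rw [h1, h2, h3]
  simp only [← add_assoc, pow_succ]
  ring

theorem eq_C_coeff_zero_of_derivative_eq_zero {P : K[X]} (h : derivative P = 0) :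
    P = C (P.coeff 0) :=
  eq_C_of_natDegree_eq_zero (derivative_eq_zero.mp h)

/-- Constancy of the first integral lets it be computed at x = 0, where p = -g₃ and p' = -g₂; this
is the source of the shape of ℓ_n. -/
theorem coeff_zero_lameForm (g₂ g₃ α β : K) (Q T : K[X]) :
    (lameForm (weierstrassCubic g₂ g₃) α β Q T).coeff 0 =
      -(2 * g₃ * T.coeff 2 + 1 / 2 * g₂ * T.coeff 1) * Q.coeff 0
      - (2 * g₃ * Q.coeff 2 + 1 / 2 * g₂ * Q.coeff 1) * T.coeff 0
      + g₃ * Q.coeff 1 * T.coeff 1 - 4 * β * Q.coeff 0 * T.coeff 0 := by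
  simp only [lameForm, curveLaplacian, weierstrassCubic, coeff_sub, coeff_add, mul_coeff_zero,
    coeff_derivative, coeff_C_mul, coeff_X_pow, coeff_ofNat_zero,
    coeff_X, coeff_C]
  norm_num
  ring

end LameOperators

/-! ### The polynomials `s_k` at given invariants -/

section LameSequence

variable {K : Type*} [Field K] [CharZero K]

/-- The substitution of values for `g₂, g₃`. -/
def evalInvariants (g₂ g₃ : K) : InvariantRing →+* K :=
  (MvPolynomial.aeval (R := ℚ) ![g₂, g₃]).toRingHom

theorem evalInvariants_X_zero (g₂ g₃ : K) : evalInvariants g₂ g₃ (MvPolynomial.X 0) = g₂ := by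
  simp [evalInvariants]

theorem evalInvariants_X_one (g₂ g₃ : K) : evalInvariants g₂ g₃ (MvPolynomial.X 1) = g₃ := by
  simp [evalInvariants]

theorem map_evalInvariants_smul (g₂ g₃ : K) (r : ℚ) (P : InvariantRing[X]) :
    (r • P).map (evalInvariants g₂ g₃) = C (r : K) * P.map (evalInvariants g₂ g₃) := by
  ext i
  have h : evalInvariants g₂ g₃ (MvPolynomial.C r) = (r : K) := by simp [evalInvariants]
  simp [coeff_map, MvPolynomial.smul_eq_C_mul, h]

/-- The polynomials `s_k(B) ∈ K[B]` at given values of `g₂, g₃`. -/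
def lameSAt (n : ℕ) (g₂ g₃ : K) (k : ℤ) : K[X] := (lameS n k).map (evalInvariants g₂ g₃)

/-- The polynomial `ℓ_n(B) ∈ K[B]` at given values of `g₂, g₃`. -/
def lameEllAt (n : ℕ) (g₂ g₃ : K) : K[X] := (lamePoly n).map (evalInvariants g₂ g₃)

theorem lameSAt_zero (n : ℕ) (g₂ g₃ : K) : lameSAt n g₂ g₃ 0 = 1 := by
  simp [lameSAt, lameS_zero]

theorem lameSAt_neg (n : ℕ) (g₂ g₃ : K) (k : ℤ) (hk : k < 0) : lameSAt n g₂ g₃ k = 0 := by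
  simp [lameSAt, lameS_neg n k hk]

/-- No bound on μ is needed: for μ = n the factor n - μ and the terms of negative index vanish, and
for μ > n all indices are negative. The differential equation thus holds in every degree. -/
theorem lameSAt_recursion (n : ℕ) (g₂ g₃ : K) (μ : ℕ) :
    C (2 * ((n : K) - μ) * (2 * μ + 1) * (n + μ + 1)) * lameSAt n g₂ g₃ (n - μ)
      - C (4 * ((μ : K) + 1)) * (X * lameSAt n g₂ g₃ (n - μ - 1))
      + C (1 / 2 * g₂ * ((μ : K) + 1) * (μ + 2) * (2 * μ + 3)) * lameSAt n g₂ g₃ (n - μ - 2)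
      - C (g₃ * ((μ : K) + 1) * (μ + 2) * (μ + 3)) * lameSAt n g₂ g₃ (n - μ - 3) = 0 := by
  rcases lt_trichotomy μ n with h | h | h
  · have := congrArg (Polynomial.map (evalInvariants g₂ g₃)) (lameS_recursion n μ h)
    simp only [Polynomial.map_zero, Polynomial.map_sub, Polynomial.map_add,
      map_evalInvariants_smul, Polynomial.map_mul, map_X, map_C, evalInvariants_X_zero,
      evalInvariants_X_one] at this
    simp only [lameSAt]
    push_cast at this
    simp only [C_mul] at this ⊢
    linear_combination -this
  · subst h
    rw [lameSAt_neg μ g₂ g₃ (μ - μ - 1) (by omega), lameSAt_neg μ g₂ g₃ (μ - μ - 2) (by omega),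
      lameSAt_neg μ g₂ g₃ (μ - μ - 3) (by omega)]
    simp
  · rw [lameSAt_neg n g₂ g₃ _ (by omega), lameSAt_neg n g₂ g₃ _ (by omega),
      lameSAt_neg n g₂ g₃ _ (by omega), lameSAt_neg n g₂ g₃ _ (by omega)]
    simp

theorem lameEllAt_eq (n : ℕ) (g₂ g₃ : K) :
    lameEllAt n g₂ g₃ = 4 * X * lameSAt n g₂ g₃ n ^ 2
      + 4 * C g₃ * lameSAt n g₂ g₃ (n - 2) * lameSAt n g₂ g₃ n
      - C g₂ * lameSAt n g₂ g₃ (n - 1) * lameSAt n g₂ g₃ n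
      - C g₃ * lameSAt n g₂ g₃ (n - 1) ^ 2 := by
  simp [lameEllAt, lamePoly, lameSAt, evalInvariants_X_zero, evalInvariants_X_one]

/-- The polynomial `Q_B(x) = ∑ₖ (-1)^k s_k(B) x^{n-k}`. -/
def lameProduct (n : ℕ) (g₂ g₃ B : K) : K[X] :=
  alternatingPoly n fun k => (lameSAt n g₂ g₃ k).eval B

/-- The derivative of `lameProduct` with respect to `B`. -/
def lameProductDeriv (n : ℕ) (g₂ g₃ B : K) : K[X] :=
  alternatingPoly n fun k => (derivative (lameSAt n g₂ g₃ k)).eval B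

theorem coeff_lameProduct (n : ℕ) (g₂ g₃ B : K) (μ : ℕ) :
    (lameProduct n g₂ g₃ B).coeff μ = (-1) ^ (n + μ) * (lameSAt n g₂ g₃ (n - μ)).eval B :=
  coeff_alternatingPoly n _ (fun k hk => by simp [lameSAt_neg n g₂ g₃ k hk]) μ

theorem coeff_lameProductDeriv (n : ℕ) (g₂ g₃ B : K) (μ : ℕ) :
    (lameProductDeriv n g₂ g₃ B).coeff μ =
      (-1) ^ (n + μ) * (derivative (lameSAt n g₂ g₃ (n - μ))).eval B :=
  coeff_alternatingPoly n _ (fun k hk => by simp [lameSAt_neg n g₂ g₃ k hk]) μ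

theorem natDegree_lameProduct_le (n : ℕ) (g₂ g₃ B : K) :
    (lameProduct n g₂ g₃ B).natDegree ≤ n := by
  rw [natDegree_le_iff_coeff_eq_zero]
  intro μ hμ
  rw [coeff_lameProduct, lameSAt_neg _ _ _ _ (by omega)]
  simp

theorem coeff_lameProduct_self (n : ℕ) (g₂ g₃ B : K) : (lameProduct n g₂ g₃ B).coeff n = 1 := by
  rw [coeff_lameProduct, sub_self, lameSAt_zero, ← two_mul, pow_mul]
  simp

theorem monic_lameProduct (n : ℕ) (g₂ g₃ B : K) : (lameProduct n g₂ g₃ B).Monic :=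
  monic_of_natDegree_le_of_coeff_eq_one n (natDegree_lameProduct_le n g₂ g₃ B)
    (coeff_lameProduct_self n g₂ g₃ B)

theorem natDegree_lameProduct (n : ℕ) (g₂ g₃ B : K) : (lameProduct n g₂ g₃ B).natDegree = n :=
  le_antisymm (natDegree_lameProduct_le n g₂ g₃ B)
    (le_natDegree_of_ne_zero (by rw [coeff_lameProduct_self]; exact one_ne_zero))

theorem lameProductOp_lameProduct (n : ℕ) (g₂ g₃ B : K) :
    lameProductOp (weierstrassCubic g₂ g₃) (n * (n + 1)) B (lameProduct n g₂ g₃ B) = 0 := by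
  ext μ
  rw [lameProduct, coeff_lameProductOp_alternatingPoly n g₂ g₃ B _
    (fun k hk => by simp [lameSAt_neg n g₂ g₃ k hk]), coeff_zero, mul_eq_zero]
  right
  have := congrArg (Polynomial.eval B) (lameSAt_recursion n g₂ g₃ μ)
  simp only [eval_sub, eval_add, eval_mul, eval_C, eval_X, eval_zero] at this
  linear_combination this

/-- Differentiating the equation for Q_B with respect to B leaves the extra term 4Q_B', from the
explicit B in the potential. -/
theorem lameProductOp_lameProductDeriv (n : ℕ) (g₂ g₃ B : K) :
    lameProductOp (weierstrassCubic g₂ g₃) (n * (n + 1)) B (lameProductDeriv n g₂ g₃ B) =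
      4 * derivative (lameProduct n g₂ g₃ B) := by
  ext μ
  rw [lameProductDeriv, coeff_lameProductOp_alternatingPoly n g₂ g₃ B _
    (fun k hk => by simp [lameSAt_neg n g₂ g₃ k hk]), ← C_ofNat, coeff_C_mul, coeff_derivative,
    coeff_lameProduct]
  have := congrArg (fun P => Polynomial.eval B (derivative P)) (lameSAt_recursion n g₂ g₃ μ)
  simp only [derivative_sub, derivative_add, derivative_mul, derivative_C, derivative_X, eval_sub,
    eval_add, eval_mul, eval_C, eval_X, eval_zero, derivative_zero, eval_one] at this
  have h1 : ((n : ℤ) - (μ + 1 : ℕ)) = n - μ - 1 := by push_cast; ring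
  rw [h1, ← add_assoc, pow_succ]
  linear_combination (-(-1) ^ (n + μ)) * this

/-- The first integral of the product of Lamé functions is `-ℓ_n(B)`. -/
theorem lameForm_lameProduct (n : ℕ) (g₂ g₃ B : K) :
    lameForm (weierstrassCubic g₂ g₃) (n * (n + 1)) B (lameProduct n g₂ g₃ B)
      (lameProduct n g₂ g₃ B) = -C ((lameEllAt n g₂ g₃).eval B) := by
  rw [eq_C_coeff_zero_of_derivative_eq_zero (P := lameForm _ _ _ _ _) (by
    rw [derivative_lameForm, lameProductOp_lameProduct]; simp), ← C_neg]
  congr 1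
  rw [coeff_zero_lameForm, lameEllAt_eq]
  simp only [coeff_lameProduct, eval_sub, eval_add, eval_mul, eval_pow, eval_C, eval_X, eval_ofNat,
    Nat.cast_zero, Nat.cast_one, Nat.cast_ofNat, sub_zero, add_zero, pow_add]
  have h : ((-1 : K) ^ n) ^ 2 = 1 := by rw [← pow_mul, mul_comm, pow_mul]; simp
  linear_combination (-4 * g₃ * eval B (lameSAt n g₂ g₃ n) * eval B (lameSAt n g₂ g₃ (n - 2))
      + g₂ * eval B (lameSAt n g₂ g₃ n) * eval B (lameSAt n g₂ g₃ (n - 1))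
      + g₃ * eval B (lameSAt n g₂ g₃ (n - 1)) ^ 2
      - 4 * B * eval B (lameSAt n g₂ g₃ n) ^ 2) * h

/-- The `B`-derivative of the first integral. -/
theorem lameForm_lameProductDeriv (n : ℕ) (g₂ g₃ B : K) :
    lameForm (weierstrassCubic g₂ g₃) (n * (n + 1)) B (lameProduct n g₂ g₃ B)
      (lameProductDeriv n g₂ g₃ B) =
      2 * lameProduct n g₂ g₃ B ^ 2 - C (1 / 2 * (derivative (lameEllAt n g₂ g₃)).eval B) := by
  have h0 : lameForm (weierstrassCubic g₂ g₃) (n * (n + 1)) B (lameProduct n g₂ g₃ B)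
      (lameProductDeriv n g₂ g₃ B) - 2 * lameProduct n g₂ g₃ B ^ 2 =
      -C (1 / 2 * (derivative (lameEllAt n g₂ g₃)).eval B) := by
    -- Since the operator kills Q and sends ∂Q/∂B to 4Q', the form has derivative 4QQ' = (2Q²)'. The
    -- difference is constant, and x = 0 identifies it.
    rw [eq_C_coeff_zero_of_derivative_eq_zero (P := lameForm _ _ _ _ _ - _) (by
      rw [derivative_sub, derivative_lameForm, lameProductOp_lameProduct,
        lameProductOp_lameProductDeriv]
      rw [derivative_mul, derivative_ofNat, pow_two, derivative_mul]
      ring), ← C_neg]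
    congr 1
    rw [coeff_sub, coeff_zero_lameForm, lameEllAt_eq, pow_two]
    simp only [derivative_sub, derivative_add, derivative_mul, derivative_C, derivative_X,
      derivative_pow, derivative_ofNat, mul_coeff_zero, coeff_ofNat_zero]
    simp only [coeff_lameProduct, coeff_lameProductDeriv, eval_sub, eval_add, eval_mul, eval_pow,
      eval_C, eval_X, eval_ofNat, Nat.cast_zero, Nat.cast_one, Nat.cast_ofNat, sub_zero, add_zero,
      pow_add, eval_zero, eval_one]
    have h : ((-1 : K) ^ n) ^ 2 = 1 := by rw [← pow_mul, mul_comm, pow_mul]; simp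
    generalize eval B (lameSAt n g₂ g₃ n) = s
    generalize eval B (lameSAt n g₂ g₃ (n - 1)) = s1
    generalize eval B (lameSAt n g₂ g₃ (n - 2)) = s2
    generalize eval B (derivative (lameSAt n g₂ g₃ n)) = t
    generalize eval B (derivative (lameSAt n g₂ g₃ (n - 1))) = t1
    generalize eval B (derivative (lameSAt n g₂ g₃ (n - 2))) = t2
    linear_combination (-2 * g₃ * t2 * s + 1 / 2 * g₂ * t1 * s - 2 * g₃ * s2 * t
      + 1 / 2 * g₂ * s1 * t + g₃ * s1 * t1 - 4 * B * s * t - 2 * s ^ 2) * h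
  linear_combination h0

end LameSequence

/-! ### Uniqueness of the polynomial solution -/

section LameUniqueness

variable {K : Type*} [Field K] [CharZero K]

theorem lameProductOp_sub {K : Type*} [Field K] (p : K[X]) (α β : K) (Q T : K[X]) :
    lameProductOp p α β (Q - T) = lameProductOp p α β Q - lameProductOp p α β T := by
  simp only [lameProductOp, curveLaplacian, derivative_sub, derivative_add, derivative_mul,
    derivative_C]
  ring

/-- A monic polynomial of degree `n` annihilated by the third order operator is `Q_β`. -/
theorem eq_lameProduct_of_lameProductOp_eq_zero {n : ℕ} {g₂ g₃ α β : K} {Q : K[X]}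
    (hQ : Q.Monic) (hn : Q.natDegree = n)
    (h : lameProductOp (weierstrassCubic g₂ g₃) α β Q = 0) :
    α = n * (n + 1) ∧ Q = lameProduct n g₂ g₃ β := by
  have hα : α = n * (n + 1) := by
    have h1 := congrArg (fun P => Polynomial.coeff P n) h
    simp only [coeff_lameProductOp, coeff_zero] at h1
    rw [coeff_eq_zero_of_natDegree_lt (n := n + 1) (by omega),
      coeff_eq_zero_of_natDegree_lt (n := n + 2) (by omega),
      coeff_eq_zero_of_natDegree_lt (n := n + 3) (by omega), ← hn, hQ.coeff_natDegree, hn] at h1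
    have h2 : (2 * (2 * n + 1) : K) ≠ 0 := by exact_mod_cast (by omega : 2 * (2 * n + 1) ≠ 0)
    have h3 : (2 * (2 * n + 1) : K) * (n * (n + 1) - α) = 0 := by linear_combination h1
    rcases mul_eq_zero.mp h3 with h4 | h4
    · exact absurd h4 h2
    · linear_combination -h4
  refine ⟨hα, ?_⟩
  by_contra hne
  -- The difference of two monic solutions has degree m < n, and its top coefficient is annihilated
  -- by 2(2m + 1)(n - m)(n + m + 1) ≠ 0.
  set d := Q - lameProduct n g₂ g₃ β with hd
  have hd0 : d ≠ 0 := sub_ne_zero.mpr hne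
  have hdop : lameProductOp (weierstrassCubic g₂ g₃) (n * (n + 1)) β d = 0 := by
    rw [hd, lameProductOp_sub, lameProductOp_lameProduct, ← hα, h, sub_zero]
  have hdlt : d.natDegree < n := by
    have hlt : d.degree < Q.degree := by
      refine degree_sub_lt_left ?_ hQ.ne_zero ?_
      · rw [degree_eq_natDegree hQ.ne_zero, degree_eq_natDegree (monic_lameProduct _ _ _ _).ne_zero,
          natDegree_lameProduct, hn]
      · rw [hQ.leadingCoeff, (monic_lameProduct _ _ _ _).leadingCoeff]
    have := natDegree_lt_natDegree hd0 hlt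
    omega
  set m := d.natDegree with hm
  have h1 := congrArg (fun P => Polynomial.coeff P m) hdop
  simp only [coeff_lameProductOp, coeff_zero] at h1
  rw [coeff_eq_zero_of_natDegree_lt (n := m + 1) (by omega),
    coeff_eq_zero_of_natDegree_lt (n := m + 2) (by omega),
    coeff_eq_zero_of_natDegree_lt (n := m + 3) (by omega)] at h1
  have h2 : (2 * (2 * m + 1) : K) ≠ 0 := by exact_mod_cast (by omega : 2 * (2 * m + 1) ≠ 0)
  have h3 : ((n : K) - m) ≠ 0 := sub_ne_zero.mpr (by exact_mod_cast hdlt.ne')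
  have h4 : ((n : K) + m + 1) ≠ 0 := by exact_mod_cast (by omega : n + m + 1 ≠ 0)
  have h5 : (2 * (2 * m + 1) : K) * ((n : K) - m) * ((n : K) + m + 1) * d.coeff m = 0 := by
    linear_combination -h1
  have h6 : d.coeff m = 0 := by
    rcases mul_eq_zero.mp h5 with h | h
    · exact absurd h (mul_ne_zero (mul_ne_zero h2 h3) h4)
    · exact h
  exact hd0 (leadingCoeff_eq_zero.mp h6)

/-- The subleading coefficient of `Q_B` is `-s_1(B) = -B/(2n-1)`. -/
theorem lameProduct_subleading {n : ℕ} (hn : 1 ≤ n) (g₂ g₃ B : K) :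
    B = -((2 * n - 1) * (lameProduct n g₂ g₃ B).coeff (n - 1)) := by
  have h1 := congrArg (fun P => Polynomial.coeff P (n - 1)) (lameProductOp_lameProduct n g₂ g₃ B)
  have hdeg := natDegree_lameProduct n g₂ g₃ B
  simp only [coeff_lameProductOp, coeff_zero] at h1
  rw [coeff_eq_zero_of_natDegree_lt (n := n - 1 + 2) (by omega),
    coeff_eq_zero_of_natDegree_lt (n := n - 1 + 3) (by omega), Nat.sub_add_cancel hn,
    coeff_lameProduct_self, Nat.cast_sub hn] at h1
  have h2 : (4 * n : K) ≠ 0 := by exact_mod_cast (by omega : 4 * n ≠ 0)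
  refine mul_left_cancel₀ h2 ?_
  push_cast at h1
  linear_combination -h1

theorem sq_dvd_of_eval_eq_zero {K : Type*} [Field K] {P : K[X]} {a : K} (h : P.eval a = 0)
    (h' : (derivative P).eval a = 0) : (X - C a) ^ 2 ∣ P := by
  obtain ⟨M, rfl⟩ := dvd_iff_isRoot.mpr h
  have : M.IsRoot a := by simpa [derivative_mul] using h'
  obtain ⟨M', rfl⟩ := dvd_iff_isRoot.mpr this
  exact ⟨M', by ring⟩

/-- Points with `y_i Q'(x_i) = c` for all `i` have `∏ (x - x_i) = Q_B` and `c² = ℓ_n(B)`. -/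
theorem prod_X_sub_C_eq_lameProduct {n : ℕ} {g₂ g₃ c : K} {x y : Fin n → K}
    (hx : Function.Injective x)
    (hxy : ∀ i, y i ^ 2 = (weierstrassCubic g₂ g₃).eval (x i))
    (hc : ∀ i, y i * (derivative (∏ j, (X - C (x j)))).eval (x i) = c) :
    ∃ B, ∏ j, (X - C (x j)) = lameProduct n g₂ g₃ B ∧ c ^ 2 = (lameEllAt n g₂ g₃).eval B := by
  set Q := ∏ j, (X - C (x j)) with hQ
  set p := weierstrassCubic g₂ g₃ with hp
  have hmonic : Q.Monic := monic_prod_of_monic _ _ fun j _ => monic_X_sub_C (x j)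
  have hdeg : Q.natDegree = n := by simp [hQ, natDegree_prod_of_monic _ _ fun j _ =>
    monic_X_sub_C (x j)]
  have hroot : ∀ i, Q.eval (x i) = 0 := fun i => by
    rw [hQ, eval_prod]
    exact Finset.prod_eq_zero (Finset.mem_univ i) (by simp)
  have h2 : (C (1 / 2 : K)) * 2 = 1 := by
    rw [← C_ofNat, ← C_mul]; norm_num
  -- At x_i the value is c² - y_i² Q'(x_i)² = 0. The derivative 2Q(ΔQ)' vanishes there as well, so
  -- every x_i is a double zero.
  set N := 2 * Q * curveLaplacian p Q - p * derivative Q ^ 2 + C (c ^ 2) with hN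
  have hN' : derivative N = 2 * Q * derivative (curveLaplacian p Q) := by
    rw [hN]
    simp only [derivative_add, derivative_sub, derivative_mul, derivative_C, derivative_ofNat,
      pow_two, curveLaplacian]
    linear_combination (derivative p * derivative Q * derivative Q) * h2
  have hdvd : Q ^ 2 ∣ N := by
    rw [hQ, ← Finset.prod_pow]
    refine Finset.prod_dvd_of_coprime ?_ fun i _ => ?_
    · intro i _ j _ hij
      exact IsCoprime.pow (isCoprime_X_sub_C_of_isUnit_sub
        (sub_ne_zero.mpr fun h => hij (hx h)).isUnit)
    · refine sq_dvd_of_eval_eq_zero ?_ ?_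
      · simp only [hN, eval_add, eval_sub, eval_mul, hroot, eval_pow, ← hxy, eval_C, ← hc i]
        ring
      · rw [hN']
        simp [hroot]
  obtain ⟨W, hW⟩ := hdvd
  have hpdeg : p.natDegree ≤ 3 := by
    rw [hp, weierstrassCubic]; compute_degree
  have hp'deg : (derivative p).natDegree ≤ 2 := (natDegree_derivative_le p).trans (by omega)
  have hQ'deg : (derivative Q).natDegree ≤ n - 1 := (natDegree_derivative_le Q).trans (by omega)
  have hQ''deg : (derivative (derivative Q)).natDegree ≤ n - 1 - 1 :=
    (natDegree_derivative_le _).trans (by omega)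
  have hWdeg : W.natDegree ≤ 1 := by
    rcases Nat.eq_zero_or_pos n with h0 | h0
    · have hQ1 : Q = 1 := eq_one_of_monic_natDegree_zero hmonic (by omega)
      have : W = C (c ^ 2) := by
        rw [hQ1, one_pow, one_mul] at hW
        rw [← hW, hN, hQ1]
        simp [curveLaplacian]
      rw [this, natDegree_C]
      omega
    have hNdeg : N.natDegree ≤ 2 * n + 1 := by
      have e1 : (curveLaplacian p Q).natDegree ≤ n + 1 := by
        refine natDegree_add_le_of_degree_le ?_ ?_
        · rcases Nat.lt_or_ge n 2 with h | h
          · have : derivative (derivative Q) = 0 := by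
              rw [derivative_eq_zero]
              omega
            rw [this]; simp
          · exact (natDegree_mul_le_of_le hpdeg hQ''deg).trans (by omega)
        · exact (natDegree_mul_le_of_le (natDegree_C_mul_le _ _ |>.trans hp'deg) hQ'deg).trans
            (by omega)
      refine natDegree_add_le_of_degree_le
        ((natDegree_sub_le_of_le (m := 2 * n + 1) (n := 2 * n + 1) ?_ ?_).trans (max_self _).le)
        (by simp)
      · refine (natDegree_mul_le_of_le (m := n) ?_ e1).trans (by omega)
        rw [← C_ofNat]
        exact (natDegree_C_mul_le _ _).trans hdeg.le
      · exact (natDegree_mul_le_of_le hpdeg (natDegree_pow_le_of_le 2 hQ'deg)).trans (by omega)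
    by_cases hW0 : W = 0
    · simp [hW0]
    rw [hW, (hmonic.pow 2).natDegree_mul' hW0, hmonic.natDegree_pow, hdeg] at hNdeg
    omega
  -- The linear quotient N / Q² plays the role of 4(αx + β); with this choice the first integral of
  -- Q is the constant -c².
  obtain ⟨a, b, rfl⟩ := exists_eq_X_add_C_of_natDegree_le_one hWdeg
  have h4 : ∀ t : K, C (t / 4) * 4 = C t := fun t => by
    rw [← C_ofNat, ← C_mul]; norm_num
  have hform : lameForm p (a / 4) (b / 4) Q Q = -C (c ^ 2) := by
    rw [lameForm]
    linear_combination hW - Q ^ 2 * X * h4 a - Q ^ 2 * h4 b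
  have hop : lameProductOp p (a / 4) (b / 4) Q = 0 := by
    have h := congrArg derivative hform
    rw [derivative_lameForm, ← C_neg, derivative_C, ← two_mul] at h
    simpa [hmonic.ne_zero] using h
  obtain ⟨hα, hQB⟩ := eq_lameProduct_of_lameProductOp_eq_zero hmonic hdeg hop
  refine ⟨b / 4, hQB, ?_⟩
  have h := lameForm_lameProduct n g₂ g₃ (b / 4)
  rw [← hQB, ← hα, ← hp, hform] at h
  exact C_injective (neg_injective h)

end LameUniqueness

/-! ### Degrees and leading coefficients -/

theorem coeff_lameS_eq_zero (n : ℕ) (k : ℕ) : ∀ j : ℤ, j < k → ∀ i : ℕ, j < i →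
    (lameS n j).coeff i = 0 := by
  induction k with
  | zero => intro j hj i _; rw [lameS_neg n j (by omega), coeff_zero]
  | succ k ih =>
    intro j hj i hi
    rcases lt_or_ge j k with h | h
    · exact ih j h i hi
    obtain rfl : j = k := by omega
    rcases Nat.eq_zero_or_pos k with h0 | h0
    · subst h0
      rw [Nat.cast_zero, lameS_zero, coeff_one, if_neg (by omega)]
    rw [lameS_eq_step n k h0, lameStep]
    obtain ⟨i, rfl⟩ : ∃ i', i = i' + 1 := ⟨i - 1, by omega⟩
    simp only [coeff_smul, coeff_add, coeff_sub, coeff_X_mul, coeff_C_mul]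
    rw [ih _ (by omega) i (by omega), ih _ (by omega) (i + 1) (by omega),
      ih _ (by omega) (i + 1) (by omega)]
    simp

/-- For k ≤ n we have μ = n - k ≥ 0, so all factors in the recursion are positive, and only the term
with B reaches degree k. -/
theorem coeff_lameS_self (n k : ℕ) (hk : k ≤ n) :
    ∃ c : ℚ, 0 < c ∧ (lameS n k).coeff k = MvPolynomial.C c := by
  induction k with
  | zero => exact ⟨1, one_pos, by simp [lameS_zero]⟩
  | succ k ih =>
    obtain ⟨c, hc, h⟩ := ih (by omega)
    set μ : ℚ := (n : ℚ) - (k + 1 : ℕ) with hμ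
    have hμ0 : 0 ≤ μ := sub_nonneg.mpr (by exact_mod_cast hk)
    have hnμ : 0 < n - μ := by rw [hμ, sub_sub_cancel]; positivity
    refine ⟨(2 * (n - μ) * (2 * μ + 1) * (n + μ + 1))⁻¹ * (4 * (μ + 1)) * c, by positivity, ?_⟩
    rw [lameS_eq_step n (k + 1) (by omega), lameStep]
    simp only [coeff_smul, coeff_add, coeff_sub, coeff_X_mul, coeff_C_mul]
    rw [coeff_lameS_eq_zero n (k + 1) (((k + 1 : ℕ) : ℤ) - 2) (by omega) (k + 1) (by omega),
      coeff_lameS_eq_zero n (k + 1) (((k + 1 : ℕ) : ℤ) - 3) (by omega) (k + 1) (by omega),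
      show (((k + 1 : ℕ) : ℤ) - 1) = k by push_cast; ring, h]
    simp only [MvPolynomial.smul_eq_C_mul, ← hμ, mul_zero, sub_zero, add_zero, ← map_mul]
    congr 1
    ring

theorem natDegree_lameS_le (n k : ℕ) : (lameS n k).natDegree ≤ k := by
  rw [natDegree_le_iff_coeff_eq_zero]
  intro i hi
  exact coeff_lameS_eq_zero n (k + 1) k (by omega) i (by omega)

theorem natDegree_lameS_sub_le (n j : ℕ) : (lameS n ((n : ℤ) - j)).natDegree ≤ n - j := by
  rw [natDegree_le_iff_coeff_eq_zero]
  intro i hi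
  exact coeff_lameS_eq_zero n (n + 1) _ (by omega) i (by omega)

/-- Only 4B s_n² reaches degree 2n + 1. Its leading coefficient is a positive rational free of g₂
and g₃, so the degree survives every specialisation. -/
theorem coeff_lamePoly_top (n : ℕ) (hn : 1 ≤ n) :
    (lamePoly n).natDegree ≤ 2 * n + 1 ∧
      ∃ c : ℚ, 0 < c ∧ (lamePoly n).coeff (2 * n + 1) = MvPolynomial.C c := by
  have h0 := natDegree_lameS_le n n
  have h1 : (lameS n ((n : ℤ) - 1)).natDegree ≤ n - 1 := natDegree_lameS_sub_le n 1
  have h2 : (lameS n ((n : ℤ) - 2)).natDegree ≤ n - 2 := natDegree_lameS_sub_le n 2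
  obtain ⟨c, hc, hcn⟩ := coeff_lameS_self n n le_rfl
  set R := 4 * C (MvPolynomial.X 1) * lameS n (n - 2) * lameS n n
    - C (MvPolynomial.X 0) * lameS n (n - 1) * lameS n n
    - C (MvPolynomial.X 1) * lameS n (n - 1) ^ 2 with hR
  have hRdeg : R.natDegree ≤ 2 * n := by
    refine (natDegree_sub_le_of_le (m := 2 * n) (n := 2 * n) ((natDegree_sub_le_of_le
      (m := 2 * n) (n := 2 * n) ?_ ?_).trans (max_self _).le) ?_).trans (max_self _).le
    · rw [← C_ofNat, ← C_mul]
      exact (natDegree_mul_le_of_le ((natDegree_C_mul_le _ _).trans h2) h0).trans (by omega)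
    · exact (natDegree_mul_le_of_le ((natDegree_C_mul_le _ _).trans h1) h0).trans (by omega)
    · exact (natDegree_C_mul_le _ _).trans ((natDegree_pow_le_of_le 2 h1).trans (by omega))
  have hlp : lamePoly n = C 4 * (X * lameS n n ^ 2) + R := by
    rw [lamePoly, hR, C_ofNat]; ring
  have hsq : (lameS n n ^ 2).natDegree ≤ 2 * n := natDegree_pow_le_of_le 2 h0
  refine ⟨?_, 4 * c ^ 2, by positivity, ?_⟩
  · rw [hlp]
    refine natDegree_add_le_of_degree_le ((natDegree_C_mul_le _ _).trans ?_) (by omega)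
    exact (natDegree_mul_le_of_le natDegree_X_le hsq).trans (by omega)
  · rw [hlp, coeff_add, coeff_eq_zero_of_natDegree_lt (p := R) (by omega), add_zero, coeff_C_mul,
      coeff_X_mul, coeff_pow_of_natDegree_le h0, hcn,
      map_mul, map_pow]
    rfl

theorem natDegree_lamePoly (n : ℕ) (hn : 1 ≤ n) : (lamePoly n).natDegree = 2 * n + 1 := by
  obtain ⟨h, c, hc, hcoeff⟩ := coeff_lamePoly_top n hn
  refine le_antisymm h (le_natDegree_of_ne_zero ?_)
  rw [hcoeff]
  simpa using hc.ne'

theorem natDegree_lameEllAt {K : Type*} [Field K] [CharZero K] (n : ℕ) (hn : 1 ≤ n) (g₂ g₃ : K) :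
    (lameEllAt n g₂ g₃).natDegree = 2 * n + 1 := by
  obtain ⟨h, c, hc, hcoeff⟩ := coeff_lamePoly_top n hn
  refine le_antisymm (natDegree_map_le.trans h) (le_natDegree_of_ne_zero ?_)
  rw [lameEllAt, coeff_map, hcoeff]
  simpa [evalInvariants] using hc.ne'

/-! ### Zeros of products of Lamé functions with vanishing first integral -/

/-- Vanishing of the first integral makes Q behave like the square of a Lamé function, whose local
exponents in x are 0, 1 at an ordinary point and 0, 1/2 at a simple zero of p. For a root of
multiplicity m, the lowest order term of the form is proportional to m(m - 2) in the first case and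
to m(m - 1) in the second. -/
theorem root_structure_of_lameForm_eq_zero {K : Type*} [Field K] [CharZero K] {p Q : K[X]}
    {α β a : K} (hQ : Q ≠ 0) (h : lameForm p α β Q Q = 0) (ha : Q.IsRoot a)
    (hp : p.eval a = 0 → (derivative p).eval a ≠ 0) :
    ∃ G : K[X], G.eval a ≠ 0 ∧ ((p.eval a ≠ 0 ∧ Q = (X - C a) ^ 2 * G) ∨
      (p.eval a = 0 ∧ Q = (X - C a) ^ 1 * G)) := by
  obtain ⟨G, hG, hGa⟩ := exists_eq_pow_rootMultiplicity_mul_and_not_dvd Q hQ a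
  have hGa' : G.eval a ≠ 0 := fun h0 => hGa (dvd_iff_isRoot.mpr h0)
  have hpos : 0 < Q.rootMultiplicity a := (rootMultiplicity_pos hQ).mpr ha
  obtain ⟨k, hk⟩ : ∃ k, Q.rootMultiplicity a = k + 1 := ⟨Q.rootMultiplicity a - 1, by omega⟩
  rw [hk] at hG
  refine ⟨G, hGa', ?_⟩
  have h2 : (C (1 / 2 : K)) * 2 = 1 := by
    rw [← C_ofNat, ← C_mul]; norm_num
  set f : K[X] := X - C a with hf
  have hf' : derivative f = 1 := by simp [hf]
  have hf0 : f ≠ 0 := X_sub_C_ne_zero a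
  set H := (k + 1 : K[X]) * G + f * derivative G with hH
  have hHa : H.eval a = (k + 1) * G.eval a := by simp [hH, hf]
  have hQ' : derivative Q = f ^ k * H := by
    rw [hG, derivative_mul, derivative_pow, hf', hH]
    simp only [map_natCast, Nat.add_sub_cancel]
    push_cast
    ring
  have hQ'' : f * derivative (derivative Q) = f ^ k * ((k : K[X]) * H + f * derivative H) := by
    rw [hQ', derivative_mul, derivative_pow, hf']
    cases k with
    | zero => simp
    | succ j =>
      simp only [map_natCast, Nat.add_sub_cancel]
      push_cast
      ring
  have hZ : 2 * G * p * ((k : K[X]) * H + f * derivative H) + f * G * derivative p * H - p * H ^ 2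
      - 4 * f ^ 2 * G ^ 2 * (C α * X + C β) = 0 := by
    have h1 : f ^ (2 * k) * (2 * G * p * ((k : K[X]) * H + f * derivative H) + f * G * derivative p * H
        - p * H ^ 2 - 4 * f ^ 2 * G ^ 2 * (C α * X + C β)) = 0 := by
      have h3 : 2 * Q * curveLaplacian p Q - p * derivative Q ^ 2
          - 4 * Q ^ 2 * (C α * X + C β) = 0 := by
        rw [← h, lameForm]; ring
      have h4 : Q * derivative (derivative Q) =
          f ^ (2 * k) * G * ((k : K[X]) * H + f * derivative H) := by
        calc Q * derivative (derivative Q) = f ^ k * G * (f * derivative (derivative Q)) := by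
              rw [hG]; ring
          _ = _ := by rw [hQ'']; ring
      rw [curveLaplacian] at h3
      have h5 : 2 * (p * (Q * derivative (derivative Q))) + (C (1 / 2) * 2) * Q * derivative p *
          derivative Q - p * derivative Q ^ 2 - 4 * Q ^ 2 * (C α * X + C β) = 0 := by
        rw [← h3]; ring
      rw [h4, h2, hQ', hG] at h5
      rw [← h5]
      ring
    exact (mul_eq_zero.mp h1).resolve_left (pow_ne_zero _ hf0)
  have hfa : f.eval a = 0 := by simp [hf]
  by_cases hpa : p.eval a = 0
  · right
    refine ⟨hpa, ?_⟩
    obtain ⟨P, hP⟩ := dvd_iff_isRoot.mpr hpa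
    have hp'a : (derivative p).eval a = P.eval a := by
      rw [hP]; simp [derivative_mul]
    have hPa : P.eval a ≠ 0 := hp'a ▸ hp hpa
    have hZ1 : f * (2 * G * P * ((k : K[X]) * H + f * derivative H) + G * derivative p * H - P * H ^ 2
        - 4 * f * G ^ 2 * (C α * X + C β)) = 0 := by
      rw [← hZ, hP]; ring
    have hZ2 := congrArg (Polynomial.eval a) ((mul_eq_zero.mp hZ1).resolve_left hf0)
    simp only [eval_add, eval_sub, eval_mul, eval_pow, hfa, hp'a, hHa, eval_natCast, eval_ofNat,
      eval_zero] at hZ2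
    have hZ3 : P.eval a * G.eval a ^ 2 * (k + 1) * k = 0 := by linear_combination hZ2
    have hk0 : (k : K) = 0 := by
      rcases mul_eq_zero.mp hZ3 with h | h
      · exact absurd h (mul_ne_zero (mul_ne_zero hPa (pow_ne_zero _ hGa'))
          (Nat.cast_add_one_ne_zero k))
      · exact h
    have : k = 0 := by exact_mod_cast hk0
    rw [hG, this]
  · left
    refine ⟨hpa, ?_⟩
    have hZ2 := congrArg (Polynomial.eval a) hZ
    simp only [eval_add, eval_sub, eval_mul, eval_pow, hfa, hHa, eval_natCast, eval_ofNat,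
      eval_zero] at hZ2
    have hZ3 : p.eval a * G.eval a ^ 2 * (k + 1) * (k - 1) = 0 := by linear_combination hZ2
    have hk0 : (k : K) - 1 = 0 := by
      rcases mul_eq_zero.mp hZ3 with h | h
      · exact absurd h (mul_ne_zero (mul_ne_zero hpa (pow_ne_zero _ hGa'))
          (Nat.cast_add_one_ne_zero k))
      · exact h
    have : k = 1 := by exact_mod_cast sub_eq_zero.mp hk0
    rw [hG, this]

/-- The equation satisfied by `R` when `f² = A R²` and `f'' = (αx + β) f` on the curve. -/
theorem half_equation_of_lameForm_eq_zero {K : Type*} [Field K] [CharZero K] {p A R : K[X]}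
    {α β : K} (hR : R ≠ 0) (h : lameForm p α β (A * R ^ 2) (A * R ^ 2) = 0) :
    p * ((2 * A * derivative (derivative A) - derivative A ^ 2) * R
        + 4 * A * derivative A * derivative R + 4 * A ^ 2 * derivative (derivative R))
      + derivative p * (A * derivative A * R + 2 * A ^ 2 * derivative R)
      = 4 * A ^ 2 * R * (C α * X + C β) := by
  have h2 : (C (1 / 2 : K)) * 2 = 1 := by
    rw [← C_ofNat, ← C_mul]; norm_num
  -- The claim is Lamé's equation for f = √A · R multiplied by 4A^{3/2}, which clears the radicals;
  -- R³ times it is the vanishing of the form.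
  refine mul_left_cancel₀ (pow_ne_zero 3 hR) ?_
  simp only [lameForm, curveLaplacian, derivative_mul, pow_two, derivative_add] at h
  linear_combination h - (R ^ 3 * derivative p * (A * derivative A * R
    + 2 * A ^ 2 * derivative R)) * h2

/-! ### The cubic `4x³ - 4x` -/

/-- The real structure at `(g₂, g₃) = (4, 0)`: the factor `A` of `Q` supported at the
branch points. -/
def branchFactor (i j k : ℕ) : ℂ[X] := (X + 1) ^ i * X ^ j * (X - 1) ^ k

theorem monic_branchFactor (i j k : ℕ) : (branchFactor i j k).Monic :=
  (((monic_X_add_C (1 : ℂ)).pow i).mul (monic_X_pow j)).mul ((monic_X_sub_C (1 : ℂ)).pow k)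

theorem map_conj_branchFactor (i j k : ℕ) :
    (branchFactor i j k).map (starRingEnd ℂ) = branchFactor i j k := by
  simp [branchFactor]

theorem map_conj_weierstrassCubic :
    (weierstrassCubic (4 : ℂ) 0).map (starRingEnd ℂ) = weierstrassCubic 4 0 := by
  have h : (starRingEnd ℂ) 4 = 4 := Complex.conj_ofNat 4
  simp [weierstrassCubic, h]

theorem map_conj_lameProduct (n : ℕ) (B : ℂ) :
    (lameProduct n 4 0 B).map (starRingEnd ℂ) = lameProduct n 4 0 (starRingEnd ℂ B) := by
  have h4 : (starRingEnd ℂ) 4 = 4 := Complex.conj_ofNat 4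
  have hcomp : (starRingEnd ℂ).comp (evalInvariants (4 : ℂ) 0) = evalInvariants 4 0 := by
    refine MvPolynomial.ringHom_ext (fun r => ?_) fun i => ?_
    · simp [evalInvariants]
    · fin_cases i <;> simp [evalInvariants, h4]
  ext μ
  rw [coeff_map, coeff_lameProduct, coeff_lameProduct, map_mul, map_pow, map_neg, map_one,
    ← Polynomial.eval_map_apply, lameSAt, Polynomial.map_map, hcomp]

/-- Self-adjointness on the real oval over `[-1, 0]`. -/
theorem no_periodic_primitive (i j k : ℕ) {R M : ℂ[X]} (hR : R ≠ 0) :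
    weierstrassCubic 4 0 * derivative M + C (1 / 2) * derivative (weierstrassCubic 4 0) * M ≠
      branchFactor i j k * R * R.map (starRingEnd ℂ) := by
  intro h
  set P : ℝ → ℝ := fun x => 4 * x ^ 3 - 4 * x with hP
  set m : ℝ → ℝ := fun x => (M.eval (x : ℂ)).re with hm
  set m' : ℝ → ℝ := fun x => ((derivative M).eval (x : ℂ)).re with hm'
  -- The sign of A on (-1, 0), where x and x - 1 are negative.
  set σ : ℝ := (-1) ^ (j + k) with hσ
  set a : ℝ → ℝ := fun x => (x + 1) ^ i * x ^ j * (x - 1) ^ k with ha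
  have hσa : ∀ x ∈ Set.Ioo (-1 : ℝ) 0, 0 < σ * a x := by
    rintro x ⟨hx1, hx2⟩
    have e : σ * a x = (x + 1) ^ i * (-x) ^ j * (1 - x) ^ k := by
      have e1 : (-x) ^ j = (-1) ^ j * x ^ j := neg_pow x j
      have e2 : (1 - x) ^ k = (-1) ^ k * (x - 1) ^ k := by rw [← neg_pow, neg_sub]
      rw [e1, e2, hσ, ha, pow_add]
      ring
    rw [e]
    have h1 : 0 < x + 1 := by linarith
    have h2 : 0 < -x := by linarith
    have h3 : 0 < 1 - x := by linarith
    positivity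
  have hPpos : ∀ x ∈ Set.Ioo (-1 : ℝ) 0, 0 < P x := by
    rintro x ⟨hx1, hx2⟩
    have e : P x = 4 * (x + 1) * (-x) * (1 - x) := by rw [hP]; ring
    have h1 : 0 < x + 1 := by linarith
    have h2 : 0 < -x := by linarith
    have h3 : 0 < 1 - x := by linarith
    rw [e]
    positivity
  have hkey : ∀ x : ℝ, P x * m' x + (6 * x ^ 2 - 2) * m x =
      a x * Complex.normSq (R.eval (x : ℂ)) := by
    intro x
    have h1 := congrArg (fun F => (Polynomial.eval (x : ℂ) F).re) h
    have e1 : (weierstrassCubic (4 : ℂ) 0).eval (x : ℂ) = ((P x : ℝ) : ℂ) := by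
      simp [weierstrassCubic, hP]
    have e2 : (C (1 / 2) * derivative (weierstrassCubic (4 : ℂ) 0)).eval (x : ℂ) =
        ((6 * x ^ 2 - 2 : ℝ) : ℂ) := by
      simp [weierstrassCubic]
      ring
    have e3 : (branchFactor i j k).eval (x : ℂ) = ((a x : ℝ) : ℂ) := by
      simp [branchFactor, ha]
    have e4 : (R.map (starRingEnd ℂ)).eval (x : ℂ) = starRingEnd ℂ (R.eval (x : ℂ)) := by
      have := Polynomial.eval_map_apply (starRingEnd ℂ) (p := R) (x : ℂ)
      rwa [Complex.conj_ofReal] at this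
    simp only [eval_add, eval_mul] at h1 e2
    rw [e1, e2, e3, e4, mul_assoc, Complex.mul_conj, ← Complex.ofReal_mul, Complex.add_re,
      Complex.re_ofReal_mul, Complex.re_ofReal_mul, Complex.ofReal_re] at h1
    exact h1
  have hmd : ∀ x : ℝ, HasDerivAt m (m' x) x := fun x =>
    (M.hasDerivAt (x : ℂ)).real_of_complex
  have hPd : ∀ x : ℝ, HasDerivAt P (12 * x ^ 2 - 4) x := fun x => by
    have := ((hasDerivAt_pow 3 x).const_mul 4).sub ((hasDerivAt_id x).const_mul 4)
    refine this.congr_deriv ?_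
    norm_num
    ring
  -- √P is an integrating factor: √P · (√P M)' = PM' + P'M/2. Therefore F' = |A| |R|² / √P ≥ 0
  -- inside the interval, while √P makes F vanish at both ends; so F ≡ 0 and R = 0 on the interval.
  set F : ℝ → ℝ := fun x => Real.sqrt (P x) * (σ * m x) with hF
  have hFd : ∀ x ∈ Set.Ioo (-1 : ℝ) 0,
      HasDerivAt F (σ * a x * Complex.normSq (R.eval (x : ℂ)) / Real.sqrt (P x)) x := by
    intro x hx
    have hs := Real.sqrt_pos.mpr (hPpos x hx)
    have hsq := Real.mul_self_sqrt (hPpos x hx).le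
    refine (((hPd x).sqrt (hPpos x hx).ne').mul ((hmd x).const_mul σ)).congr_deriv ?_
    rw [eq_div_iff hs.ne', mul_assoc σ, ← hkey x]
    field_simp
    linear_combination (2 * σ * m' x) * hsq
  have hcont : Continuous F := by
    have h1 : Continuous m := continuous_iff_continuousAt.mpr fun x => (hmd x).continuousAt
    have h2 : Continuous P := by fun_prop
    exact (Real.continuous_sqrt.comp h2).mul (continuous_const.mul h1)
  have hmono : MonotoneOn F (Set.Icc (-1) 0) := by
    refine monotoneOn_of_deriv_nonneg (convex_Icc _ _) hcont.continuousOn ?_ ?_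
    · rw [interior_Icc]
      exact fun x hx => (hFd x hx).differentiableAt.differentiableWithinAt
    · rw [interior_Icc]
      intro x hx
      rw [(hFd x hx).deriv]
      exact div_nonneg (mul_nonneg (hσa x hx).le (Complex.normSq_nonneg _)) (Real.sqrt_nonneg _)
  have hF0 : F (-1) = 0 ∧ F 0 = 0 := by
    constructor <;> (simp only [hF, hP]; norm_num)
  have hFzero : ∀ x ∈ Set.Ioo (-1 : ℝ) 0, F x = 0 := by
    intro x hx
    have hx' := Set.Ioo_subset_Icc_self hx
    have h1 := hmono (Set.left_mem_Icc.mpr (by norm_num)) hx' hx'.1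
    have h2 := hmono hx' (Set.right_mem_Icc.mpr (by norm_num)) hx'.2
    rw [hF0.1] at h1
    rw [hF0.2] at h2
    exact le_antisymm h2 h1
  have hRzero : ∀ x ∈ Set.Ioo (-1 : ℝ) 0, R.eval (x : ℂ) = 0 := by
    intro x hx
    have h1 : F =ᶠ[𝓝 x] fun _ => 0 := by
      filter_upwards [isOpen_Ioo.mem_nhds hx] with y hy using hFzero y hy
    have h2 := (hFd x hx).unique ((hasDerivAt_const x (0 : ℝ)).congr_of_eventuallyEq h1)
    have hs := Real.sqrt_pos.mpr (hPpos x hx)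
    rw [div_eq_zero_iff, mul_eq_zero] at h2
    rcases h2 with (h2 | h2) | h2
    · exact absurd h2 (hσa x hx).ne'
    · exact Complex.normSq_eq_zero.mp h2
    · exact absurd h2 hs.ne'
  refine hR (Polynomial.eq_zero_of_infinite_isRoot R ?_)
  have hinf : (Complex.ofReal '' Set.Ioo (-1 : ℝ) 0).Infinite :=
    (Set.Ioo_infinite (by norm_num)).image Complex.ofReal_injective.injOn
  refine hinf.mono ?_
  rintro _ ⟨x, hx, rfl⟩
  exact hRzero x hx

theorem weierstrassCubic_four_zero_root {a : ℂ} (h : (weierstrassCubic (4 : ℂ) 0).eval a = 0) :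
    a = -1 ∨ a = 0 ∨ a = 1 := by
  have h1 : (a + 1) * (a * (a - 1)) = 0 := by
    simp [weierstrassCubic] at h
    linear_combination (1 / 4 : ℂ) * h
  rcases mul_eq_zero.mp h1 with h | h
  · left; linear_combination h
  · rcases mul_eq_zero.mp h with h | h
    · right; left; exact h
    · right; right; linear_combination h

theorem derivative_weierstrassCubic_four_zero {a : ℂ}
    (h : (weierstrassCubic (4 : ℂ) 0).eval a = 0) :
    (derivative (weierstrassCubic (4 : ℂ) 0)).eval a ≠ 0 := by
  have e : (derivative (weierstrassCubic (4 : ℂ) 0)).eval a = 12 * a ^ 2 - 4 := by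
    simp [weierstrassCubic]
    ring
  rw [e]
  rcases weierstrassCubic_four_zero_root h with rfl | rfl | rfl <;> norm_num

/-- If the first integral vanishes then `Q = A R²` with `A` supported at the branch points. -/
theorem exists_branchFactor_mul_sq {Q : ℂ[X]} {α β : ℂ} (hQ : Q.Monic)
    (h : lameForm (weierstrassCubic 4 0) α β Q Q = 0) :
    ∃ (i j k : ℕ) (R : ℂ[X]), R.Monic ∧ Q = branchFactor i j k * R ^ 2 ∧
      ∀ T : ℂ[X], (∀ a, Q.IsRoot a → T.IsRoot a) → branchFactor i j k * R ∣ T := by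
  classical
  have hstr := fun a (ha : Q.IsRoot a) => root_structure_of_lameForm_eq_zero hQ.ne_zero h ha
    derivative_weierstrassCubic_four_zero
  have hmult : ∀ a m (G : ℂ[X]), G.eval a ≠ 0 → Q = (X - C a) ^ m * G →
      Q.rootMultiplicity a = m := by
    intro a m G hG hQG
    have h0 : (X - C a) ^ m * G ≠ 0 := hQG ▸ hQ.ne_zero
    rw [hQG, rootMultiplicity_mul h0, rootMultiplicity_X_sub_C_pow, rootMultiplicity_eq_zero hG,
      add_zero]
  have hm1 : ∀ a, Q.IsRoot a → (weierstrassCubic (4 : ℂ) 0).eval a = 0 →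
      Q.rootMultiplicity a = 1 := by
    intro a ha hpa
    obtain ⟨G, hG, ⟨hp, _⟩ | ⟨-, hQG⟩⟩ := hstr a ha
    · exact absurd hpa hp
    · exact hmult a 1 G hG hQG
  have hm2 : ∀ a, Q.IsRoot a → (weierstrassCubic (4 : ℂ) 0).eval a ≠ 0 →
      Q.rootMultiplicity a = 2 := by
    intro a ha hpa
    obtain ⟨G, hG, ⟨-, hQG⟩ | ⟨hp, _⟩⟩ := hstr a ha
    · exact hmult a 2 G hG hQG
    · exact absurd hp hpa
  set S : Finset ℂ := {-1, 0, 1} with hS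
  have hSp : ∀ a ∈ S, (weierstrassCubic (4 : ℂ) 0).eval a = 0 := by
    intro a ha
    simp only [hS, Finset.mem_insert, Finset.mem_singleton] at ha
    rcases ha with rfl | rfl | rfl <;> norm_num [weierstrassCubic]
  have hpS : ∀ a, (weierstrassCubic (4 : ℂ) 0).eval a = 0 → a ∈ S := by
    intro a ha
    simpa [hS] using weierstrassCubic_four_zero_root ha
  set U := Q.roots.toFinset with hU
  have hUroot : ∀ a, a ∈ U ↔ Q.IsRoot a := fun a => by
    rw [hU, Multiset.mem_toFinset, mem_roots hQ.ne_zero]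
  have hA : ∏ a ∈ S, (X - C a) ^ Q.rootMultiplicity a =
      branchFactor (Q.rootMultiplicity (-1)) (Q.rootMultiplicity 0) (Q.rootMultiplicity 1) := by
    rw [hS, Finset.prod_insert (by norm_num), Finset.prod_insert (by norm_num),
      Finset.prod_singleton, branchFactor]
    simp only [C_neg, C_1, C_0, sub_zero, sub_neg_eq_add, mul_assoc]
  refine ⟨Q.rootMultiplicity (-1), Q.rootMultiplicity 0, Q.rootMultiplicity 1,
    ∏ a ∈ U \ S, (X - C a), monic_prod_of_monic _ _ fun a _ => monic_X_sub_C a, ?_, ?_⟩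
  · have h1 : Q = ∏ a ∈ U, (X - C a) ^ Q.rootMultiplicity a := by
      conv_lhs => rw [(IsAlgClosed.splits Q).eq_prod_roots_of_monic hQ,
        Finset.prod_multiset_map_count]
      simp only [count_roots, hU]
    have h2 : Q = ∏ a ∈ S ∪ (U \ S), (X - C a) ^ Q.rootMultiplicity a := by
      conv_lhs => rw [h1]
      refine Finset.prod_subset (fun a ha => by simp; tauto) fun a _ ha => ?_
      rw [rootMultiplicity_eq_zero (by rwa [← hUroot]), pow_zero]
    rw [Finset.prod_union Finset.disjoint_sdiff, hA] at h2
    conv_lhs => rw [h2]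
    rw [← Finset.prod_pow]
    congr 1
    refine Finset.prod_congr rfl fun a ha => ?_
    rw [Finset.mem_sdiff] at ha
    rw [hm2 a ((hUroot a).mp ha.1) fun h0 => ha.2 (hpS a h0)]
  · intro T hT
    -- The exponents in A are 0 or 1, so A R is the product of X - a over the distinct roots a of Q.
    have h1 : branchFactor (Q.rootMultiplicity (-1)) (Q.rootMultiplicity 0)
        (Q.rootMultiplicity 1) * ∏ a ∈ U \ S, (X - C a) = ∏ a ∈ U, (X - C a) := by
      rw [← hA, ← Finset.prod_sdiff (s₁ := U ∩ S) (s₂ := U) Finset.inter_subset_left,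
        Finset.sdiff_inter_self_left, mul_comm]
      congr 1
      refine (Finset.prod_subset (s₁ := U ∩ S) Finset.inter_subset_right fun a ha ha' => ?_).symm.trans ?_
      · rw [rootMultiplicity_eq_zero fun h0 => ha' (Finset.mem_inter.mpr ⟨(hUroot a).mpr h0, ha⟩),
          pow_zero]
      · refine Finset.prod_congr rfl fun a ha => ?_
        rw [Finset.mem_inter] at ha
        rw [hm1 a ((hUroot a).mp ha.1) (hSp a ha.2), pow_one]
    rw [h1]
    refine Finset.prod_dvd_of_coprime ?_ fun a ha => ?_
    · intro a _ b _ hab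
      exact isCoprime_X_sub_C_of_isUnit_sub (sub_ne_zero.mpr hab).isUnit
    · exact dvd_iff_isRoot.mpr (hT a ((hUroot a).mp ha))

/-- For the cubic `4x³ - 4x` all roots of `ℓ_n` are real. -/
theorem conj_eq_of_lameEllAt_root {n : ℕ} {B : ℂ} (h : (lameEllAt n (4 : ℂ) 0).eval B = 0) :
    starRingEnd ℂ B = B := by
  have hform := lameForm_lameProduct n (4 : ℂ) 0 B
  rw [h, C_0, neg_zero] at hform
  obtain ⟨i, j, k, R, hR, hQ, -⟩ := exists_branchFactor_mul_sq (monic_lameProduct n 4 0 B) hform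
  rw [hQ] at hform
  have h1 := half_equation_of_lameForm_eq_zero hR.ne_zero hform
  have h1' := congrArg (Polynomial.map (starRingEnd ℂ)) h1
  have hα : starRingEnd ℂ (n * (n + 1) : ℂ) = n * (n + 1) := by simp
  simp only [Polynomial.map_add, Polynomial.map_sub, Polynomial.map_mul, Polynomial.map_pow,
    ← derivative_map, map_conj_branchFactor, map_conj_weierstrassCubic, Polynomial.map_ofNat,
    map_C, map_X, hα] at h1'
  by_contra hne
  set A := branchFactor i j k with hA
  set R' := R.map (starRingEnd ℂ) with hR'
  set p := weierstrassCubic (4 : ℂ) 0 with hp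
  have hne' : starRingEnd ℂ B - B ≠ 0 := sub_ne_zero.mpr hne
  set c := (starRingEnd ℂ B - B)⁻¹ with hc
  have hcc : C c * (C (starRingEnd ℂ B) - C B) = 1 := by
    rw [← C_sub, ← C_mul, hc, inv_mul_cancel₀ hne', C_1]
  -- Lagrange's identity for f = √A · R and its conjugate, which solve Lamé's equation with
  -- parameters B and its conjugate: `M` is their Wronskian in x divided by the difference of the
  -- parameters.
  refine no_periodic_primitive i j k (R := R)
    (M := C c * (A * (R * derivative R' - derivative R * R'))) hR.ne_zero ?_
  rw [← hA, ← hp, ← hR']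
  have h2 : (C (1 / 2 : ℂ)) * 2 = 1 := by
    rw [← C_ofNat, ← C_mul]; norm_num
  have hA0 : (4 : ℂ[X]) * A ≠ 0 :=
    mul_ne_zero (by norm_num) (monic_branchFactor i j k).ne_zero
  refine mul_left_cancel₀ hA0 ?_
  simp only [derivative_mul, derivative_sub, derivative_C]
  linear_combination C c * (R * h1' - R' * h1) + (4 * A ^ 2 * R * R') * hcc
    + 2 * A * derivative p * C c * (A * (R * derivative R' - derivative R * R')) * h2

/-- For the cubic `4x³ - 4x` the roots of `ℓ_n` are simple. -/
theorem derivative_lameEllAt_ne_zero {n : ℕ} {B : ℂ} (h : (lameEllAt n (4 : ℂ) 0).eval B = 0) :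
    (derivative (lameEllAt n (4 : ℂ) 0)).eval B ≠ 0 := by
  intro h'
  have hconj := conj_eq_of_lameEllAt_root h
  have hform := lameForm_lameProduct n (4 : ℂ) 0 B
  rw [h, C_0, neg_zero] at hform
  have hT := lameForm_lameProductDeriv n (4 : ℂ) 0 B
  rw [h', mul_zero, C_0, sub_zero] at hT
  have hmon := monic_lameProduct n 4 0 B
  obtain ⟨i, j, k, R, hR, hQ, hdvd⟩ := exists_branchFactor_mul_sq hmon hform
  have hmap := map_conj_lameProduct n B
  rw [hconj] at hmap
  set Q := lameProduct n 4 0 B with hQdef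
  set T := lameProductDeriv n 4 0 B with hTdef
  set p := weierstrassCubic (4 : ℂ) 0 with hp
  -- At a root of Q the relation form(Q, T) = 2Q² reduces to T times a nonzero number: 2pG at a
  -- double root off the branch points, p'G/2 at a simple root on one.
  have hTroot : ∀ a, Q.IsRoot a → T.IsRoot a := by
    intro a ha
    have ha' : Q.eval a = 0 := ha
    have h1 := congrArg (Polynomial.eval a) hT
    simp only [lameForm, curveLaplacian, eval_add, eval_sub, eval_mul, eval_pow, ha'] at h1
    obtain ⟨G, hG, ⟨hpa, hQG⟩ | ⟨hpa, hQG⟩⟩ := root_structure_of_lameForm_eq_zero hmon.ne_zero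
      hform ha derivative_weierstrassCubic_four_zero
    · have e1 : (derivative Q).eval a = 0 := by rw [hQG]; simp [derivative_mul, derivative_pow]
      have e2 : (derivative (derivative Q)).eval a = 2 * G.eval a := by
        rw [hQG]; simp [derivative_mul, derivative_pow]
      rw [e1, e2] at h1
      have h3 : T.eval a * (p.eval a * (2 * G.eval a)) = 0 := by linear_combination h1
      exact (mul_eq_zero.mp h3).resolve_right
        (mul_ne_zero hpa (mul_ne_zero two_ne_zero hG))
    · have e1 : (derivative Q).eval a = G.eval a := by rw [hQG]; simp [derivative_mul]
      rw [e1, hpa, eval_C] at h1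
      have h3 : T.eval a * ((derivative p).eval a * G.eval a) = 0 := by
        linear_combination 2 * h1
      exact (mul_eq_zero.mp h3).resolve_right
        (mul_ne_zero (derivative_weierstrassCubic_four_zero hpa) hG)
  obtain ⟨T₁, hT₁⟩ := hdvd T hTroot
  set A := branchFactor i j k with hA
  have hA0 : A ≠ 0 := (monic_branchFactor i j k).ne_zero
  -- B is real, so Q is real and R is determined up to sign; being monic, R is real and A R² becomes
  -- A R R̄.
  have hRR : R.map (starRingEnd ℂ) = R := by
    rw [hQ, Polynomial.map_mul, Polynomial.map_pow, map_conj_branchFactor] at hmap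
    rcases sq_eq_sq_iff_eq_or_eq_neg.mp (mul_left_cancel₀ hA0 hmap) with h0 | h0
    · exact h0
    · have h3 := congrArg leadingCoeff h0
      rw [leadingCoeff_neg, (hR.map _).leadingCoeff, hR.leadingCoeff] at h3
      norm_num at h3
  have h2 : (C (1 / 2 : ℂ)) * 2 = 1 := by
    rw [← C_ofNat, ← C_mul]; norm_num
  -- Formally T = 2f ∂f/∂B with f = √A · R, so √A · T₁ = 2 ∂f/∂B. Since (∂f/∂B)'' = V ∂f/∂B + f, the
  -- Wronskian of f and ∂f/∂B has derivative f² along the curve; `M` is this Wronskian in the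
  -- coordinate x.
  refine no_periodic_primitive i j k (R := R)
    (M := C (1 / 2) * (A * (R * derivative T₁ - derivative R * T₁))) hR.ne_zero ?_
  rw [← hA, ← hp, hRR]
  -- Q · form(Q, T) - T · form(Q, Q) eliminates the potential and leaves a first order equation for
  -- the Wronskian of Q and T.
  have hw : Q * (p * derivative (Q * derivative T - derivative Q * T)
      + C (1 / 2) * derivative p * (Q * derivative T - derivative Q * T))
      - p * derivative Q * (Q * derivative T - derivative Q * T) = 2 * Q ^ 3 := by
    rw [lameForm] at hform hT
    simp only [curveLaplacian] at hform hT
    simp only [derivative_mul, derivative_sub]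
    linear_combination Q * hT - T * hform
  have hwQ : Q * derivative T - derivative Q * T =
      Q * (A * (R * derivative T₁ - derivative R * T₁)) := by
    rw [hT₁, hQ]
    simp only [derivative_mul, pow_two]
    ring
  rw [hwQ, derivative_mul] at hw
  set M := A * (R * derivative T₁ - derivative R * T₁) with hM
  have hfin : p * derivative M + C (1 / 2) * derivative p * M = 2 * Q := by
    refine mul_left_cancel₀ (pow_ne_zero 2 hmon.ne_zero) ?_
    linear_combination hw
  rw [derivative_mul, derivative_C]
  linear_combination C (1 / 2) * hfin + Q * h2 + hQ

/-! ### The discriminant -/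

/-- Resultants commute with ring homomorphisms in fixed degrees. In Res(f, f') = ± lc(f) disc(f) the
leading coefficient has nonzero image and can be cancelled. -/
theorem discr_map_of_natDegree_eq {R S : Type*} [CommRing R] [CommRing S] [IsDomain S]
    (φ : R →+* S) {f : R[X]} (hf : 0 < f.natDegree) (h : (f.map φ).natDegree = f.natDegree) :
    (f.map φ).discr = φ f.discr := by
  have hpos : 0 < (f.map φ).natDegree := h ▸ hf
  have hlc : (f.map φ).leadingCoeff = φ f.leadingCoeff := by
    rw [leadingCoeff, h, coeff_map, leadingCoeff]
  have h0 : φ f.leadingCoeff ≠ 0 := by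
    rw [← hlc, Ne, leadingCoeff_eq_zero]
    rintro h0
    simp [h0] at hpos
  have h1 := resultant_deriv (natDegree_pos_iff_degree_pos.mp hpos)
  have h2 := congrArg φ (resultant_deriv (natDegree_pos_iff_degree_pos.mp hf))
  rw [← resultant_map_map, ← derivative_map, ← h, h1, map_mul, map_mul, map_pow, map_neg, map_one,
    hlc] at h2
  refine mul_left_cancel₀ (mul_ne_zero ?_ h0) h2
  exact pow_ne_zero _ (neg_ne_zero.mpr one_ne_zero)

theorem derivative_scaleRoots {R : Type*} [CommRing R] [IsDomain R] [CharZero R] (f : R[X])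
    (r : R) : derivative (f.scaleRoots r) = (derivative f).scaleRoots r := by
  rcases Nat.eq_zero_or_pos f.natDegree with h0 | hpos
  · rw [eq_C_of_natDegree_eq_zero h0]
    simp
  ext i
  rw [coeff_derivative, coeff_scaleRoots, coeff_scaleRoots, coeff_derivative, natDegree_derivative,
    show f.natDegree - (i + 1) = f.natDegree - 1 - i by omega]
  ring

theorem discr_scaleRoots {R : Type*} [CommRing R] [IsDomain R] [CharZero R] {f : R[X]}
    (hf : 0 < f.natDegree) (r : R) :
    (f.scaleRoots r).discr = r ^ (f.natDegree * (f.natDegree - 1)) * f.discr := by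
  have h1 := resultant_deriv (natDegree_pos_iff_degree_pos.mp hf)
  have h2 := resultant_deriv (f := f.scaleRoots r)
    (natDegree_pos_iff_degree_pos.mp (by rwa [natDegree_scaleRoots]))
  have h3 := resultant_scaleRoots f (derivative f) r
  have h4 : (derivative f).natDegree = f.natDegree - 1 := natDegree_derivative f
  rw [derivative_scaleRoots, natDegree_scaleRoots, leadingCoeff_scaleRoots] at h2
  rw [natDegree_scaleRoots, natDegree_scaleRoots, h4, h1, h2] at h3
  have h0 : f.leadingCoeff ≠ 0 := by
    rw [Ne, leadingCoeff_eq_zero]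
    rintro rfl
    simp at hf
  refine mul_left_cancel₀ (mul_ne_zero (pow_ne_zero (f.natDegree * (f.natDegree - 1) / 2)
    (neg_ne_zero.mpr one_ne_zero)) h0) ?_
  rw [h3]
  ring

theorem discr_ne_zero_of_simple_roots {f : ℂ[X]} (hf : 0 < f.natDegree)
    (h : ∀ z, f.eval z = 0 → (derivative f).eval z ≠ 0) : f.discr ≠ 0 := by
  intro h0
  have h1 := resultant_deriv (natDegree_pos_iff_degree_pos.mp hf)
  rw [h0, mul_zero, ← natDegree_derivative, resultant_eq_zero_iff] at h1
  refine h1.2 ?_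
  refine isCoprime_of_dvd _ _ ?_ ?_
  · rintro ⟨rfl, -⟩
    simp at hf
  · rintro z hz hz0 ⟨u, hu⟩ ⟨v, hv⟩
    obtain ⟨a, ha⟩ := IsAlgClosed.exists_root z (by
      intro hdeg
      exact hz (isUnit_iff_degree_eq_zero.mpr hdeg))
    refine h a ?_ ?_
    · rw [hu, eval_mul, IsRoot.def.mp ha, zero_mul]
    · rw [hv, eval_mul, IsRoot.def.mp ha, zero_mul]

theorem evalInvariants_discr (n : ℕ) (hn : 1 ≤ n) (g₂ g₃ : ℂ) :
    (lameEllAt n g₂ g₃).discr = evalInvariants g₂ g₃ (lamePoly n).discr :=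
  discr_map_of_natDegree_eq _ (by rw [natDegree_lamePoly n hn]; omega) (by
    rw [natDegree_lamePoly n hn]; exact natDegree_lameEllAt n hn g₂ g₃)

/-- This single specialisation is the source of both nonvanishing statements about the discriminant.
-/
theorem evalInvariants_four_zero_discr_ne_zero (n : ℕ) (hn : 1 ≤ n) :
    evalInvariants (4 : ℂ) 0 (lamePoly n).discr ≠ 0 := by
  rw [← evalInvariants_discr n hn]
  exact discr_ne_zero_of_simple_roots (by rw [natDegree_lameEllAt n hn]; omega)
    fun B hB => derivative_lameEllAt_ne_zero hB

theorem discr_lamePoly_ne_zero (n : ℕ) (hn : 1 ≤ n) : (lamePoly n).discr ≠ 0 := fun h =>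
  evalInvariants_four_zero_discr_ne_zero n hn (by rw [h, map_zero])

/-! ### Weights -/

/-- The substitution `g₂ ↦ 4 g₂`, `g₃ ↦ 8 g₃`. -/
def scaleInvariants : InvariantRing →ₐ[ℚ] InvariantRing :=
  MvPolynomial.aeval fun i => MvPolynomial.C (2 ^ (![2, 3] i)) * MvPolynomial.X i

theorem coeff_scaleInvariants (P : InvariantRing) (m : Fin 2 →₀ ℕ) :
    (scaleInvariants P).coeff m = 2 ^ (Finsupp.weight ![2, 3] m) * P.coeff m := by
  induction P using MvPolynomial.induction_on' with
  | monomial u a =>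
    have h : scaleInvariants (MvPolynomial.monomial u a) =
        MvPolynomial.monomial u (2 ^ (Finsupp.weight ![2, 3] u) * a) := by
      rw [scaleInvariants, MvPolynomial.aeval_monomial, MvPolynomial.monomial_eq]
      simp only [mul_pow, Finsupp.prod_mul, MvPolynomial.algebraMap_eq, map_mul]
      have h2 : (u.prod fun a b => (MvPolynomial.C (2 ^ (![2, 3] a) : ℚ) : InvariantRing) ^ b) =
          MvPolynomial.C (2 ^ (Finsupp.weight ![2, 3] u)) := by
        simp only [← map_pow, Finsupp.prod, ← map_prod, ← pow_mul, Finset.prod_pow_eq_pow_sum]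
        congr 2
        rw [Finsupp.weight_apply, Finsupp.sum]
        exact Finset.sum_congr rfl fun i _ => by rw [smul_eq_mul, mul_comm]
      rw [h2]
      ring
    rw [h, MvPolynomial.coeff_monomial, MvPolynomial.coeff_monomial]
    split_ifs with hum
    · rw [hum]
    · simp
  | add p q hp hq => rw [map_add, MvPolynomial.coeff_add, hp, hq, MvPolynomial.coeff_add]; ring

/-- Scaling by the single number 2 detects the weight of each monomial, because the powers of 2 are
distinct in ℚ. -/
theorem isWeightedHomogeneous_of_scaleInvariants {P : InvariantRing} {d : ℕ}
    (h : scaleInvariants P = MvPolynomial.C (2 ^ d) * P) :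
    MvPolynomial.IsWeightedHomogeneous ![2, 3] P d := by
  intro m hm
  have h1 := congrArg (MvPolynomial.coeff m) h
  rw [coeff_scaleInvariants, MvPolynomial.coeff_C_mul] at h1
  have h2 := mul_right_cancel₀ hm h1
  exact pow_right_injective₀ (by norm_num) (by norm_num) h2

/-- The substitution `B ↦ 2B`, `g₂ ↦ 4 g₂`, `g₃ ↦ 8 g₃`. -/
def scaleLame : InvariantRing[X] →+* InvariantRing[X] :=
  eval₂RingHom (C.comp scaleInvariants.toRingHom) (C (MvPolynomial.C 2) * X)

theorem scaleLame_C (P : InvariantRing) : scaleLame (C P) = C (scaleInvariants P) := by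
  simp [scaleLame]

theorem scaleLame_X : scaleLame X = C (MvPolynomial.C 2) * X := by simp [scaleLame]

theorem scaleLame_smul (r : ℚ) (P : InvariantRing[X]) : scaleLame (r • P) = r • scaleLame P := by
  have h : ∀ Q : InvariantRing[X], r • Q = C (MvPolynomial.C r) * Q := fun Q => by
    ext; simp [MvPolynomial.smul_eq_C_mul]
  rw [h, h, map_mul, scaleLame_C]
  simp [scaleInvariants]

theorem scaleInvariants_X_zero :
    scaleInvariants (MvPolynomial.X 0) = MvPolynomial.C (2 ^ 2) * MvPolynomial.X 0 := by
  simp [scaleInvariants]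

theorem scaleInvariants_X_one :
    scaleInvariants (MvPolynomial.X 1) = MvPolynomial.C (2 ^ 3) * MvPolynomial.X 1 := by
  simp [scaleInvariants]

theorem coeff_scaleLame (P : InvariantRing[X]) (i : ℕ) :
    (scaleLame P).coeff i = MvPolynomial.C (2 ^ i) * scaleInvariants (P.coeff i) := by
  induction P using Polynomial.induction_on' with
  | add p q hp hq => rw [map_add, coeff_add, hp, hq, coeff_add, map_add]; ring
  | monomial m a =>
    have h : scaleLame (monomial m a) = C (scaleInvariants a * MvPolynomial.C (2 ^ m)) * X ^ m := by
      rw [← C_mul_X_pow_eq_monomial, map_mul, scaleLame_C, map_pow, scaleLame_X, mul_pow, C_mul,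
        ← C_pow, ← map_pow]
      ring
    rw [h, coeff_C_mul, coeff_X_pow, coeff_monomial]
    split_ifs with h1 h2 h2
    · subst h1; ring
    · exact absurd h1.symm h2
    · exact absurd h2.symm h1
    · simp

/-- The recursion is homogeneous for the weights 1, 2, 3 of B, g₂, g₃, so s_k has weight k. Since it
reaches back three steps, the induction covers all smaller indices at once. -/
theorem scaleLame_lameS (n : ℕ) (k : ℕ) : ∀ j : ℤ, j < k →
    scaleLame (lameS n j) = C (MvPolynomial.C (2 ^ j.toNat)) * lameS n j := by
  induction k with
  | zero => intro j hj; rw [lameS_neg n j (by omega)]; simp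
  | succ k ih =>
    intro j hj
    rcases lt_or_ge j k with h | h
    · exact ih j h
    obtain rfl : j = k := by omega
    rcases Nat.eq_zero_or_pos k with h0 | h0
    · subst h0
      simp [lameS_zero]
    -- Moving 2^i to the left side avoids the exponent k - i, so that negative indices are covered
    -- too.
    have key : ∀ i : ℕ, 1 ≤ i → scaleLame (lameS n ((k : ℤ) - i)) *
        C (MvPolynomial.C (2 ^ i)) = C (MvPolynomial.C (2 ^ k)) * lameS n ((k : ℤ) - i) := by
      intro i hi
      rcases lt_or_ge k i with h1 | h1
      · rw [lameS_neg n _ (by omega)]; simp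
      · rw [ih _ (by omega), show ((k : ℤ) - i).toNat = k - i by omega, mul_right_comm, ← C_mul,
          ← map_mul, ← pow_add, Nat.sub_add_cancel h1]
    have k1 := key 1 le_rfl
    have k2 := key 2 (by omega)
    have k3 := key 3 (by omega)
    push_cast at k1 k2 k3
    rw [lameS_eq_step n k h0, lameStep]
    simp only [scaleLame_smul, map_add, map_sub, map_mul, scaleLame_X, scaleLame_C,
      scaleInvariants_X_zero, scaleInvariants_X_one, Int.toNat_natCast, mul_smul_comm]
    congr 1
    simp only [mul_add, mul_sub, mul_smul_comm]
    have e1 : C (MvPolynomial.C (2 : ℚ)) * X * scaleLame (lameS n (k - 1)) =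
        C (MvPolynomial.C (2 ^ k)) * (X * lameS n (k - 1)) := by
      rw [pow_one] at k1
      linear_combination X * k1
    have e2 : C (MvPolynomial.C (2 ^ 2 : ℚ)) * C (MvPolynomial.X 0) *
        scaleLame (lameS n (k - 2)) =
        C (MvPolynomial.C (2 ^ k)) * (C (MvPolynomial.X 0) * lameS n (k - 2)) := by
      linear_combination C (MvPolynomial.X 0) * k2
    have e3 : C (MvPolynomial.C (2 ^ 3 : ℚ)) * C (MvPolynomial.X 1) *
        scaleLame (lameS n (k - 3)) =
        C (MvPolynomial.C (2 ^ k)) * (C (MvPolynomial.X 1) * lameS n (k - 3)) := by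
      linear_combination C (MvPolynomial.X 1) * k3
    rw [e1, e2, e3]

theorem scaleLame_lameS_sub (n i : ℕ) :
    scaleLame (lameS n ((n : ℤ) - i)) * C (MvPolynomial.C (2 ^ i)) =
      C (MvPolynomial.C (2 ^ n)) * lameS n ((n : ℤ) - i) := by
  rcases lt_or_ge n i with h1 | h1
  · rw [lameS_neg n _ (by omega)]; simp
  · rw [scaleLame_lameS n (n + 1) _ (by omega), show ((n : ℤ) - i).toNat = n - i by omega,
      mul_right_comm, ← C_mul, ← map_mul, ← pow_add, Nat.sub_add_cancel h1]

theorem scaleLame_lamePoly (n : ℕ) :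
    scaleLame (lamePoly n) = C (MvPolynomial.C (2 ^ (2 * n + 1))) * lamePoly n := by
  have h0 := scaleLame_lameS_sub n 0
  have h1 := scaleLame_lameS_sub n 1
  have h2 := scaleLame_lameS_sub n 2
  simp only [Nat.cast_zero, sub_zero, pow_zero, map_one, mul_one, Nat.cast_one, pow_one,
    Nat.cast_ofNat] at h0 h1 h2
  have e : C (MvPolynomial.C (2 ^ (2 * n + 1) : ℚ)) =
      (C (MvPolynomial.C 2) * C (MvPolynomial.C (2 ^ n)) ^ 2 : InvariantRing[X]) := by
    simp only [← map_pow, ← map_mul]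
    ring_nf
  have e2 : (C (MvPolynomial.C (2 ^ 2 : ℚ)) : InvariantRing[X]) = C (MvPolynomial.C 2) ^ 2 := by
    simp only [← map_pow]
  have e3 : (C (MvPolynomial.C (2 ^ 3 : ℚ)) : InvariantRing[X]) = C (MvPolynomial.C 2) ^ 3 := by
    simp only [← map_pow]
  have h4 : scaleLame 4 = 4 := map_ofNat _ 4
  rw [e2] at h2
  rw [lamePoly, e]
  simp only [map_add, map_sub, map_mul scaleLame, map_pow scaleLame, scaleLame_X, scaleLame_C,
    scaleInvariants_X_zero, scaleInvariants_X_one, h4, h0, C_mul, e2, e3]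
  generalize C (MvPolynomial.C (2 ^ n : ℚ)) = P at *
  generalize (C (MvPolynomial.C (2 : ℚ)) : InvariantRing[X]) = a at *
  linear_combination (4 * a * C (MvPolynomial.X 1) * P * lameS n n) * h2
    - (a * C (MvPolynomial.X 0) * P * lameS n n) * h1
    - (a * C (MvPolynomial.X 1) * (scaleLame (lameS n (n - 1)) * a + P * lameS n (n - 1))) * h1

/-- Homogeneity of ℓ_n turns the scaling of g₂, g₃ into a scaling of the roots by 2, which
multiplies the discriminant by 2^{d(d-1)} with d = 2n + 1. -/
theorem isWeightedHomogeneous_discr_lamePoly (n : ℕ) (hn : 1 ≤ n) :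
    MvPolynomial.IsWeightedHomogeneous ![2, 3] (lamePoly n).discr (2 * n * (2 * n + 1)) := by
  have hd := natDegree_lamePoly n hn
  have hinj : Function.Injective scaleInvariants := by
    refine (injective_iff_map_eq_zero _).mpr fun P hP => ?_
    ext m
    have := congrArg (MvPolynomial.coeff m) hP
    rw [coeff_scaleInvariants, MvPolynomial.coeff_zero] at this
    simpa using this
  have hmap : (lamePoly n).map scaleInvariants.toRingHom =
      (lamePoly n).scaleRoots (MvPolynomial.C 2) := by
    ext1 i
    rw [coeff_map, coeff_scaleRoots, hd]
    rcases le_or_gt i (2 * n + 1) with hi | hi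
    · have h1 := congrArg (fun P => coeff P i) (scaleLame_lamePoly n)
      simp only [coeff_scaleLame, coeff_C_mul] at h1
      have h2 : (MvPolynomial.C (2 ^ i : ℚ) : InvariantRing) ≠ 0 := by
        simp
      refine mul_left_cancel₀ h2 (h1.trans ?_)
      have : (2 ^ (2 * n + 1) : ℚ) = 2 ^ i * 2 ^ (2 * n + 1 - i) := by
        rw [← pow_add]; congr 1; omega
      rw [this, map_mul, ← map_pow]
      ring
    · rw [coeff_eq_zero_of_natDegree_lt (by omega)]
      simp
  refine isWeightedHomogeneous_of_scaleInvariants ?_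
  have h1 := discr_map_of_natDegree_eq scaleInvariants.toRingHom (f := lamePoly n) (by omega)
    (by rw [hmap, natDegree_scaleRoots])
  rw [hmap, discr_scaleRoots (by omega), hd] at h1
  change scaleInvariants.toRingHom _ = _
  rw [← h1, ← map_pow]
  congr 3
  rw [Nat.add_sub_cancel, mul_comm]

/-! ### Modularity of the invariants -/

theorem G_latticeOf {k : ℕ} (hk : 3 ≤ k) (τ : UpperHalfPlane) :
    (latticeOf τ).G k = 2 * riemannZeta k * ModularForm.E hk τ := by
  have h1 : (latticeOf τ).G k = ∑' v, EisensteinSeries.eisSummand k v τ := by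
    -- The coordinates are swapped: the Eisenstein summand attaches τ to `v 0`, while τ is the
    -- second period of the lattice.
    rw [PeriodPair.G, ← (latticeOf τ).latticeEquivProd.symm.toEquiv.tsum_eq,
      ← (Equiv.prodComm ℤ ℤ).tsum_eq, ← (finTwoArrowEquiv ℤ).tsum_eq]
    refine tsum_congr fun v => ?_
    have h2 := (latticeOf τ).latticeEquiv_symm_apply (v 1, v 0)
    change (((latticeOf τ).latticeEquivProd.symm (v 1, v 0)).1 ^ k)⁻¹ =
      (v 0 * (τ : ℂ) + v 1) ^ (-(k : ℤ))
    rw [h2, zpow_neg, zpow_natCast]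
    simp [latticeOf, add_comm]
  rw [h1, tsum_eisSummand_eq_riemannZeta_mul_eisensteinSeries hk,
    show ModularForm.E hk τ = (1 / 2 : ℂ) •
      EisensteinSeries.eisensteinSeriesSIF (N := 1) 0 k τ from rfl,
    EisensteinSeries.eisensteinSeriesSIF_apply, smul_eq_mul]
  ring

theorem g₂_latticeOf (τ : UpperHalfPlane) :
    (latticeOf τ).g₂ = 120 * riemannZeta 4 * ModularForm.E₄ τ := by
  have := G_latticeOf (k := 4) (by norm_num) τ
  rw [PeriodPair.g₂, this]
  push_cast
  ring

theorem g₃_latticeOf (τ : UpperHalfPlane) :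
    (latticeOf τ).g₃ = 280 * riemannZeta 6 * ModularForm.E₆ τ := by
  have := G_latticeOf (k := 6) (by norm_num) τ
  rw [PeriodPair.g₃, this]
  push_cast
  ring

/-- Multiplication by i permutes ℤ[i] and multiplies each summand by i^{-6} = -1. -/
theorem E₆_I : ModularForm.E₆ UpperHalfPlane.I = 0 := by
  have h := tsum_eisSummand_eq_riemannZeta_mul_eisensteinSeries (k := 6)
    (by norm_num) UpperHalfPlane.I
  have hz : riemannZeta (6 : ℕ) ≠ 0 := riemannZeta_ne_zero_of_one_lt_re (by norm_num)
  have h0 : ∑' v, EisensteinSeries.eisSummand (6 : ℕ) v UpperHalfPlane.I = 0 := by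
    let e : (Fin 2 → ℤ) ≃ (Fin 2 → ℤ) :=
      { toFun v := ![v 1, -v 0]
        invFun v := ![-v 1, v 0]
        left_inv v := by ext i; fin_cases i <;> simp
        right_inv v := by ext i; fin_cases i <;> simp }
    rw [← CharZero.eq_neg_self_iff, ← tsum_neg, ← e.tsum_eq]
    refine tsum_congr fun v => ?_
    have hI : (UpperHalfPlane.I : ℂ) = Complex.I := rfl
    have h1 : ((v 1 : ℂ) * Complex.I + (-v 0 : ℤ)) = Complex.I * (v 0 * Complex.I + v 1) := by
      push_cast
      linear_combination -(v 0 : ℂ) * Complex.I_sq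
    simp only [EisensteinSeries.eisSummand, e, Equiv.coe_fn_mk, Matrix.cons_val_zero,
      Matrix.cons_val_one, hI]
    rw [h1, mul_zpow]
    have h2 : Complex.I ^ (-((6 : ℕ) : ℤ)) = -1 := by
      rw [zpow_neg, zpow_natCast, show Complex.I ^ 6 = (Complex.I ^ 2) ^ 3 by ring, Complex.I_sq]
      norm_num
    rw [h2]
    ring
  rw [h0, eq_comm, mul_eq_zero, or_iff_right hz] at h
  rw [show ModularForm.E₆ UpperHalfPlane.I = (1 / 2 : ℂ) •
      EisensteinSeries.eisensteinSeriesSIF (N := 1) 0 6 UpperHalfPlane.I from rfl,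
    EisensteinSeries.eisensteinSeriesSIF_apply]
  exact (congrArg _ h).trans (smul_zero _)

theorem E₄_I_ne_zero : ModularForm.E₄ UpperHalfPlane.I ≠ 0 := by
  intro h
  have := ModularForm.discriminant_eq_E₄_cube_sub_E₆_sq UpperHalfPlane.I
  rw [h, E₆_I] at this
  exact ModularForm.discriminant_ne_zero UpperHalfPlane.I (by simpa using this)

/-- A weighted homogeneous polynomial in the invariants is a modular form. -/
theorem exists_modularForm_of_isWeightedHomogeneous {P : InvariantRing} {d : ℕ}
    (hP : MvPolynomial.IsWeightedHomogeneous ![2, 3] P d) {k : ℤ} (hk : k = 2 * d) :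
    ∃ f : ModularForm 𝒮ℒ k, ∀ τ, f τ = invariantsAt (latticeOf τ) P := by
  -- Only exponents in the support have the right weight; elsewhere the zero form is a default
  -- value.
  have hmon : ∀ m : Fin 2 →₀ ℕ, ∃ f : ModularForm 𝒮ℒ k, m ∈ P.support →
      ∀ τ, f τ = ModularForm.E₄ τ ^ m 0 * ModularForm.E₆ τ ^ m 1 := by
    intro m
    by_cases hm : m ∈ P.support
    · have hw := hP (MvPolynomial.mem_support_iff.mp hm)
      have hw' : 2 * m 0 + 3 * m 1 = d := by
        rw [← hw, Finsupp.weight_apply, Finsupp.sum_fintype _ _ (by simp)]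
        simp [Fin.sum_univ_two, mul_comm]
      refine ⟨((ModularForm.E₄.pow (m 0)).mul (ModularForm.E₆.pow (m 1))).mcast ?_, fun _ τ => ?_⟩
      · rw [hk, ← hw']; push_cast; ring
      · simp
    · exact ⟨0, fun h => absurd h hm⟩
  choose F hF using hmon
  refine ⟨∑ m ∈ P.support, (((MvPolynomial.coeff m P : ℚ) : ℂ) * (120 * riemannZeta 4) ^ m 0 *
    (280 * riemannZeta 6) ^ m 1) • F m, fun τ => ?_⟩
  rw [invariantsAt, MvPolynomial.aeval_def, MvPolynomial.eval₂_eq']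
  have hsum : ∀ (s : Finset (Fin 2 →₀ ℕ)) (g : (Fin 2 →₀ ℕ) → ModularForm 𝒮ℒ k),
      (∑ m ∈ s, g m) τ = ∑ m ∈ s, g m τ := by
    intro s g
    induction s using Finset.cons_induction with
    | empty => simp
    | cons a s ha ih => rw [Finset.sum_cons, Finset.sum_cons, ← ih]; rfl
  rw [hsum]
  refine Finset.sum_congr rfl fun m hm => ?_
  have h1 : ∀ c : ℂ, (c • F m) τ = c * F m τ := fun c => rfl
  rw [h1, hF m hm, Fin.prod_univ_two]
  simp only [Matrix.cons_val_zero, Matrix.cons_val_one, g₂_latticeOf, g₃_latticeOf, mul_pow]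
  change _ = ((MvPolynomial.coeff m P : ℚ) : ℂ) * _
  ring

theorem evalInvariants_weighted {P : InvariantRing} {d : ℕ}
    (hP : MvPolynomial.IsWeightedHomogeneous ![2, 3] P d) (t g₂ g₃ : ℂ) :
    evalInvariants (t ^ 2 * g₂) (t ^ 3 * g₃) P = t ^ d * evalInvariants g₂ g₃ P := by
  change MvPolynomial.aeval (R := ℚ) _ P = _ * MvPolynomial.aeval (R := ℚ) _ P
  rw [MvPolynomial.aeval_def, MvPolynomial.eval₂_eq', MvPolynomial.aeval_def,
    MvPolynomial.eval₂_eq', Finset.mul_sum]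
  refine Finset.sum_congr rfl fun m hm => ?_
  have hw := hP (MvPolynomial.mem_support_iff.mp hm)
  have hw' : 2 * m 0 + 3 * m 1 = d := by
    rw [← hw, Finsupp.weight_apply, Finsupp.sum_fintype _ _ (by simp)]
    simp [Fin.sum_univ_two, mul_comm]
  rw [Fin.prod_univ_two, Fin.prod_univ_two, ← hw']
  simp only [Matrix.cons_val_zero, Matrix.cons_val_one]
  ring

/-- The square lattice has g₃ = 0 and g₂ ≠ 0, so its invariants are (4t², 0) for some t ≠ 0, and
weighted homogeneity reduces the claim to (4, 0). -/
theorem invariantsAt_latticeOf_I_discr_ne_zero (n : ℕ) (hn : 1 ≤ n) :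
    invariantsAt (latticeOf UpperHalfPlane.I) (lamePoly n).discr ≠ 0 := by
  have h3 : (latticeOf UpperHalfPlane.I).g₃ = 0 := by rw [g₃_latticeOf, E₆_I, mul_zero]
  have h2 : (latticeOf UpperHalfPlane.I).g₂ ≠ 0 := by
    have hz : riemannZeta 4 ≠ 0 := riemannZeta_ne_zero_of_one_lt_re (by norm_num)
    rw [g₂_latticeOf]
    exact mul_ne_zero (mul_ne_zero (by norm_num) hz) E₄_I_ne_zero
  obtain ⟨t, ht⟩ := IsAlgClosed.exists_pow_nat_eq ((latticeOf UpperHalfPlane.I).g₂ / 4)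
    (n := 2) (by norm_num)
  have ht0 : t ≠ 0 := by
    rintro rfl
    rw [zero_pow two_ne_zero, eq_comm, div_eq_zero_iff] at ht
    exact ht.elim h2 (by norm_num)
  have h := evalInvariants_weighted (isWeightedHomogeneous_discr_lamePoly n hn) t 4 0
  rw [ht, div_mul_cancel₀ _ (by norm_num), mul_zero] at h
  change evalInvariants (latticeOf UpperHalfPlane.I).g₂ (latticeOf UpperHalfPlane.I).g₃ _ ≠ 0
  rw [h3, h]
  exact mul_ne_zero (pow_ne_zero _ ht0) (evalInvariants_four_zero_discr_ne_zero n hn)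

theorem exists_modularForm_discr_lamePoly (n : ℕ) (hn : 1 ≤ n) :
    ∃ f : ModularForm 𝒮ℒ (4 * n * (2 * n + 1)), f ≠ 0 ∧
      ∀ τ, f τ = invariantsAt (latticeOf τ) (lamePoly n).discr := by
  obtain ⟨f, hf⟩ := exists_modularForm_of_isWeightedHomogeneous
    (isWeightedHomogeneous_discr_lamePoly n hn) (k := 4 * n * (2 * n + 1)) (by push_cast; ring)
  refine ⟨f, ?_, hf⟩
  rintro rfl
  exact invariantsAt_latticeOf_I_discr_ne_zero n hn (hf _).symm

/-! ### Morphisms and open immersions of spaces with functions -/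

namespace VarietyStructure

variable {X Y : Type*}

/-- Every quotient of forms on `Y` is, near each point, pulled back to a quotient of forms. -/
def PullsBackForms (F : ℕ → Set (X → ℂ)) (G : ℕ → Set (Y → ℂ)) (φ : X → Y) : Prop :=
  ∀ x d, ∀ a ∈ G d, ∀ b ∈ G d, b (φ x) ≠ 0 → ∃ e, ∃ a' ∈ F e, ∃ b' ∈ F e, b' x ≠ 0 ∧
    ∀ y, b' y ≠ 0 → b (φ y) ≠ 0 ∧ a (φ y) / b (φ y) = a' y / b' y

/-- Every quotient of forms on `X` extends, near each point, to a quotient of forms on `Y`. -/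
def ExtendsForms (F : ℕ → Set (X → ℂ)) (G : ℕ → Set (Y → ℂ)) (φ : X → Y) : Prop :=
  ∀ x d, ∀ a ∈ F d, ∀ b ∈ F d, b x ≠ 0 → ∃ e, ∃ a' ∈ G e, ∃ b' ∈ G e, b' (φ x) ≠ 0 ∧
    ∀ y, b' y ≠ 0 → ∃ z, φ z = y ∧ b z ≠ 0 ∧ a z / b z = a' y / b' y

theorem isOpen_ofForms {F : ℕ → Set (X → ℂ)} {d : ℕ} {b : X → ℂ} (hb : b ∈ F d) :
    IsOpen[(ofForms F).top] {x | b x ≠ 0} :=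
  TopologicalSpace.isOpen_generateFrom_of_mem ⟨d, b, hb, rfl⟩

theorem isOpen_ofForms_of_forall {F : ℕ → Set (X → ℂ)} {U : Set X}
    (h : ∀ x ∈ U, ∃ d, ∃ b ∈ F d, b x ≠ 0 ∧ ∀ y, b y ≠ 0 → y ∈ U) :
    IsOpen[(ofForms F).top] U := by
  let := (ofForms F).top
  rw [isOpen_iff_forall_mem_open]
  intro x hx
  obtain ⟨d, b, hb, hbx, hbU⟩ := h x hx
  exact ⟨{x | b x ≠ 0}, hbU, isOpen_ofForms hb, hbx⟩

variable {F : ℕ → Set (X → ℂ)} {G : ℕ → Set (Y → ℂ)} {φ : X → Y}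

theorem PullsBackForms.continuous (h : PullsBackForms F G φ) :
    Continuous[(ofForms F).top, (ofForms G).top] φ := by
  let := (ofForms F).top
  refine continuous_generateFrom_iff.mpr ?_
  rintro _ ⟨d, b, hb, rfl⟩
  refine isOpen_ofForms_of_forall fun x hx => ?_
  obtain ⟨e, a', _, b', hb', hx', hy⟩ := h x d b hb b hb hx
  exact ⟨e, b', hb', hx', fun y hyb => (hy y hyb).1⟩

theorem PullsBackForms.isRegularOn (h : PullsBackForms F G φ) {V : Set Y} {f : Y → ℂ}
    (hf : (ofForms G).IsRegularOn V f) : (ofForms F).IsRegularOn (φ ⁻¹' V) (f ∘ φ) := by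
  intro x hx
  obtain ⟨d, a, ha, b, hb, hbx, hV⟩ := hf (φ x) hx
  obtain ⟨e, a', ha', b', hb', hx', hy⟩ := h x d a ha b hb hbx
  refine ⟨e, a', ha', b', hb', hx', fun y hyV hyb => ?_⟩
  rw [Function.comp_apply, hV (φ y) hyV (hy y hyb).1, (hy y hyb).2]

theorem PullsBackForms.isMorphism (h : PullsBackForms F G φ) :
    IsMorphism (ofForms F) (ofForms G) φ :=
  ⟨h.continuous, fun _ _ _ hf => h.isRegularOn hf⟩

/-- The nonvanishing locus of the denominator in `ExtendsForms` lies in the image of φ. This yields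
openness of the image, the induced topology, and regular functions on the image; `hF` supplies a
denominator at every point. -/
theorem isOpenImmersion_of_forms (hF : ∀ x, ∃ d, ∃ b ∈ F d, b x ≠ 0)
    (hφ : Function.Injective φ) (h₁ : PullsBackForms F G φ) (h₂ : ExtendsForms F G φ) :
    IsOpenImmersion (ofForms F) (ofForms G) φ := by
  refine ⟨?_, fun V _ f => ⟨fun hf => ?_, fun hf => ?_⟩⟩
  · let := (ofForms F).top
    let := (ofForms G).top
    refine ⟨⟨⟨le_antisymm h₁.continuous.le_induced ?_⟩, hφ⟩, ?_⟩
    · refine le_generateFrom ?_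
      rintro _ ⟨d, b, hb, rfl⟩
      refine (@isOpen_iff_forall_mem_open X
        (TopologicalSpace.induced φ (ofForms G).top) _).mpr fun x hx => ?_
      obtain ⟨e, a', _, b', hb', hx', hy⟩ := h₂ x d b hb b hb hx
      refine ⟨φ ⁻¹' {y | b' y ≠ 0}, fun y hyb => ?_, ⟨_, isOpen_ofForms hb', rfl⟩, hx'⟩
      obtain ⟨z, hz, hbz, -⟩ := hy _ hyb
      rwa [hφ hz] at hbz
    · refine isOpen_ofForms_of_forall ?_
      rintro _ ⟨x, rfl⟩
      obtain ⟨d, b, hb, hbx⟩ := hF x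
      obtain ⟨e, a', _, b', hb', hx', hy⟩ := h₂ x d b hb b hb hbx
      refine ⟨e, b', hb', hx', fun y hyb => ?_⟩
      obtain ⟨z, hz, -⟩ := hy _ hyb
      exact ⟨z, hz⟩
  · simpa only [Set.preimage_image_eq _ hφ] using h₁.isRegularOn hf
  · rintro _ ⟨x, hx, rfl⟩
    obtain ⟨d, a, ha, b, hb, hbx, hV⟩ := hf x hx
    obtain ⟨e, a', ha', b', hb', hx', hy⟩ := h₂ x d a ha b hb hbx
    refine ⟨e, a', ha', b', hb', hx', ?_⟩
    rintro _ ⟨y, hyV, rfl⟩ hyb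
    obtain ⟨z, hz, hbz, habz⟩ := hy _ hyb
    obtain rfl := hφ hz
    rw [← habz]
    exact hV z hyV hbz

theorem IsOpenImmersion.injective {S : VarietyStructure X} {T : VarietyStructure Y} {φ : X → Y}
    (h : IsOpenImmersion S T φ) : Function.Injective φ := by
  let := S.top
  let := T.top
  exact h.1.injective

theorem IsOpenImmersion.isOpen_range {S : VarietyStructure X} {T : VarietyStructure Y} {φ : X → Y}
    (h : IsOpenImmersion S T φ) : IsOpen[T.top] (Set.range φ) := by
  let := S.top
  let := T.top
  exact h.1.isOpen_range

theorem IsOpenImmersion.isOpen_preimage {S : VarietyStructure X} {T : VarietyStructure Y}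
    {φ : X → Y} (h : IsOpenImmersion S T φ) {U : Set Y} (hU : IsOpen[T.top] U) :
    IsOpen[S.top] (φ ⁻¹' U) := by
  let := S.top
  let := T.top
  exact h.1.continuous.isOpen_preimage U hU

theorem IsOpenImmersion.comp {Z : Type*} {S : VarietyStructure X} {T : VarietyStructure Y}
    {U : VarietyStructure Z} {φ : X → Y} {ψ : Y → Z} (hψ : IsOpenImmersion T U ψ)
    (hφ : IsOpenImmersion S T φ) : IsOpenImmersion S U (ψ ∘ φ) := by
  let := S.top
  let := T.top
  let := U.top
  refine ⟨hψ.1.comp hφ.1, fun V hV f => ?_⟩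
  rw [Set.image_comp, hψ.2 _ (hφ.1.isOpenMap V hV), hφ.2 V hV]
  rfl

end VarietyStructure

/-! ### Forms in homogeneous coordinates -/

theorem MvPolynomial.IsHomogeneous.eval_smul_point {σ R : Type*} [CommRing R]
    {p : MvPolynomial σ R} {d : ℕ} (hp : p.IsHomogeneous d) (c : R) (v : σ → R) :
    MvPolynomial.eval (c • v) p = c ^ d * MvPolynomial.eval v p := by
  rw [MvPolynomial.eval_eq, MvPolynomial.eval_eq, Finset.mul_sum]
  refine Finset.sum_congr rfl fun m hm => ?_
  have h := hp (MvPolynomial.mem_support_iff.mp hm)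
  simp only [Pi.smul_apply, smul_eq_mul, mul_pow, Finset.prod_mul_distrib,
    Finset.prod_pow_eq_pow_sum]
  rw [show ∑ i ∈ m.support, m i = d by rw [← h]; simp [Finsupp.weight_apply, Finsupp.sum]]
  ring

/-- Homogenization with respect to the coordinate `i₀`, padded so as to vanish where it does. -/
theorem MvPolynomial.exists_homogenization {σ τ : Type*} (k : σ → τ) (i₀ : τ)
    (p : MvPolynomial σ ℂ) {N : ℕ} (hN : p.totalDegree < N) :
    ∃ P : MvPolynomial τ ℂ, P.IsHomogeneous N ∧ ∀ v : τ → ℂ, (v i₀ = 0 → eval v P = 0) ∧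
      (v i₀ ≠ 0 → eval v P = v i₀ ^ N * eval (fun s => v (k s) / v i₀) p) := by
  refine ⟨∑ m ∈ p.support, C (p.coeff m) * (X i₀ ^ (N - m.degree) *
    m.prod fun s e => X (k s) ^ e), IsHomogeneous.sum _ _ _ fun m hm => ?_, fun v => ⟨?_, ?_⟩⟩
  · have h1 : m.degree ≤ p.totalDegree := le_totalDegree hm
    have h2 : (m.prod fun s e => (X (k s) : MvPolynomial τ ℂ) ^ e).IsHomogeneous m.degree :=
      IsHomogeneous.prod _ _ _ fun s _ => isHomogeneous_X_pow _ _
    have h3 := (isHomogeneous_C τ (p.coeff m)).mul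
      ((isHomogeneous_X_pow (R := ℂ) i₀ (N - m.degree)).mul h2)
    rwa [zero_add, Nat.sub_add_cancel (by omega)] at h3
  · intro h0
    rw [map_sum]
    refine Finset.sum_eq_zero fun m hm => ?_
    have h1 : m.degree ≤ p.totalDegree := le_totalDegree hm
    rw [map_mul, map_mul, map_pow, eval_X, h0, zero_pow (by omega), zero_mul, mul_zero]
  · intro h0
    rw [map_sum, eval_eq, Finset.mul_sum]
    refine Finset.sum_congr rfl fun m hm => ?_
    have h1 : m.degree ≤ p.totalDegree := le_totalDegree hm
    rw [map_mul, map_mul, map_pow, eval_X, eval_C, Finsupp.prod, map_prod]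
    simp only [map_pow, eval_X, div_pow, Finset.prod_div_distrib, Finset.prod_pow_eq_pow_sum]
    rw [← Nat.sub_add_cancel (h1.trans hN.le), pow_add, Nat.add_sub_cancel,
      show ∑ i ∈ m.support, m i = m.degree from rfl]
    have := pow_ne_zero m.degree h0
    field_simp

namespace VarietyStructure

variable {X Y σ τ : Type*}

theorem pullsBackForms_affine_projective {e : X → σ → ℂ} {e' : Y → ℙ ℂ (τ → ℂ)} {φ : X → Y}
    (w : τ → MvPolynomial σ ℂ) (hw : ∀ x, ∃ c : ℂ, c ≠ 0 ∧ ∀ i,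
      (e' (φ x)).rep i = c * MvPolynomial.eval (e x) (w i)) :
    PullsBackForms (fun _ => {h | ∃ p : MvPolynomial σ ℂ, h = fun x => MvPolynomial.eval (e x) p})
      (fun d => {h | ∃ p : MvPolynomial τ ℂ, p.IsHomogeneous d ∧
        h = fun x => MvPolynomial.eval (e' x).rep p}) φ := by
  rintro x d _ ⟨p, hp, rfl⟩ _ ⟨q, hq, rfl⟩ hx
  have key : ∀ y, ∃ c : ℂ, c ≠ 0 ∧ ∀ r : MvPolynomial τ ℂ, r.IsHomogeneous d →
      MvPolynomial.eval (e' (φ y)).rep r = c * MvPolynomial.eval (e y) (MvPolynomial.bind₁ w r) := by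
    intro y
    obtain ⟨c, hc, h⟩ := hw y
    refine ⟨c ^ d, pow_ne_zero _ hc, fun r hr => ?_⟩
    rw [show (e' (φ y)).rep = c • fun i => MvPolynomial.eval (e y) (w i) from funext h,
      hr.eval_smul_point]
    exact congrArg _ (MvPolynomial.eval₂Hom_bind₁ (RingHom.id ℂ) _ w r).symm
  refine ⟨0, _, ⟨MvPolynomial.bind₁ w p, rfl⟩, _, ⟨MvPolynomial.bind₁ w q, rfl⟩, ?_, ?_⟩
  · obtain ⟨c, hc, h⟩ := key x
    simp only [h q hq] at hx
    exact right_ne_zero_of_mul hx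
  · intro y hy
    obtain ⟨c, hc, h⟩ := key y
    simp only [h q hq, h p hp]
    exact ⟨mul_ne_zero hc hy, mul_div_mul_left _ _ hc⟩

/-- A standard affine chart `Z_{i₀} ≠ 0`. -/
theorem isOpenImmersion_affine_chart {e : X → σ → ℂ} {e' : Y → ℙ ℂ (τ → ℂ)} {φ : X → Y}
    (he : Function.Injective e) (w : τ → MvPolynomial σ ℂ)
    (hw : ∀ x, ∃ c : ℂ, c ≠ 0 ∧ ∀ i, (e' (φ x)).rep i = c * MvPolynomial.eval (e x) (w i))
    (i₀ : τ) (k : σ → τ) (h₀ : ∀ x, (e' (φ x)).rep i₀ ≠ 0)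
    (hk : ∀ x s, e x s = (e' (φ x)).rep (k s) / (e' (φ x)).rep i₀)
    (hsurj : ∀ y, (e' y).rep i₀ ≠ 0 → ∃ z, φ z = y) :
    IsOpenImmersion (affine e) (projective e') φ := by
  refine isOpenImmersion_of_forms (fun x => ⟨0, _, ⟨1, rfl⟩, by simp⟩) ?_
    (pullsBackForms_affine_projective w hw) ?_
  · intro x y hxy
    refine he (funext fun s => ?_)
    rw [hk, hk, hxy]
  · rintro x d _ ⟨p, rfl⟩ _ ⟨q, rfl⟩ hx
    -- A common degree above both total degrees gives a quotient of forms of equal degree, both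
    -- vanishing outside the chart.
    have hp : p.totalDegree < p.totalDegree + q.totalDegree + 1 := by omega
    have hq : q.totalDegree < p.totalDegree + q.totalDegree + 1 := by omega
    obtain ⟨P, hP, hPv⟩ := MvPolynomial.exists_homogenization k i₀ p hp
    obtain ⟨Q, hQ, hQv⟩ := MvPolynomial.exists_homogenization k i₀ q hq
    have hez : ∀ z, (fun s => (e' (φ z)).rep (k s) / (e' (φ z)).rep i₀) = e z :=
      fun z => funext fun s => (hk z s).symm
    refine ⟨_, _, ⟨P, hP, rfl⟩, _, ⟨Q, hQ, rfl⟩, ?_, fun y hy => ?_⟩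
    · simp only [(hQv _).2 (h₀ x), hez]
      exact mul_ne_zero (pow_ne_zero _ (h₀ x)) hx
    · have hy0 : (e' y).rep i₀ ≠ 0 := fun h => hy ((hQv _).1 h)
      obtain ⟨z, rfl⟩ := hsurj y hy0
      simp only [(hQv _).2 hy0, (hPv _).2 hy0, hez] at hy ⊢
      exact ⟨z, rfl, right_ne_zero_of_mul hy, (mul_div_mul_left _ _ (pow_ne_zero _ hy0)).symm⟩

/-- A map between projective varieties given locally by forms of degree one. -/
theorem isMorphism_projective {e : X → ℙ ℂ (σ → ℂ)} {e' : Y → ℙ ℂ (τ → ℂ)} {φ : X → Y}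
    (h : ∀ x, ∃ (w : τ → MvPolynomial σ ℂ) (m : ℕ) (t : MvPolynomial σ ℂ),
      (∀ i, (w i).IsHomogeneous 1) ∧ t.IsHomogeneous m ∧ MvPolynomial.eval (e x).rep t ≠ 0 ∧
      ∀ y, MvPolynomial.eval (e y).rep t ≠ 0 → ∃ c : ℂ, c ≠ 0 ∧ ∀ i,
        (e' (φ y)).rep i = c * MvPolynomial.eval (e y).rep (w i)) :
    IsMorphism (projective e) (projective e') φ := by
  refine PullsBackForms.isMorphism ?_
  rintro x d _ ⟨p, hp, rfl⟩ _ ⟨q, hq, rfl⟩ hx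
  obtain ⟨w, m, t, hw, ht, htx, hc⟩ := h x
  have key : ∀ y, MvPolynomial.eval (e y).rep t ≠ 0 → ∃ c : ℂ, c ≠ 0 ∧
      ∀ r : MvPolynomial τ ℂ, r.IsHomogeneous d → MvPolynomial.eval (e' (φ y)).rep r =
        c * MvPolynomial.eval (e y).rep (MvPolynomial.bind₁ w r) := by
    intro y hy
    obtain ⟨c, hc, h⟩ := hc y hy
    refine ⟨c ^ d, pow_ne_zero _ hc, fun r hr => ?_⟩
    rw [show (e' (φ y)).rep = c • fun i => MvPolynomial.eval (e y).rep (w i) from funext h,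
      hr.eval_smul_point]
    exact congrArg _ (MvPolynomial.eval₂Hom_bind₁ (RingHom.id ℂ) _ w r).symm
  have hhom : ∀ r : MvPolynomial τ ℂ, r.IsHomogeneous d →
      (t * MvPolynomial.bind₁ w r).IsHomogeneous (m + d) := by
    intro r hr
    have := ht.mul (hr.aeval w hw)
    rwa [one_mul] at this
  refine ⟨m + d, _, ⟨t * MvPolynomial.bind₁ w p, hhom p hp, rfl⟩, _,
    ⟨t * MvPolynomial.bind₁ w q, hhom q hq, rfl⟩, ?_, ?_⟩
  · obtain ⟨c, hc, h⟩ := key x htx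
    simp only [h q hq, map_mul] at hx ⊢
    exact mul_ne_zero htx (right_ne_zero_of_mul hx)
  · intro y hy
    rw [map_mul] at hy
    have hty := left_ne_zero_of_mul hy
    obtain ⟨c, hc, h⟩ := key y hty
    simp only [h q hq, h p hp, map_mul]
    exact ⟨mul_ne_zero hc (right_ne_zero_of_mul hy), by
      rw [mul_div_mul_left _ _ hc, mul_div_mul_left _ _ hty]⟩

/-- The linear forms x_i Z_j - x_j Z_i cut out the point x. -/
theorem t1Space_projective {e : X → ℙ ℂ (σ → ℂ)} (he : Function.Injective e) :
    @T1Space X (projective e).top := by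
  let := (projective e).top
  refine ⟨fun x => ⟨?_⟩⟩
  refine isOpen_ofForms_of_forall fun y hy => ?_
  by_contra! hcon
  have hprop : ∀ i j, (e x).rep i * (e y).rep j = (e x).rep j * (e y).rep i := by
    intro i j
    by_contra hij
    obtain ⟨z, hz, hzU⟩ := hcon 1 _ ⟨MvPolynomial.C ((e x).rep i) * MvPolynomial.X j -
      MvPolynomial.C ((e x).rep j) * MvPolynomial.X i,
      ((MvPolynomial.isHomogeneous_C_mul_X _ _).sub (MvPolynomial.isHomogeneous_C_mul_X _ _)),
      rfl⟩ (by simpa [sub_eq_zero] using hij)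
    simp only [Set.mem_compl_iff, Set.mem_singleton_iff, not_not] at hzU
    subst hzU
    refine hz ?_
    simp [mul_comm]
  obtain ⟨i, hi⟩ := Function.ne_iff.mp (e x).rep_nonzero
  refine hy (he ?_)
  rw [← (e x).mk_rep, ← (e y).mk_rep, Projectivization.mk_eq_mk_iff']
  refine ⟨(e y).rep i / (e x).rep i, funext fun j => ?_⟩
  have hi' : (e x).rep i ≠ 0 := hi
  rw [Pi.smul_apply, smul_eq_mul, div_mul_eq_mul_div, div_eq_iff hi', mul_comm _ ((e x).rep i),
    hprop i j, mul_comm]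

end VarietyStructure

/-! ### Cofinite topologies -/

/-- "Empty or cofinite" is stable under unions and finite intersections, so it need only be checked
on generators. -/
theorem finite_compl_of_isOpen_generateFrom {X : Type*} {S : Set (Set X)}
    (hS : ∀ U ∈ S, U.Nonempty → Uᶜ.Finite) {U : Set X}
    (h : IsOpen[TopologicalSpace.generateFrom S] U) : U.Nonempty → Uᶜ.Finite := by
  induction h with
  | basic U hU => exact hS U hU
  | univ => simp
  | inter U V _ _ hU hV =>
    rintro ⟨x, hxU, hxV⟩
    rw [Set.compl_inter]
    exact (hU ⟨x, hxU⟩).union (hV ⟨x, hxV⟩)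
  | sUnion A _ hA =>
    rintro ⟨x, V, hVA, hxV⟩
    exact (hA V hVA ⟨x, hxV⟩).subset (Set.compl_subset_compl.mpr (Set.subset_sUnion_of_mem hVA))

theorem irreducibleSpace_of_isOpen_iff_finite_compl {X : Type*} [TopologicalSpace X] [Infinite X]
    (h : ∀ U : Set X, IsOpen U ↔ (U.Nonempty → Uᶜ.Finite)) : IrreducibleSpace X where
  isPreirreducible_univ := by
    rintro U V hU hV ⟨x, -, hx⟩ ⟨y, -, hy⟩
    rw [Set.univ_inter, Set.nonempty_iff_ne_empty]
    intro h0
    have := ((h U).mp hU ⟨x, hx⟩).union ((h V).mp hV ⟨y, hy⟩)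
    rw [← Set.compl_inter, h0, Set.compl_empty] at this
    exact Set.infinite_univ this
  toNonempty := inferInstance

/-- A proper irreducible closed subset is finite, hence a point: the maximal chains are a point
inside the whole space. -/
theorem topologicalKrullDim_of_isOpen_iff_finite_compl {X : Type*} [TopologicalSpace X]
    [Infinite X] (h : ∀ U : Set X, IsOpen U ↔ (U.Nonempty → Uᶜ.Finite)) :
    topologicalKrullDim X = 1 := by
  have hirr := irreducibleSpace_of_isOpen_iff_finite_compl h
  have hcl : ∀ A : Set X, IsClosed A ↔ (A ≠ Set.univ → A.Finite) := by
    intro A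
    rw [← isOpen_compl_iff, h, compl_compl, Set.nonempty_compl]
  have hclosed : ∀ x : X, IsClosed ({x} : Set X) := fun x =>
    (hcl _).mpr fun _ => Set.finite_singleton x
  have hsub : ∀ A : TopologicalSpace.IrreducibleCloseds X, (A : Set X) ≠ Set.univ →
      (A : Set X).Subsingleton := by
    intro A hA x hx y hy
    by_contra hxy
    have hfin := (hcl _).mp A.isClosed hA
    obtain ⟨z, hzA, hzx, hzy⟩ := A.isIrreducible.isPreirreducible ((A : Set X) \ {x})ᶜ {x}ᶜ
      ((hcl _).mpr fun _ => hfin.subset Set.sdiff_subset).isOpen_compl (hclosed x).isOpen_compl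
      ⟨x, hx, by simp⟩ ⟨y, hy, fun h => hxy (Set.mem_singleton_iff.mp h).symm⟩
    exact hzx ⟨hzA, hzy⟩
  refine le_antisymm ?_ ?_
  · refine Order.krullDim_le_one_iff.mpr fun A => ?_
    by_cases hA : (A : Set X) = Set.univ
    · right
      intro B _
      change (B : Set X) ⊆ A
      rw [hA]
      exact Set.subset_univ _
    · left
      intro B hBA
      change (A : Set X) ⊆ B
      obtain ⟨b, hb⟩ := B.isIrreducible.nonempty
      intro a ha
      rwa [hsub A hA ha (hBA hb)]
  · refine Order.one_le_krullDim_iff.mpr ?_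
    obtain ⟨x⟩ : Nonempty X := inferInstance
    refine ⟨⟨{x}, isIrreducible_singleton, hclosed x⟩,
      ⟨Set.univ, IrreducibleSpace.isIrreducible_univ X, isClosed_univ⟩, ?_⟩
    refine lt_of_le_not_ge (Set.subset_univ ({x} : Set X)) fun hle => ?_
    have h1 : (Set.univ : Set X) ⊆ {x} := hle
    exact Set.infinite_univ ((Set.finite_singleton x).subset h1)

/-! ### Points of the projective hyperelliptic curve -/

theorem Projectivization.exists_rep_mk_apply {ι : Type*} (v : ι → ℂ) (hv : v ≠ 0) :
    ∃ c : ℂ, c ≠ 0 ∧ ∀ i, (Projectivization.mk ℂ v hv).rep i = c * v i := by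
  obtain ⟨a, ha⟩ := Projectivization.exists_smul_eq_mk_rep ℂ v hv
  exact ⟨a, a.ne_zero, fun i => by rw [← ha]; rfl⟩

theorem Projectivization.eq_mk_of_apply {ι : Type*} (P : ℙ ℂ (ι → ℂ)) (v : ι → ℂ) (hv : v ≠ 0)
    (c : ℂ) (h : ∀ i, P.rep i = c * v i) : P = Projectivization.mk ℂ v hv := by
  rw [← P.mk_rep, Projectivization.mk_eq_mk_iff']
  exact ⟨c, funext fun i => (h i).symm⟩

/-- The equations of the projective hyperelliptic curve. -/
def IsHypVector (n : ℕ) (f : ℂ[X]) (v : HypCoord n → ℂ) : Prop :=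
  (∀ i j k l : Fin (n + 2), (i : ℕ) + j = k + l →
    v (Sum.inl i) * v (Sum.inl j) = v (Sum.inl k) * v (Sum.inl l)) ∧
  v (Sum.inr ()) ^ 2 = ∑ m : Fin (2 * n + 3), f.coeff m *
    (v (Sum.inl ⟨m / 2, by omega⟩) * v (Sum.inl ⟨(m + 1) / 2, by omega⟩))

theorem isHypVector_iff {n : ℕ} {f : ℂ[X]} {v : HypCoord n → ℂ} :
    IsHypVector n f v ↔ ∀ p ∈ hypEquations n f, MvPolynomial.eval v p = 0 := by
  constructor
  · rintro ⟨h1, h2⟩ p (⟨i, j, k, l, h, rfl⟩ | rfl)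
    · simpa [sub_eq_zero] using h1 i j k l h
    · simp [hypQuadric, coordZ, h2]
  · intro h
    refine ⟨fun i j k l hij => ?_, ?_⟩
    · simpa [sub_eq_zero] using h _ (Or.inl ⟨i, j, k, l, hij, rfl⟩)
    · simpa [sub_eq_zero, hypQuadric, coordZ] using h _ (Or.inr rfl)

theorem isHypVector_rep {n : ℕ} {f : ℂ[X]} (P : hypModel n f) : IsHypVector n f P.1.rep :=
  isHypVector_iff.mpr P.2

theorem mk_mem_hypModel {n : ℕ} {f : ℂ[X]} {v : HypCoord n → ℂ} (hv : v ≠ 0)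
    (h : IsHypVector n f v) : Projectivization.mk ℂ v hv ∈ hypModel n f := by
  intro p hp
  obtain ⟨c, -, hc⟩ := Projectivization.exists_rep_mk_apply v hv
  rw [show (Projectivization.mk ℂ v hv).rep = c • v from funext hc,
    (isHomogeneous_of_mem_hypEquations hp).eval_smul_point, isHypVector_iff.mp h p hp, mul_zero]

theorem eval_eq_sum_fin {n : ℕ} {f : ℂ[X]} (hf : f.natDegree = 2 * n + 1) (B : ℂ) :
    f.eval B = ∑ m : Fin (2 * n + 3), f.coeff m * B ^ (m : ℕ) := by
  rw [Fin.sum_univ_eq_sum_range (fun m => f.coeff m * B ^ m),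
    eval_eq_sum_range' (show f.natDegree < 2 * n + 3 by omega)]

theorem eval_X_mul_reverse {n : ℕ} {f : ℂ[X]} (hf : f.natDegree = 2 * n + 1) (u : ℂ) :
    (X * f.reverse).eval u = ∑ m : Fin (2 * n + 3), f.coeff m * u ^ (2 * n + 2 - (m : ℕ)) := by
  rw [Fin.sum_univ_eq_sum_range (fun m => f.coeff m * u ^ (2 * n + 2 - m)),
    Finset.sum_range_succ, coeff_eq_zero_of_natDegree_lt (by omega), zero_mul, add_zero, eval_mul,
    eval_X, eval_eq_sum_range' (show f.reverse.natDegree < 2 * n + 2 by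
      have := f.reverse_natDegree_le; omega), Finset.mul_sum, ← Finset.sum_range_reflect]
  refine Finset.sum_congr rfl fun m hm => ?_
  rw [Finset.mem_range] at hm
  rw [coeff_reverse, hf, revAt_le (by omega),
    show 2 * n + 1 - (2 * n + 2 - 1 - m) = m by omega,
    show 2 * n + 2 - m = 2 * n + 2 - 1 - m + 1 by omega, pow_succ]
  ring

theorem isHypVector_finite {n : ℕ} {f : ℂ[X]} (hf : f.natDegree = 2 * n + 1) {p : ℂ × ℂ}
    (hp : p ∈ doubleCover f) :
    IsHypVector n f (Sum.elim (fun i : Fin (n + 2) => p.1 ^ (i : ℕ)) fun _ => p.2) := by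
  refine ⟨fun i j k l h => ?_, ?_⟩
  · simp only [Sum.elim_inl, ← pow_add, h]
  · simp only [Sum.elim_inl, Sum.elim_inr, ← pow_add]
    rw [show p.2 ^ 2 = f.eval p.1 from hp, eval_eq_sum_fin hf]
    refine Finset.sum_congr rfl fun m _ => ?_
    rw [show (m : ℕ) / 2 + (m + 1) / 2 = m by omega]

theorem isHypVector_nearInfinity {n : ℕ} {f : ℂ[X]} (hf : f.natDegree = 2 * n + 1) {p : ℂ × ℂ}
    (hp : p ∈ doubleCover (X * f.reverse)) :
    IsHypVector n f (Sum.elim (fun i : Fin (n + 2) => p.1 ^ (n + 1 - (i : ℕ))) fun _ => p.2) := by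
  refine ⟨fun i j k l h => ?_, ?_⟩
  · simp only [Sum.elim_inl, ← pow_add]
    congr 1
    omega
  · simp only [Sum.elim_inl, Sum.elim_inr, ← pow_add]
    have hp' : p.2 ^ 2 = (X * f.reverse).eval p.1 := hp
    rw [hp', eval_X_mul_reverse hf]
    refine Finset.sum_congr rfl fun m _ => ?_
    rw [show n + 1 - (m : ℕ) / 2 + (n + 1 - (m + 1) / 2) = 2 * n + 2 - m by omega]

/-! ### Solving the equations in homogeneous coordinates -/

section vector

variable {n : ℕ} {f : ℂ[X]} {v : HypCoord n → ℂ}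

theorem IsHypVector.apply_of_ne_zero (h : IsHypVector n f v) (h0 : v (Sum.inl 0) ≠ 0) (i : ℕ)
    (hi : i < n + 2) :
    v (Sum.inl ⟨i, hi⟩) = v (Sum.inl 0) * (v (Sum.inl 1) / v (Sum.inl 0)) ^ i := by
  induction i with
  | zero => simp
  | succ i ih =>
    have h1 := h.1 ⟨i + 1, hi⟩ 0 ⟨i, by omega⟩ 1 (by simp)
    rw [ih (by omega)] at h1
    refine mul_right_cancel₀ h0 (h1.trans ?_)
    rw [pow_succ]
    field_simp

/-- The relations Z_{i+1}² = Z_i Z_{i+2} propagate Z_0 = 0 up to Z_n, but not to the last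
coordinate. -/
theorem IsHypVector.apply_eq_zero (h : IsHypVector n f v) (h0 : v (Sum.inl 0) = 0) (i : ℕ)
    (hi : i < n + 1) : v (Sum.inl ⟨i, by omega⟩) = 0 := by
  induction i with
  | zero => exact h0
  | succ i ih =>
    have h1 := h.1 ⟨i + 1, by omega⟩ ⟨i + 1, by omega⟩ ⟨i, by omega⟩ ⟨i + 2, by omega⟩
      (by simp only; omega)
    rw [ih (by omega), zero_mul] at h1
    exact mul_self_eq_zero.mp h1

theorem IsHypVector.apply_of_last_ne_zero (h : IsHypVector n f v)
    (h0 : v (Sum.inl (Fin.last (n + 1))) ≠ 0) (i : ℕ) (hi : i ≤ n + 1) :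
    v (Sum.inl ⟨n + 1 - i, by omega⟩) = v (Sum.inl (Fin.last (n + 1))) *
      (v (Sum.inl ⟨n, by omega⟩) / v (Sum.inl (Fin.last (n + 1)))) ^ i := by
  induction i with
  | zero => simp [Fin.last]
  | succ i ih =>
    have h1 := h.1 ⟨n + 1 - (i + 1), by omega⟩ (Fin.last (n + 1)) ⟨n + 1 - i, by omega⟩
      ⟨n, by omega⟩ (by simp only [Fin.val_last]; omega)
    rw [ih (by omega)] at h1
    refine mul_right_cancel₀ h0 (h1.trans ?_)
    rw [pow_succ]
    field_simp

theorem IsHypVector.finite_mem (hf : f.natDegree = 2 * n + 1) (h : IsHypVector n f v)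
    (h0 : v (Sum.inl 0) ≠ 0) :
    (v (Sum.inl 1) / v (Sum.inl 0), v (Sum.inr ()) / v (Sum.inl 0)) ∈ doubleCover f := by
  change (_ / _) ^ 2 = eval _ f
  rw [div_pow, h.2, eval_eq_sum_fin hf, div_eq_iff (pow_ne_zero _ h0), Finset.sum_mul]
  refine Finset.sum_congr rfl fun m _ => ?_
  have hm : (v (Sum.inl 1) / v (Sum.inl 0)) ^ (m : ℕ) = (v (Sum.inl 1) / v (Sum.inl 0)) ^
      ((m : ℕ) / 2) * (v (Sum.inl 1) / v (Sum.inl 0)) ^ (((m : ℕ) + 1) / 2) := by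
    rw [← pow_add]
    congr 1
    omega
  rw [h.apply_of_ne_zero h0 (m / 2) (by omega), h.apply_of_ne_zero h0 ((m + 1) / 2) (by omega)]
  simp only [hm]
  ring

theorem IsHypVector.nearInfinity_mem (hf : f.natDegree = 2 * n + 1) (h : IsHypVector n f v)
    (h0 : v (Sum.inl (Fin.last (n + 1))) ≠ 0) :
    (v (Sum.inl ⟨n, by omega⟩) / v (Sum.inl (Fin.last (n + 1))),
      v (Sum.inr ()) / v (Sum.inl (Fin.last (n + 1)))) ∈ doubleCover (X * f.reverse) := by
  change (_ / _) ^ 2 = eval _ _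
  rw [div_pow, h.2, eval_X_mul_reverse hf, div_eq_iff (pow_ne_zero _ h0), Finset.sum_mul]
  refine Finset.sum_congr rfl fun m _ => ?_
  have h1 := h.apply_of_last_ne_zero h0 (n + 1 - m / 2) (by omega)
  have h2 := h.apply_of_last_ne_zero h0 (n + 1 - (m + 1) / 2) (by omega)
  simp only [show n + 1 - (n + 1 - (m : ℕ) / 2) = m / 2 by omega] at h1
  simp only [show n + 1 - (n + 1 - ((m : ℕ) + 1) / 2) = (m + 1) / 2 by omega] at h2
  rw [h1, h2, show 2 * n + 2 - (m : ℕ) = n + 1 - m / 2 + (n + 1 - (m + 1) / 2) by omega, pow_add]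
  ring

/-- When Z_0 = 0, only the term Z_{n+1}² of the quadric could survive, and its coefficient f_{2n+2}
is zero because the degree is 2n + 1. Hence there is just one point at infinity, with W = 0. -/
theorem IsHypVector.inr_eq_zero (hf : f.natDegree = 2 * n + 1) (h : IsHypVector n f v)
    (h0 : v (Sum.inl 0) = 0) : v (Sum.inr ()) = 0 := by
  refine pow_eq_zero_iff two_ne_zero |>.mp (h.2.trans (Finset.sum_eq_zero fun m _ => ?_))
  rcases Nat.lt_or_ge m (2 * n + 2) with hm | hm
  · rw [h.apply_eq_zero h0 (m / 2) (by omega), zero_mul, mul_zero]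
  · rw [coeff_eq_zero_of_natDegree_lt (by omega), zero_mul]

theorem IsHypVector.last_ne_zero (hf : f.natDegree = 2 * n + 1) (h : IsHypVector n f v)
    (hv : v ≠ 0) (h0 : v (Sum.inl 0) = 0) : v (Sum.inl (Fin.last (n + 1))) ≠ 0 := by
  intro hl
  refine hv (funext fun i => ?_)
  rcases i with i | ⟨⟩
  · rcases Nat.lt_or_ge i (n + 1) with hi | hi
    · exact h.apply_eq_zero h0 i hi
    · rw [show i = Fin.last (n + 1) from Fin.ext (by simp only [Fin.val_last]; omega), hl]; rfl
  · exact h.inr_eq_zero hf h0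

end vector

/-! ### Charts, projection and involution -/

section charts

variable {n : ℕ} {f : ℂ[X]} (hf : f.natDegree = 2 * n + 1)

/-- The chart `C² = f(B)`. -/
def hypChart (p : doubleCover f) : hypModel n f :=
  ⟨finitePoint n p, mk_mem_hypModel _ (isHypVector_finite hf p.2)⟩

/-- The chart `v² = u · u^{2n+1} f(1/u)`. -/
def hypChartInfinity (p : doubleCover (X * f.reverse)) : hypModel n f :=
  ⟨pointNearInfinity n p, mk_mem_hypModel _ (isHypVector_nearInfinity hf p.2)⟩

theorem zero_mem_doubleCover_reverse (f : ℂ[X]) :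
    ((0, 0) : ℂ × ℂ) ∈ doubleCover (X * f.reverse) := by simp [doubleCover]

/-- The point at infinity. -/
def hypInfinity : hypModel n f := hypChartInfinity hf ⟨(0, 0), zero_mem_doubleCover_reverse f⟩

/-- The hyperelliptic involution. -/
def hypInvolution (P : hypModel n f) : hypModel n f :=
  ⟨Projectivization.mk ℂ (Sum.elim (fun i => P.1.rep (Sum.inl i)) fun _ => -P.1.rep (Sum.inr ()))
    (fun h => P.1.rep_nonzero (funext fun i => by
      rcases i with i | ⟨⟩
      · exact congrFun h (Sum.inl i)
      · exact neg_eq_zero.mp (congrFun h (Sum.inr ())))),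
    mk_mem_hypModel _ ⟨(isHypVector_rep P).1, by
      simpa using (isHypVector_rep P).2⟩⟩

/-- The point at infinity of the projective line. -/
def lineInfinity : ProjLine :=
  Projectivization.mk ℂ ![0, 1] (fun h => by simpa using congrFun h 1)

open Classical in
/-- The projection to the projective line. -/
def hypProjection (P : hypModel n f) : ProjLine :=
  if P.1.rep (Sum.inl 0) = 0 then lineInfinity
  else linePoint (P.1.rep (Sum.inl 1) / P.1.rep (Sum.inl 0))

theorem exists_hypChart_rep (p : doubleCover f) : ∃ c : ℂ, c ≠ 0 ∧
    (∀ i : Fin (n + 2), (hypChart hf p).1.rep (Sum.inl i) = c * p.1.1 ^ (i : ℕ)) ∧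
    (hypChart hf p).1.rep (Sum.inr ()) = c * p.1.2 := by
  obtain ⟨c, hc, h⟩ := Projectivization.exists_rep_mk_apply _
    (fun h => by simpa using congrFun h (Sum.inl 0) :
      (Sum.elim (fun i : Fin (n + 2) => p.1.1 ^ (i : ℕ)) (fun _ => p.1.2) : HypCoord n → ℂ) ≠ 0)
  exact ⟨c, hc, fun i => h (Sum.inl i), h (Sum.inr ())⟩

theorem exists_hypChartInfinity_rep (p : doubleCover (X * f.reverse)) : ∃ c : ℂ, c ≠ 0 ∧
    (∀ i : Fin (n + 2), (hypChartInfinity hf p).1.rep (Sum.inl i) =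
      c * p.1.1 ^ (n + 1 - (i : ℕ))) ∧
    (hypChartInfinity hf p).1.rep (Sum.inr ()) = c * p.1.2 := by
  obtain ⟨c, hc, h⟩ := Projectivization.exists_rep_mk_apply _
    (fun h => by simpa using congrFun h (Sum.inl (Fin.last (n + 1))) :
      (Sum.elim (fun i : Fin (n + 2) => p.1.1 ^ (n + 1 - (i : ℕ))) (fun _ => p.1.2) :
        HypCoord n → ℂ) ≠ 0)
  exact ⟨c, hc, fun i => h (Sum.inl i), h (Sum.inr ())⟩

theorem exists_hypChart_eq (P : hypModel n f) (h0 : P.1.rep (Sum.inl 0) ≠ 0) :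
    ∃ p, hypChart hf p = P := by
  have h := isHypVector_rep P
  refine ⟨⟨_, h.finite_mem hf h0⟩, Subtype.ext ?_⟩
  refine (Projectivization.eq_mk_of_apply _ _ _ (P.1.rep (Sum.inl 0)) fun i => ?_).symm
  rcases i with i | ⟨⟩
  · exact h.apply_of_ne_zero h0 i i.2
  · exact (mul_div_cancel₀ _ h0).symm

theorem exists_hypChartInfinity_eq (P : hypModel n f)
    (h0 : P.1.rep (Sum.inl (Fin.last (n + 1))) ≠ 0) : ∃ p, hypChartInfinity hf p = P := by
  have h := isHypVector_rep P
  refine ⟨⟨_, h.nearInfinity_mem hf h0⟩, Subtype.ext ?_⟩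
  refine (Projectivization.eq_mk_of_apply _ _ _ (P.1.rep (Sum.inl (Fin.last (n + 1))))
    fun i => ?_).symm
  rcases i with i | ⟨⟩
  · have := h.apply_of_last_ne_zero h0 (n + 1 - i) (by omega)
    simp only [show n + 1 - (n + 1 - (i : ℕ)) = i by omega] at this
    exact this
  · exact (mul_div_cancel₀ _ h0).symm

theorem hypChart_rep_zero_ne_zero (p : doubleCover f) :
    (hypChart hf p).1.rep (Sum.inl 0) ≠ 0 := by
  obtain ⟨c, hc, h, -⟩ := exists_hypChart_rep hf p
  simpa [h] using hc

theorem hypChartInfinity_rep_last_ne_zero (p : doubleCover (X * f.reverse)) :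
    (hypChartInfinity hf p).1.rep (Sum.inl (Fin.last (n + 1))) ≠ 0 := by
  obtain ⟨c, hc, h, -⟩ := exists_hypChartInfinity_rep hf p
  simpa [h] using hc

theorem isOpenImmersion_hypChart :
    (doubleCoverStructure f).IsOpenImmersion (hypStructure n f) (hypChart hf) := by
  refine VarietyStructure.isOpenImmersion_affine_chart (fun p q h => ?_)
    (Sum.elim (fun i => MvPolynomial.X 0 ^ (i : ℕ)) fun _ => MvPolynomial.X 1) (fun p => ?_)
    (Sum.inl 0) ![Sum.inl 1, Sum.inr ()] (hypChart_rep_zero_ne_zero hf) (fun p s => ?_)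
    (exists_hypChart_eq hf)
  · exact Subtype.ext (Prod.ext (congrFun h 0) (congrFun h 1))
  · obtain ⟨c, hc, h1, h2⟩ := exists_hypChart_rep hf p
    refine ⟨c, hc, fun i => ?_⟩
    rcases i with i | ⟨⟩
    · simpa using h1 i
    · simpa using h2
  · obtain ⟨c, hc, h1, h2⟩ := exists_hypChart_rep hf p
    fin_cases s
    · simp [h1, hc]
    · simp [h1, h2, hc]

theorem isOpenImmersion_hypChartInfinity :
    (doubleCoverStructure _).IsOpenImmersion (hypStructure n f) (hypChartInfinity hf) := by
  refine VarietyStructure.isOpenImmersion_affine_chart (fun p q h => ?_)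
    (Sum.elim (fun i => MvPolynomial.X 0 ^ (n + 1 - (i : ℕ))) fun _ => MvPolynomial.X 1)
    (fun p => ?_) (Sum.inl (Fin.last (n + 1))) ![Sum.inl ⟨n, by omega⟩, Sum.inr ()]
    (hypChartInfinity_rep_last_ne_zero hf) (fun p s => ?_) (exists_hypChartInfinity_eq hf)
  · exact Subtype.ext (Prod.ext (congrFun h 0) (congrFun h 1))
  · obtain ⟨c, hc, h1, h2⟩ := exists_hypChartInfinity_rep hf p
    refine ⟨c, hc, fun i => ?_⟩
    rcases i with i | ⟨⟩
    · simpa using h1 i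
    · simpa using h2
  · obtain ⟨c, hc, h1, h2⟩ := exists_hypChartInfinity_rep hf p
    fin_cases s
    · simp [h1, hc]
    · simp [h1, h2, hc]

theorem hypInfinity_rep_zero : (hypInfinity hf).1.rep (Sum.inl 0) = 0 := by
  obtain ⟨c, hc, h, -⟩ := exists_hypChartInfinity_rep hf ⟨(0, 0), zero_mem_doubleCover_reverse f⟩
  rw [hypInfinity, h]
  simp

theorem eq_hypInfinity (P : hypModel n f) (h0 : P.1.rep (Sum.inl 0) = 0) :
    P = hypInfinity hf := by
  have h := isHypVector_rep P
  refine Subtype.ext (Projectivization.eq_mk_of_apply _ _ _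
    (P.1.rep (Sum.inl (Fin.last (n + 1)))) fun i => ?_)
  rcases i with i | ⟨⟩
  · rcases Nat.lt_or_ge i (n + 1) with hi | hi
    · rw [h.apply_eq_zero h0 i hi]
      simp [show n + 1 - (i : ℕ) ≠ 0 by omega]
    · rw [show i = Fin.last (n + 1) from Fin.ext (by simp only [Fin.val_last]; omega)]
      simp
  · rw [h.inr_eq_zero hf h0]
    simp

theorem hypChart_injective : Function.Injective (hypChart (n := n) hf) :=
  (isOpenImmersion_hypChart hf).injective

theorem hypChart_ne_hypInfinity (p : doubleCover f) : hypChart hf p ≠ hypInfinity hf := fun h =>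
  hypChart_rep_zero_ne_zero hf p (h ▸ hypInfinity_rep_zero hf)

theorem hypChart_or_infinity (P : hypModel n f) :
    (∃ p, P = hypChart hf p) ∨ P = hypInfinity hf := by
  by_cases h0 : P.1.rep (Sum.inl 0) = 0
  · exact Or.inr (eq_hypInfinity hf P h0)
  · obtain ⟨p, hp⟩ := exists_hypChart_eq hf P h0
    exact Or.inl ⟨p, hp.symm⟩

theorem compl_range_hypChart : (Set.range (hypChart (n := n) hf))ᶜ = {hypInfinity hf} := by
  ext P
  rcases hypChart_or_infinity hf P with ⟨p, rfl⟩ | rfl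
  · simp [hypChart_ne_hypInfinity]
  · simp [hypChart_ne_hypInfinity]

theorem hypProjection_hypChart (p : doubleCover f) :
    hypProjection (hypChart (n := n) hf p) = linePoint p.1.1 := by
  obtain ⟨c, hc, h, -⟩ := exists_hypChart_rep hf p
  rw [hypProjection, if_neg (hypChart_rep_zero_ne_zero hf p), h, h]
  simp [hc]

theorem hypProjection_hypInfinity : hypProjection (hypInfinity (n := n) hf) = lineInfinity :=
  if_pos (hypInfinity_rep_zero hf)

theorem neg_mem_doubleCover {p : ℂ × ℂ} (hp : p ∈ doubleCover f) :
    (p.1, -p.2) ∈ doubleCover f := by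
  simpa [doubleCover] using hp

theorem hypInvolution_hypChart (p : doubleCover f) :
    hypInvolution (hypChart (n := n) hf p) =
      hypChart hf ⟨(p.1.1, -p.1.2), neg_mem_doubleCover p.2⟩ := by
  obtain ⟨c, hc, h1, h2⟩ := exists_hypChart_rep hf p
  refine Subtype.ext ?_
  obtain ⟨d, hd, h⟩ := Projectivization.exists_rep_mk_apply
    (Sum.elim (fun i => (hypChart (n := n) hf p).1.rep (Sum.inl i))
      fun _ => -(hypChart (n := n) hf p).1.rep (Sum.inr ()))
    (fun h => hypChart_rep_zero_ne_zero hf p (congrFun h (Sum.inl 0)))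
  refine Projectivization.eq_mk_of_apply _ _ _ (d * c) fun i => (h i).trans ?_
  rcases i with i | ⟨⟩
  · simp [h1, mul_assoc]
  · simp [h2, mul_assoc]

theorem hypInvolution_hypInfinity : hypInvolution (hypInfinity (n := n) hf) = hypInfinity hf := by
  refine eq_hypInfinity hf _ ?_
  obtain ⟨d, hd, h⟩ := Projectivization.exists_rep_mk_apply
    (Sum.elim (fun i => (hypInfinity (n := n) hf).1.rep (Sum.inl i))
      fun _ => -(hypInfinity (n := n) hf).1.rep (Sum.inr ()))
    (fun h => (isHypVector_rep (hypInfinity (n := n) hf)).last_ne_zero hf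
      (hypInfinity hf).1.rep_nonzero (hypInfinity_rep_zero hf)
      (congrFun h (Sum.inl (Fin.last (n + 1)))))
  refine (h (Sum.inl 0)).trans ?_
  simp [hypInfinity_rep_zero]

theorem hypInvolution_involutive (hf : f.natDegree = 2 * n + 1) :
    Function.Involutive (hypInvolution (n := n) (f := f)) := by
  intro P
  rcases hypChart_or_infinity hf P with ⟨p, rfl⟩ | rfl
  · simp [hypInvolution_hypChart]
  · simp [hypInvolution_hypInfinity]

theorem linePoint_injective : Function.Injective linePoint := by
  intro B B' h
  obtain ⟨c, hc⟩ := (Projectivization.mk_eq_mk_iff' _ _ _ _ _).mp h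
  have h0 := congrFun hc 0
  have h1 := congrFun hc 1
  simp at h0 h1
  rw [← h1, h0, one_mul]

theorem linePoint_ne_lineInfinity (B : ℂ) : linePoint B ≠ lineInfinity := by
  intro h
  obtain ⟨c, hc⟩ := (Projectivization.mk_eq_mk_iff' _ _ _ _ _).mp h
  simpa using congrFun hc 0

theorem linePoint_or_infinity (Q : ProjLine) : (∃ B, Q = linePoint B) ∨ Q = lineInfinity := by
  by_cases h : Q.rep 0 = 0
  · refine Or.inr (Projectivization.eq_mk_of_apply _ _ _ (Q.rep 1) fun i => ?_)
    fin_cases i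
    · simpa using h
    · simp
  · refine Or.inl ⟨Q.rep 1 / Q.rep 0,
      Projectivization.eq_mk_of_apply _ _ _ (Q.rep 0) fun i => ?_⟩
    fin_cases i
    · simp
    · simp [mul_div_cancel₀ _ h]

theorem exists_mem_doubleCover (g : ℂ[X]) (B : ℂ) : ∃ C, (B, C) ∈ doubleCover g :=
  IsAlgClosed.exists_pow_nat_eq (g.eval B) (n := 2) two_pos

theorem hypProjection_surjective (hf : f.natDegree = 2 * n + 1) :
    Function.Surjective (hypProjection (n := n) (f := f)) := by
  intro Q
  rcases linePoint_or_infinity Q with ⟨B, rfl⟩ | rfl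
  · obtain ⟨C, hC⟩ := exists_mem_doubleCover f B
    exact ⟨hypChart hf ⟨_, hC⟩, hypProjection_hypChart hf _⟩
  · exact ⟨hypInfinity hf, hypProjection_hypInfinity hf⟩

theorem hypProjection_eq_iff (hf : f.natDegree = 2 * n + 1) (P Q : hypModel n f) :
    hypProjection P = hypProjection Q ↔ Q = P ∨ Q = hypInvolution P := by
  rcases hypChart_or_infinity hf P with ⟨p, rfl⟩ | rfl <;>
  rcases hypChart_or_infinity hf Q with ⟨q, rfl⟩ | rfl
  · rw [hypProjection_hypChart, hypProjection_hypChart, linePoint_injective.eq_iff,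
      hypInvolution_hypChart, (hypChart_injective hf).eq_iff, (hypChart_injective hf).eq_iff,
      Subtype.ext_iff, Subtype.ext_iff, Prod.ext_iff, Prod.ext_iff, ← and_or_left, eq_comm]
    refine (and_iff_left_of_imp fun h => ?_).symm
    have hp : p.1.2 ^ 2 = f.eval p.1.1 := p.2
    have hq : q.1.2 ^ 2 = f.eval q.1.1 := q.2
    exact sq_eq_sq_iff_eq_or_eq_neg.mp (by rw [hp, hq, h])
  · simp [hypProjection_hypChart, hypProjection_hypInfinity, hypInvolution_hypChart,
      linePoint_ne_lineInfinity, (hypChart_ne_hypInfinity hf _).symm]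
  · simp [hypProjection_hypChart, hypProjection_hypInfinity, hypInvolution_hypInfinity,
      (linePoint_ne_lineInfinity _).symm, hypChart_ne_hypInfinity hf _]
  · simp

theorem setOf_hypInvolution_ne :
    {P : hypModel n f | hypInvolution P ≠ P} = hypChart hf '' {p | p.1.2 ≠ 0} := by
  ext P
  rcases hypChart_or_infinity hf P with ⟨p, rfl⟩ | rfl
  · rw [(hypChart_injective hf).mem_set_image, Set.mem_ofPred_eq, Set.mem_ofPred_eq,
      hypInvolution_hypChart, (hypChart_injective hf).ne_iff, Ne, Subtype.ext_iff, Prod.ext_iff]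
    simp [neg_eq_self]
  · simp [hypInvolution_hypInfinity, hypChart_ne_hypInfinity]

theorem isMorphism_hypInvolution :
    (hypStructure n f).IsMorphism (hypStructure n f) hypInvolution := by
  refine VarietyStructure.isMorphism_projective fun P =>
    ⟨Sum.elim (fun i => MvPolynomial.X (Sum.inl i)) fun _ => -MvPolynomial.X (Sum.inr ()), 0, 1,
      fun i => ?_, MvPolynomial.isHomogeneous_one _ _, by simp, fun Q _ => ?_⟩
  · rcases i with i | ⟨⟩
    · exact MvPolynomial.isHomogeneous_X _ _
    · exact (MvPolynomial.isHomogeneous_X _ _).neg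
  · obtain ⟨c, hc, h⟩ := Projectivization.exists_rep_mk_apply
      (Sum.elim (fun i => Q.1.rep (Sum.inl i)) fun _ => -Q.1.rep (Sum.inr ()))
      (fun h => Q.1.rep_nonzero (funext fun i => by
        rcases i with i | ⟨⟩
        · exact congrFun h (Sum.inl i)
        · exact neg_eq_zero.mp (congrFun h (Sum.inr ()))))
    refine ⟨c, hc, fun i => (h i).trans ?_⟩
    rcases i with i | ⟨⟩ <;> simp

/-- The map is [Z_0 : Z_1] where Z_0 ≠ 0 and [Z_n : Z_{n+1}] where Z_{n+1} ≠ 0; the second pair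
covers the point at infinity. -/
theorem isMorphism_hypProjection (hf : f.natDegree = 2 * n + 1) :
    (hypStructure n f).IsMorphism projLineStructure hypProjection := by
  refine VarietyStructure.isMorphism_projective fun P => ?_
  by_cases h0 : P.1.rep (Sum.inl 0) = 0
  · have hl := (isHypVector_rep P).last_ne_zero hf P.1.rep_nonzero h0
    refine ⟨![MvPolynomial.X (Sum.inl ⟨n, by omega⟩), MvPolynomial.X (Sum.inl (Fin.last (n + 1)))],
      1, MvPolynomial.X (Sum.inl (Fin.last (n + 1))), fun i => ?_,
      MvPolynomial.isHomogeneous_X _ _, by simpa using hl, fun Q hQ => ?_⟩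
    · fin_cases i <;> exact MvPolynomial.isHomogeneous_X _ _
    · rw [MvPolynomial.eval_X] at hQ
      have hv := isHypVector_rep Q
      by_cases hQ0 : Q.1.rep (Sum.inl 0) = 0
      · obtain ⟨c, hc, h⟩ := Projectivization.exists_rep_mk_apply (![0, 1] : Fin 2 → ℂ)
          (fun h => by simpa using congrFun h 1)
        refine ⟨c / Q.1.rep (Sum.inl (Fin.last (n + 1))), div_ne_zero hc hQ, fun i => ?_⟩
        rw [hypProjection, if_pos hQ0]
        refine (h i).trans ?_
        fin_cases i
        · simp [hv.apply_eq_zero hQ0 n (by omega)]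
        · simp [hQ]
      · obtain ⟨c, hc, h⟩ := Projectivization.exists_rep_mk_apply
          (![1, Q.1.rep (Sum.inl 1) / Q.1.rep (Sum.inl 0)] : Fin 2 → ℂ)
          (fun h => by simpa using congrFun h 0)
        have hn := hv.apply_of_ne_zero hQ0 n (by omega)
        have hn1 := hv.apply_of_ne_zero hQ0 (n + 1) (by omega)
        change Q.1.rep (Sum.inl (Fin.last (n + 1))) = _ at hn1
        have hB : Q.1.rep (Sum.inl 1) / Q.1.rep (Sum.inl 0) ≠ 0 := by
          intro hB
          rw [hn1, hB] at hQ
          simp at hQ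
        -- On the overlap Z_n = Z_0 B^n and Z_{n+1} = Z_0 B^{n+1}, so dividing by Z_0 B^n recovers
        -- [1 : B]; here B ≠ 0 since Z_{n+1} ≠ 0.
        refine ⟨c / (Q.1.rep (Sum.inl 0) *
          (Q.1.rep (Sum.inl 1) / Q.1.rep (Sum.inl 0)) ^ n),
          div_ne_zero hc (mul_ne_zero hQ0 (pow_ne_zero _ hB)), fun i => ?_⟩
        rw [hypProjection, if_neg hQ0]
        refine (h i).trans ?_
        have hBn := mul_ne_zero hQ0 (pow_ne_zero n hB)
        fin_cases i
        · simp only [Fin.zero_eta, Matrix.cons_val_zero, MvPolynomial.eval_X, hn, mul_one]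
          rw [div_mul_cancel₀ _ hBn]
        · simp only [Fin.mk_one, Matrix.cons_val_one, Matrix.cons_val_fin_one, MvPolynomial.eval_X,
            hn1, pow_succ]
          rw [← mul_assoc (Q.1.rep (Sum.inl 0)), ← mul_assoc, div_mul_cancel₀ _ hBn]
  · refine ⟨![MvPolynomial.X (Sum.inl 0), MvPolynomial.X (Sum.inl 1)], 1,
      MvPolynomial.X (Sum.inl 0), fun i => ?_, MvPolynomial.isHomogeneous_X _ _,
      by simpa using h0, fun Q hQ => ?_⟩
    · fin_cases i <;> exact MvPolynomial.isHomogeneous_X _ _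
    · rw [MvPolynomial.eval_X] at hQ
      obtain ⟨c, hc, h⟩ := Projectivization.exists_rep_mk_apply
        (![1, Q.1.rep (Sum.inl 1) / Q.1.rep (Sum.inl 0)] : Fin 2 → ℂ)
        (fun h => by simpa using congrFun h 0)
      refine ⟨c / Q.1.rep (Sum.inl 0), div_ne_zero hc hQ, fun i => ?_⟩
      rw [hypProjection, if_neg hQ]
      refine (h i).trans ?_
      fin_cases i
      · simp [hQ]
      · simp; ring

end charts

/-! ### The topology of the hyperelliptic curve -/

theorem exists_eval_eq_add_mul (g : ℂ[X]) (p : MvPolynomial (Fin 2) ℂ) :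
    ∃ a b : ℂ[X], ∀ q ∈ doubleCover g,
      MvPolynomial.eval ![q.1, q.2] p = a.eval q.1 + b.eval q.1 * q.2 := by
  induction p using MvPolynomial.induction_on with
  | C r => exact ⟨C r, 0, fun q _ => by simp⟩
  | add p₁ p₂ h₁ h₂ =>
    obtain ⟨a₁, b₁, h₁⟩ := h₁
    obtain ⟨a₂, b₂, h₂⟩ := h₂
    refine ⟨a₁ + a₂, b₁ + b₂, fun q hq => ?_⟩
    rw [map_add, h₁ q hq, h₂ q hq, eval_add, eval_add]
    ring
  | mul_X p i h =>
    obtain ⟨a, b, h⟩ := h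
    fin_cases i
    · refine ⟨a * X, b * X, fun q hq => ?_⟩
      rw [map_mul, h q hq]
      simp
      ring
    · refine ⟨b * g, a, fun q hq => ?_⟩
      rw [map_mul, h q hq, eval_mul, ← show q.2 ^ 2 = g.eval q.1 from hq]
      simp
      ring

theorem finite_fibre_doubleCover (g : ℂ[X]) (B : ℂ) :
    {q : doubleCover g | q.1.1 = B}.Finite := by
  obtain ⟨C₀, hC₀⟩ := exists_mem_doubleCover g B
  refine Set.Finite.of_finite_image (f := fun q => q.1.2) (Set.Finite.subset
    (Set.toFinite {C₀, -C₀}) ?_) ?_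
  · rintro _ ⟨q, rfl, rfl⟩
    have h1 : q.1.2 ^ 2 = g.eval q.1.1 := q.2
    have h2 : C₀ ^ 2 = g.eval q.1.1 := hC₀
    exact sq_eq_sq_iff_eq_or_eq_neg.mp (h1.trans h2.symm)
  · rintro q rfl q' hq' h
    exact Subtype.ext (Prod.ext hq'.symm h)

theorem infinite_doubleCover (g : ℂ[X]) : Infinite (doubleCover g) :=
  Infinite.of_surjective (fun q => q.1.1) fun B =>
    let ⟨_, hC⟩ := exists_mem_doubleCover g B
    ⟨⟨_, hC⟩, rfl⟩

/-- On the curve every polynomial is a(B) + b(B)C. Its zeros lie over the roots of the norm a² -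
b²g, which by `hg` is nonzero unless the function itself vanishes. -/
theorem finite_compl_of_isOpen_doubleCover {g : ℂ[X]}
    (hg : ∀ a b : ℂ[X], a ^ 2 = b ^ 2 * g → b = 0) {U : Set (doubleCover g)}
    (hU : IsOpen[(doubleCoverStructure g).top] U) : U.Nonempty → Uᶜ.Finite := by
  refine finite_compl_of_isOpen_generateFrom ?_ hU
  rintro _ ⟨-, -, ⟨p, rfl⟩, rfl⟩ ⟨q₀, hq₀⟩
  obtain ⟨a, b, hab⟩ := exists_eval_eq_add_mul g p
  have hN : a ^ 2 - b ^ 2 * g ≠ 0 := by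
    intro h
    have hb := hg a b (sub_eq_zero.mp h)
    rw [hb, zero_pow two_ne_zero, zero_mul, sub_zero, pow_eq_zero_iff two_ne_zero] at h
    refine hq₀ ((hab _ q₀.2).trans ?_)
    simp [h, hb]
  refine Set.Finite.subset (Set.Finite.preimage' (f := fun q : doubleCover g => q.1.1)
    (a ^ 2 - b ^ 2 * g).roots.toFinset.finite_toSet
    fun B _ => finite_fibre_doubleCover g B) ?_
  intro q hq
  have h1 : MvPolynomial.eval ![q.1.1, q.1.2] p = 0 := by
    by_contra h
    exact hq h
  have h2 : q.1.2 ^ 2 = g.eval q.1.1 := q.2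
  rw [hab _ q.2] at h1
  simp only [Set.mem_preimage, Finset.mem_coe, Multiset.mem_toFinset, mem_roots hN, IsRoot.def,
    eval_sub, eval_mul, eval_pow]
  linear_combination (a.eval q.1.1 - b.eval q.1.1 * q.1.2) * h1 + (b.eval q.1.1) ^ 2 * h2

theorem eq_zero_of_sq_eq_sq_mul_of_odd_natDegree {a b g : ℂ[X]} (hg : Odd g.natDegree)
    (h : a ^ 2 = b ^ 2 * g) : b = 0 := by
  by_contra hb
  have hg0 : g ≠ 0 := by
    rintro rfl
    simp at hg
  have := congrArg natDegree h
  rw [natDegree_mul (pow_ne_zero _ hb) hg0, natDegree_pow, natDegree_pow] at this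
  obtain ⟨k, hk⟩ := hg
  omega

/-- Parity of the order of vanishing at 0: the reverse of f has nonzero constant term, so the right
side has odd order there. -/
theorem eq_zero_of_sq_eq_sq_mul_X_mul_reverse {a b f : ℂ[X]} (hf : f ≠ 0)
    (h : a ^ 2 = b ^ 2 * (X * f.reverse)) : b = 0 := by
  by_contra hb
  have hr : f.reverse ≠ 0 := by simpa using hf
  have ha : a ≠ 0 := by
    rintro rfl
    rw [zero_pow two_ne_zero, eq_comm] at h
    exact mul_ne_zero (pow_ne_zero _ hb) (mul_ne_zero X_ne_zero hr) h
  have h0 : f.reverse.natTrailingDegree = 0 :=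
    natTrailingDegree_reverse f
  have := congrArg natTrailingDegree h
  rw [natTrailingDegree_mul (pow_ne_zero _ hb) (mul_ne_zero X_ne_zero hr),
    natTrailingDegree_mul X_ne_zero hr, natTrailingDegree_X, h0, pow_two,
    pow_two, natTrailingDegree_mul ha ha, natTrailingDegree_mul hb hb] at this
  omega

theorem infinite_hypModel {n : ℕ} {f : ℂ[X]} (hf : f.natDegree = 2 * n + 1) :
    Infinite (hypModel n f) :=
  have := infinite_doubleCover f
  Infinite.of_injective _ (hypChart_injective hf)

/-- The topology is cofinite; irreducibility and dimension one use nothing else. -/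
theorem isOpen_hypModel_iff {n : ℕ} {f : ℂ[X]} (hf : f.natDegree = 2 * n + 1)
    (U : Set (hypModel n f)) :
    IsOpen[(hypStructure n f).top] U ↔ (U.Nonempty → Uᶜ.Finite) := by
  let := (hypStructure n f).top
  have hf0 : f ≠ 0 := by
    rintro rfl
    simp at hf
  constructor
  · rintro hU ⟨P, hP⟩
    have h1 := finite_compl_of_isOpen_doubleCover (g := f) (fun a b =>
      eq_zero_of_sq_eq_sq_mul_of_odd_natDegree ⟨n, hf⟩)
      ((isOpenImmersion_hypChart hf).isOpen_preimage hU)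
    have h2 := finite_compl_of_isOpen_doubleCover (g := X * f.reverse) (fun a b =>
      eq_zero_of_sq_eq_sq_mul_X_mul_reverse hf0)
      ((isOpenImmersion_hypChartInfinity hf).isOpen_preimage hU)
    -- An open set cannot be the point at infinity alone: in the second chart it would be both
    -- finite and cofinite in an infinite set.
    have hne : (hypChart hf ⁻¹' U).Nonempty := by
      by_contra hempty
      have hU' : ∀ Q ∈ U, Q = hypInfinity hf := by
        intro Q hQ
        rcases hypChart_or_infinity hf Q with ⟨p, rfl⟩ | h
        · exact absurd ⟨p, hQ⟩ hempty
        · exact h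
      obtain rfl := hU' P hP
      have hfin := h2 ⟨_, hP⟩
      have hinj := (isOpenImmersion_hypChartInfinity (n := n) hf).injective
      have hinf := infinite_doubleCover (X * f.reverse)
      have hsub : (hypChartInfinity (n := n) hf ⁻¹' U).Subsingleton := fun x hx y hy =>
        hinj ((hU' _ hx).trans (hU' _ hy).symm)
      have := hfin.union hsub.finite
      rw [Set.compl_union_self] at this
      exact Set.infinite_univ this
    refine (((h1 hne).image (hypChart hf)).union (Set.finite_singleton (hypInfinity hf))).subset ?_
    intro Q hQ
    rcases hypChart_or_infinity hf Q with ⟨p, rfl⟩ | rfl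
    · exact Or.inl ⟨p, hQ, rfl⟩
    · exact Or.inr rfl
  · intro h
    have : T1Space (hypModel n f) := VarietyStructure.t1Space_projective Subtype.val_injective
    rcases U.eq_empty_or_nonempty with rfl | hU
    · exact isOpen_empty
    · rw [← compl_compl U]
      exact (h hU).isClosed.isOpen_compl

theorem irreducibleSpace_hypModel {n : ℕ} {f : ℂ[X]} (hf : f.natDegree = 2 * n + 1) :
    @IrreducibleSpace (hypModel n f) (hypStructure n f).top :=
  let := (hypStructure n f).top
  have := infinite_hypModel hf
  irreducibleSpace_of_isOpen_iff_finite_compl (isOpen_hypModel_iff hf)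

theorem topologicalKrullDim_hypModel {n : ℕ} {f : ℂ[X]} (hf : f.natDegree = 2 * n + 1) :
    @topologicalKrullDim (hypModel n f) (hypStructure n f).top = 1 :=
  let := (hypStructure n f).top
  have := infinite_hypModel hf
  topologicalKrullDim_of_isOpen_iff_finite_compl (isOpen_hypModel_iff hf)

/-! ### Unordered tuples -/

/-- Equal multisets of values mean fibres of equal size, and bijections between the fibres assemble
to a permutation. -/
theorem exists_perm_of_map_univ_eq {ι E : Type*} [Fintype ι] {a b : ι → E}
    (h : Finset.univ.val.map a = Finset.univ.val.map b) : ∃ σ : Equiv.Perm ι, a = b ∘ σ := by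
  classical
  have hcard : ∀ c, Fintype.card {i // a i = c} = Fintype.card {i // b i = c} := by
    intro c
    have := congrArg (Multiset.count c) h
    rw [Multiset.count_map, Multiset.count_map] at this
    rw [Fintype.card_subtype, Fintype.card_subtype]
    simp_rw [eq_comm (a := c)] at this
    exact this
  exact ⟨Equiv.ofFiberEquiv fun c => Fintype.equivOfCardEq (hcard c),
    funext fun i => (Equiv.ofFiberEquiv_map _ i).symm⟩

theorem symPoint_eq_iff {E : Type*} {n : ℕ} {a b : Fin n → E} :
    symPoint a = symPoint b ↔ ∃ σ : Equiv.Perm (Fin n), a = b ∘ σ := by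
  constructor
  · intro h
    exact exists_perm_of_map_univ_eq (congrArg Subtype.val h)
  · rintro ⟨σ, rfl⟩
    refine Subtype.ext ?_
    change Finset.univ.val.map (b ∘ σ) = Finset.univ.val.map b
    rw [← Multiset.map_map, Multiset.map_univ_val_equiv]

/-! ### Tuples on the Liouville curve -/

section liouville

variable {n : ℕ} {L : PeriodPair}

/-- The defining conditions of the Liouville curve. -/
def IsLiouvilleTuple (L : PeriodPair) (a : Fin n → EllipticTorus L) : Prop :=
  (∀ i, 2 • a i ≠ 0) ∧
    (∀ i j, i ≠ j → weierstrassX L (a i) ≠ weierstrassX L (a j)) ∧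
    ∀ r : ℕ, r + 2 ≤ n → ∑ i, weierstrassX L (a i) ^ r * weierstrassY L (a i) = 0

theorem IsLiouvilleTuple.comp_perm {a : Fin n → EllipticTorus L} (h : IsLiouvilleTuple L a)
    (σ : Equiv.Perm (Fin n)) : IsLiouvilleTuple L (a ∘ σ) := by
  refine ⟨fun i => h.1 _, fun i j hij => h.2.1 _ _ (σ.injective.ne hij), fun r hr => ?_⟩
  rw [← h.2.2 r hr]
  exact Equiv.sum_comp σ fun i => weierstrassX L (a i) ^ r * weierstrassY L (a i)

theorem symPoint_mem_liouvilleCurve {a : Fin n → EllipticTorus L} :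
    symPoint a ∈ liouvilleCurve n L ↔ IsLiouvilleTuple L a := by
  constructor
  · rintro ⟨b, hb, h⟩
    obtain ⟨σ, rfl⟩ := symPoint_eq_iff.mp hb
    exact IsLiouvilleTuple.comp_perm h σ
  · exact fun h => ⟨a, rfl, h⟩

theorem paramB_comp_perm (a : Fin n → EllipticTorus L) (σ : Equiv.Perm (Fin n)) :
    paramB L (a ∘ σ) = paramB L a := by
  rw [paramB, paramB]
  congr 1
  exact Equiv.sum_comp σ fun i => weierstrassX L (a i)

theorem paramC_eq_eval_derivative (a : Fin n → EllipticTorus L) (i : Fin n) :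
    paramC L a i = weierstrassY L (a i) *
      (derivative (∏ j, (X - C (weierstrassX L (a j))))).eval (weierstrassX L (a i)) := by
  have := Lagrange.eval_nodal_derivative_eval_node_eq (s := Finset.univ)
    (v := fun j => weierstrassX L (a j)) (Finset.mem_univ i)
  rw [Lagrange.nodal] at this
  rw [paramC, this, Lagrange.eval_nodal]

theorem paramC_comp_perm (a : Fin n → EllipticTorus L) (σ : Equiv.Perm (Fin n)) (i : Fin n) :
    paramC L (a ∘ σ) i = paramC L a (σ i) := by
  rw [paramC_eq_eval_derivative, paramC_eq_eval_derivative]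
  rw [← Equiv.prod_comp σ fun j => X - C (weierstrassX L (a j))]
  rfl

variable {a : Fin n → EllipticTorus L}

theorem IsLiouvilleTuple.sum_eval_mul (h : IsLiouvilleTuple L a) {g : ℂ[X]} (hg : g.natDegree + 2 ≤ n) :
    ∑ i, g.eval (weierstrassX L (a i)) * weierstrassY L (a i) = 0 := by
  simp_rw [eval_eq_sum_range, Finset.sum_mul]
  rw [Finset.sum_comm]
  refine Finset.sum_eq_zero fun r hr => ?_
  rw [Finset.mem_range] at hr
  simp_rw [mul_assoc]
  rw [← Finset.mul_sum, h.2.2 r (by omega), mul_zero]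

/-- The linear relations, tested on ∏_{k ≠ i, j} (x - x_k) of degree n - 2, leave only the terms of
i and j. -/
theorem IsLiouvilleTuple.paramC_eq (h : IsLiouvilleTuple L a) (i j : Fin n) :
    paramC L a i = paramC L a j := by
  rcases eq_or_ne i j with rfl | hij
  · rfl
  set x := fun k => weierstrassX L (a k) with hx
  set S := (Finset.univ.erase i).erase j with hS
  have hj : j ∈ Finset.univ.erase i := Finset.mem_erase.mpr ⟨hij.symm, Finset.mem_univ j⟩
  have hi : i ∈ Finset.univ.erase j := Finset.mem_erase.mpr ⟨hij, Finset.mem_univ i⟩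
  have hScard : S.card + 2 = n := by
    have h1 := Finset.card_erase_add_one hj
    have h2 := Finset.card_erase_add_one (Finset.mem_univ i)
    rw [Finset.card_univ, Fintype.card_fin] at h2
    rw [hS]
    omega
  have h0 := h.sum_eval_mul (g := ∏ k ∈ S, (X - C (x k)))
    (by rw [natDegree_finsetProd_X_sub_C_eq_card]; omega)
  rw [← Finset.add_sum_erase _ _ (Finset.mem_univ i), ← Finset.add_sum_erase _ _ hj,
    Finset.sum_eq_zero (s := (Finset.univ.erase i).erase j) (fun k hk => by
      rw [eval_prod, Finset.prod_eq_zero hk (by simp [hx]), zero_mul]), add_zero] at h0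
  simp only [eval_prod, eval_sub, eval_X, eval_C] at h0
  rw [paramC, paramC, ← Finset.mul_prod_erase _ _ hj, ← Finset.mul_prod_erase _ _ hi,
    Finset.erase_right_comm (a := j)]
  linear_combination (x i - x j) * h0

theorem IsLiouvilleTuple.injective (h : IsLiouvilleTuple L a) :
    Function.Injective fun i => weierstrassX L (a i) := fun i j hij => by
  by_contra hne
  exact h.2.1 i j hne hij

theorem IsLiouvilleTuple.paramC_ne_zero (h : IsLiouvilleTuple L a) (i : Fin n) : paramC L a i ≠ 0 :=
  mul_ne_zero (weierstrassY_ne_zero (h.1 i)) (Finset.prod_ne_zero_iff.mpr fun j hj =>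
    sub_ne_zero.mpr (h.2.1 i j (Finset.ne_of_mem_erase hj).symm))

theorem eval_weierstrassCubic_weierstrassX {b : EllipticTorus L} (hb : 2 • b ≠ 0) :
    weierstrassY L b ^ 2 = (weierstrassCubic L.g₂ L.g₃).eval (weierstrassX L b) := by
  rw [weierstrass_equation hb]
  simp [weierstrassCubic]

/-- Constancy of y_i Q'(x_i) makes Q a solution Q_B; the parameter is then read off the subleading
coefficient -∑ x_i = -B/(2n - 1). -/
theorem IsLiouvilleTuple.prod_eq (hn : 1 ≤ n) (h : IsLiouvilleTuple L a) (i : Fin n) :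
    ∏ j, (X - C (weierstrassX L (a j))) = lameProduct n L.g₂ L.g₃ (paramB L a) ∧
      paramC L a i ^ 2 = (lamePolyAt n L).eval (paramB L a) := by
  obtain ⟨B, hB, hC⟩ := prod_X_sub_C_eq_lameProduct h.injective
    (fun j => eval_weierstrassCubic_weierstrassX (h.1 j))
    (fun j => (paramC_eq_eval_derivative a j).symm.trans (h.paramC_eq j i))
  have hB' : B = paramB L a := by
    rw [lameProduct_subleading hn L.g₂ L.g₃ B, ← hB, paramB]
    have := prod_X_sub_C_coeff_card_pred Finset.univ (fun j => weierstrassX L (a j))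
      (by rw [Finset.card_univ, Fintype.card_fin]; omega)
    rw [Finset.card_univ, Fintype.card_fin] at this
    rw [this]
    ring
  rw [← hB']
  exact ⟨hB, hC⟩

theorem eval_derivative_lameProduct_sq {g₂ g₃ B x : ℂ}
    (hx : (lameProduct n g₂ g₃ B).eval x = 0) :
    (weierstrassCubic g₂ g₃).eval x * (derivative (lameProduct n g₂ g₃ B)).eval x ^ 2 =
      (lameEllAt n g₂ g₃).eval B := by
  have h := congrArg (eval x) (lameForm_lameProduct n g₂ g₃ B)
  rw [lameForm] at h
  simp only [eval_sub, eval_add, eval_mul, hx, eval_neg, eval_C, zero_mul, mul_zero] at h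
  linear_combination -h

/-- The first integral at a root x of Q_B gives p(x) Q_B'(x)² = c² ≠ 0. Hence Q_B has n distinct
roots, and (x, c / Q_B'(x)) lies on the Weierstrass cubic. -/
theorem exists_isLiouvilleTuple (hn : 1 ≤ n) {B c : ℂ} (hc : c ≠ 0)
    (h : c ^ 2 = (lamePolyAt n L).eval B) :
    ∃ a : Fin n → EllipticTorus L, IsLiouvilleTuple L a ∧ paramB L a = B ∧ ∀ i, paramC L a i = c := by
  set Q := lameProduct n L.g₂ L.g₃ B with hQ
  have hmon : Q.Monic := monic_lameProduct n _ _ B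
  have hdeg : Q.natDegree = n := natDegree_lameProduct n _ _ B
  have hsq : ∀ x, Q.eval x = 0 → (weierstrassCubic L.g₂ L.g₃).eval x *
      (derivative Q).eval x ^ 2 = c ^ 2 := fun x hx =>
    (eval_derivative_lameProduct_sq hx).trans h.symm
  have hQ' : ∀ x, Q.eval x = 0 → (derivative Q).eval x ≠ 0 := by
    intro x hx h0
    have := hsq x hx
    rw [h0, zero_pow two_ne_zero, mul_zero] at this
    exact pow_ne_zero 2 hc this.symm
  have hcard : Multiset.card Q.roots = n := by
    rw [← hdeg]
    exact (IsAlgClosed.splits Q).natDegree_eq_card_roots.symm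
  have hnodup : Q.roots.Nodup := by
    rw [Multiset.nodup_iff_count_le_one]
    intro x
    rw [count_roots]
    by_contra! hlt
    obtain ⟨h1, h2⟩ := (one_lt_rootMultiplicity_iff_isRoot hmon.ne_zero).mp hlt
    exact hQ' x h1 h2
  have hcard' : Q.roots.toFinset.card = n := by
    rw [Multiset.toFinset_card_of_nodup hnodup, hcard]
  let e := (Q.roots.toFinset.equivFinOfCardEq hcard').symm
  let x : Fin n → ℂ := fun i => e i
  have hxinj : Function.Injective x := Subtype.val_injective.comp e.injective
  have hxroot : ∀ i, Q.eval (x i) = 0 := fun i =>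
    (mem_roots'.mp (Multiset.mem_toFinset.mp (e i).2)).2
  have hprod : ∏ j, (X - C (x j)) = Q := by
    rw [(IsAlgClosed.splits Q).eq_prod_roots_of_monic hmon,
      show ∏ j, (X - C (x j)) = ∏ r : Q.roots.toFinset, (X - C (r : ℂ)) from
        Equiv.prod_comp e fun r => X - C (r : ℂ),
      Finset.prod_coe_sort Q.roots.toFinset fun r => X - C r, Finset.prod,
      Multiset.toFinset_val, hnodup.dedup]
  have hpt : ∀ i, ∃ b, weierstrassX L b = x i ∧
      weierstrassY L b = c / (derivative Q).eval (x i) := by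
    intro i
    refine exists_point_of_weierstrass_equation L ?_
    have h1 := hsq (x i) (hxroot i)
    rw [div_pow, div_eq_iff (pow_ne_zero 2 (hQ' _ (hxroot i))), ← h1]
    simp [weierstrassCubic]
  choose a hax hay using hpt
  have hderiv : ∀ i, (derivative Q).eval (x i) = ∏ j ∈ Finset.univ.erase i, (x i - x j) := by
    intro i
    have := Lagrange.eval_nodal_derivative_eval_node_eq (s := Finset.univ) (v := x)
      (Finset.mem_univ i)
    rw [Lagrange.nodal, hprod] at this
    rw [this, Lagrange.eval_nodal]
  have hL : IsLiouvilleTuple L a := by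
    refine ⟨fun i => two_nsmul_ne_zero_of_weierstrassY ?_, fun i j hij => ?_, fun r hr => ?_⟩
    · rw [hay]
      exact div_ne_zero hc (hQ' _ (hxroot i))
    · rw [hax, hax]
      exact hxinj.ne hij
    · have h1 := Lagrange.coeff_eq_sum (s := Finset.univ) (v := x) (P := X ^ r) hxinj.injOn
        (by rw [degree_X_pow, Finset.card_univ, Fintype.card_fin]; exact_mod_cast (by omega))
      rw [Finset.card_univ, Fintype.card_fin, coeff_X_pow, if_neg (by omega)] at h1
      calc ∑ i, weierstrassX L (a i) ^ r * weierstrassY L (a i)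
          = c * ∑ i, (X ^ r : ℂ[X]).eval (x i) / ∏ j ∈ Finset.univ.erase i, (x i - x j) := by
            rw [Finset.mul_sum]
            refine Finset.sum_congr rfl fun i _ => ?_
            rw [hax, hay, hderiv, eval_pow, eval_X]
            ring
        _ = 0 := by rw [← h1, mul_zero]
  refine ⟨a, hL, ?_, fun i => ?_⟩
  · have h1 := (hL.prod_eq hn ⟨0, hn⟩).1
    simp only [hax] at h1
    rw [hprod] at h1
    rw [lameProduct_subleading hn L.g₂ L.g₃ B, lameProduct_subleading hn L.g₂ L.g₃ (paramB L a),
      ← h1]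
  · rw [paramC_eq_eval_derivative]
    simp only [hax, hay]
    rw [hprod, div_mul_cancel₀ _ (hQ' _ (hxroot i))]

/-- B determines Q and so the x_i up to order; then C determines y_i = C / Q'(x_i). -/
theorem IsLiouvilleTuple.eq_comp_perm (hn : 1 ≤ n) (ha : IsLiouvilleTuple L a)
    {b : Fin n → EllipticTorus L} (hb : IsLiouvilleTuple L b) (hB : paramB L a = paramB L b)
    (hC : paramC L a ⟨0, hn⟩ = paramC L b ⟨0, hn⟩) : ∃ σ : Equiv.Perm (Fin n), a = b ∘ σ := by
  have hprod : ∏ j, (X - C (weierstrassX L (a j))) = ∏ j, (X - C (weierstrassX L (b j))) := by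
    rw [(ha.prod_eq hn ⟨0, hn⟩).1, (hb.prod_eq hn ⟨0, hn⟩).1, hB]
  have hroots : ∀ d : Fin n → EllipticTorus L, (∏ j, (X - C (weierstrassX L (d j)))).roots =
      Finset.univ.val.map fun j => weierstrassX L (d j) := by
    intro d
    change (Multiset.map ((fun t => X - C t) ∘ fun j => weierstrassX L (d j)) _).prod.roots = _
    rw [← Multiset.map_map, roots_multiset_prod_X_sub_C]
  obtain ⟨σ, hσ⟩ := exists_perm_of_map_univ_eq ((hroots a).symm.trans (hprod ▸ hroots b))
  refine ⟨σ, funext fun i => point_ext (ha.1 i) (hb.1 _) (congrFun hσ i) ?_⟩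
  have h1 := ha.paramC_eq i ⟨0, hn⟩
  have h2 := hb.paramC_eq (σ i) ⟨0, hn⟩
  rw [hC, ← h2, paramC_eq_eval_derivative, paramC_eq_eval_derivative, hprod,
    show weierstrassX L (a i) = weierstrassX L (b (σ i)) from congrFun hσ i] at h1
  refine mul_right_cancel₀ ?_ h1
  have := hb.paramC_ne_zero (σ i)
  rw [paramC_eq_eval_derivative] at this
  exact right_ne_zero_of_mul this

end liouville

/-! ### The Liouville curve as an open part of the hyperelliptic curve -/

section liouvilleMap

variable {n : ℕ} {L : PeriodPair}

/-- The Weierstrass coordinates `(x_i, y_i)` of a tuple. -/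
def liouvilleCoord (L : PeriodPair) (a : Fin n → EllipticTorus L) (k : Fin n × Fin 2) : ℂ :=
  ![weierstrassX L (a k.1), weierstrassY L (a k.1)] k.2

/-- The map `{(x_i, y_i)} ↦ (B, C)`. -/
def liouvilleMap (hn : 1 ≤ n) (s : liouvilleCurve n L) : doubleCover (lamePolyAt n L) :=
  ⟨(paramB L s.2.choose, paramC L s.2.choose ⟨0, hn⟩),
    ((show IsLiouvilleTuple L s.2.choose from s.2.choose_spec.2).prod_eq hn ⟨0, hn⟩).2⟩

theorem liouvilleMap_symPoint (hn : 1 ≤ n) (a : Fin n → EllipticTorus L)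
    (ha : symPoint a ∈ liouvilleCurve n L) (i : Fin n) :
    (liouvilleMap hn ⟨symPoint a, ha⟩).1 = (paramB L a, paramC L a i) := by
  obtain ⟨σ, hσ⟩ := symPoint_eq_iff.mp ha.choose_spec.1.symm
  change (paramB L ha.choose, paramC L ha.choose ⟨0, hn⟩) = _
  rw [hσ, paramB_comp_perm, paramC_comp_perm]
  exact Prod.ext rfl ((symPoint_mem_liouvilleCurve.mp ha).paramC_eq _ _)

theorem exists_eq_symPoint (s : liouvilleCurve n L) :
    ∃ (a : Fin n → EllipticTorus L) (ha : symPoint a ∈ liouvilleCurve n L),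
      IsLiouvilleTuple L a ∧ s = ⟨symPoint a, ha⟩ := by
  obtain ⟨s, a, rfl, h⟩ := s
  exact ⟨a, symPoint_mem_liouvilleCurve.mpr h, h, rfl⟩

theorem liouvilleMap_injective (hn : 1 ≤ n) :
    Function.Injective (liouvilleMap (L := L) hn) := by
  intro s t h
  obtain ⟨a, ha, hLa, rfl⟩ := exists_eq_symPoint s
  obtain ⟨b, hb, hLb, rfl⟩ := exists_eq_symPoint t
  have h' := congrArg Subtype.val h
  rw [liouvilleMap_symPoint hn a ha ⟨0, hn⟩, liouvilleMap_symPoint hn b hb ⟨0, hn⟩,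
    Prod.mk.injEq] at h'
  exact Subtype.ext (symPoint_eq_iff.mpr (hLa.eq_comp_perm hn hLb h'.1 h'.2))

theorem range_liouvilleMap (hn : 1 ≤ n) :
    Set.range (liouvilleMap (L := L) hn) = {p | p.1.2 ≠ 0} := by
  ext p
  constructor
  · rintro ⟨s, rfl⟩
    obtain ⟨a, ha, hLa, rfl⟩ := exists_eq_symPoint s
    change (liouvilleMap hn _).1.2 ≠ 0
    rw [liouvilleMap_symPoint hn a ha ⟨0, hn⟩]
    exact hLa.paramC_ne_zero _
  · intro hp
    obtain ⟨a, hLa, hB, hC⟩ := exists_isLiouvilleTuple hn hp p.2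
    have ha := symPoint_mem_liouvilleCurve.mpr hLa
    refine ⟨⟨symPoint a, ha⟩, Subtype.ext ?_⟩
    rw [liouvilleMap_symPoint hn a ha ⟨0, hn⟩, hB, hC]

/-- `C` as a polynomial in the coordinates with index `i` singled out. -/
def paramCPoly (n : ℕ) (i : Fin n) : MvPolynomial (Fin n × Fin 2) ℂ :=
  MvPolynomial.X (i, 1) *
    ∏ j ∈ Finset.univ.erase i, (MvPolynomial.X (i, 0) - MvPolynomial.X (j, 0))

theorem rename_paramCPoly (σ : Equiv.Perm (Fin n)) (i : Fin n) :
    MvPolynomial.rename (Prod.map σ id) (paramCPoly n i) = paramCPoly n (σ i) := by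
  have h : Finset.univ.erase (σ i) = (Finset.univ.erase i).map σ.toEmbedding := by
    rw [Finset.map_erase, Finset.map_univ_equiv]
    rfl
  rw [paramCPoly, paramCPoly, h, Finset.prod_map]
  simp [map_prod]

/-- The coordinates `B` and `C` as invariant polynomials. -/
def paramPoly (n : ℕ) : Fin 2 → MvPolynomial (Fin n × Fin 2) ℂ :=
  ![MvPolynomial.C (2 * (n : ℂ) - 1) *
      ∑ i : Fin n, (MvPolynomial.X (i, 0) : MvPolynomial (Fin n × Fin 2) ℂ),
    -- The polynomials for the various i are merely permuted by S_n; their average is invariant and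
    -- equals C on X_n, where they all agree.
    MvPolynomial.C (n : ℂ)⁻¹ * ∑ i, paramCPoly n i]

theorem rename_paramPoly (σ : Equiv.Perm (Fin n)) (k : Fin 2) :
    MvPolynomial.rename (Prod.map σ id) (paramPoly n k) = paramPoly n k := by
  fin_cases k
  · simp only [paramPoly, Fin.zero_eta, Matrix.cons_val_zero, map_mul, MvPolynomial.rename_C,
      map_sum, MvPolynomial.rename_X, Prod.map_apply, id_eq]
    congr 1
    exact Equiv.sum_comp σ fun i =>
      (MvPolynomial.X (i, 0) : MvPolynomial (Fin n × Fin 2) ℂ)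
  · simp only [paramPoly, Fin.mk_one, Matrix.cons_val_one, Matrix.cons_val_fin_one, map_mul,
      MvPolynomial.rename_C, map_sum, rename_paramCPoly]
    congr 1
    exact Equiv.sum_comp σ fun i => paramCPoly n i

theorem eval_paramPoly (hn : 1 ≤ n) {a : Fin n → EllipticTorus L} (ha : IsLiouvilleTuple L a)
    (i : Fin n) : (fun k => MvPolynomial.eval (liouvilleCoord L a) (paramPoly n k)) =
      ![paramB L a, paramC L a i] := by
  funext k
  fin_cases k
  · simp [paramPoly, paramB, liouvilleCoord]
  · have h : ∀ j, MvPolynomial.eval (liouvilleCoord L a) (paramCPoly n j) = paramC L a i := by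
      intro j
      rw [← ha.paramC_eq j i]
      simp [paramCPoly, paramC, liouvilleCoord]
    have hn0 : (n : ℂ) ≠ 0 := by exact_mod_cast (by omega : n ≠ 0)
    simp [paramPoly, h, hn0]

/-- Since ∏ (x - x_i) = Q_B, the elementary symmetric functions of the x_i are the s_k(B). -/
theorem exists_eval_symmetric (hn : 1 ≤ n) (L : PeriodPair) {g : MvPolynomial (Fin n) ℂ}
    (hg : g.IsSymmetric) : ∃ r : ℂ[X], ∀ a : Fin n → EllipticTorus L, IsLiouvilleTuple L a →
      MvPolynomial.eval (fun i => weierstrassX L (a i)) g = r.eval (paramB L a) := by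
  obtain ⟨q, hq⟩ := MvPolynomial.esymmAlgHom_surjective (σ := Fin n) (n := n) ℂ
    (Fintype.card_fin n).le ⟨g, hg⟩
  have hq' : g = MvPolynomial.aeval (fun i : Fin n => MvPolynomial.esymm (Fin n) ℂ (i + 1)) q := by
    rw [← MvPolynomial.esymmAlgHom_apply, hq]
  refine ⟨MvPolynomial.aeval (fun i : Fin n => lameSAt n L.g₂ L.g₃ (i + 1)) q, fun a ha => ?_⟩
  have hes : ∀ i : Fin n, MvPolynomial.aeval (fun i => weierstrassX L (a i))
      (MvPolynomial.esymm (Fin n) ℂ (i + 1)) =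
        (lameSAt n L.g₂ L.g₃ (i + 1)).eval (paramB L a) := by
    intro i
    have hcard : Multiset.card (Finset.univ.val.map fun j => weierstrassX L (a j)) = n := by simp
    have h1 := Multiset.prod_X_sub_C_coeff (Finset.univ.val.map fun j => weierstrassX L (a j))
      (k := n - (i + 1)) (by rw [hcard]; omega)
    have h2 := (ha.prod_eq hn i).1
    rw [Multiset.map_map, hcard, show n - (n - ((i : ℕ) + 1)) = i + 1 by omega] at h1
    change (∏ j, (X - C (weierstrassX L (a j)))).coeff _ = _ at h1
    rw [h2, coeff_lameProduct, show ((n : ℤ) - ((n - (i + 1) : ℕ) : ℤ)) = i + 1 by omega,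
      show n + (n - ((i : ℕ) + 1)) = 2 * (n - (i + 1)) + (i + 1) by omega, pow_add, pow_mul,
      neg_one_sq, one_pow, one_mul] at h1
    rw [MvPolynomial.aeval_esymm_eq_multiset_esymm]
    exact (mul_left_cancel₀ (pow_ne_zero _ (neg_ne_zero.mpr one_ne_zero)) h1).symm
  have h3 : MvPolynomial.eval (fun i => weierstrassX L (a i)) g =
      MvPolynomial.aeval (fun i => weierstrassX L (a i)) g := by
    rw [MvPolynomial.aeval_eq_eval]
  have h4 := MvPolynomial.map_aeval (fun i : Fin n => lameSAt n L.g₂ L.g₃ (i + 1))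
    (evalRingHom (paramB L a)) q
  rw [h3, hq', ← AlgHom.comp_apply, MvPolynomial.comp_aeval]
  simp only [hes]
  rw [coe_evalRingHom] at h4
  rw [h4, MvPolynomial.aeval_def]
  congr 1
  ext c
  simp

/-- `C y_i` as a polynomial in the `x_j`. -/
def paramYPoly (L : PeriodPair) (i : Fin n) : MvPolynomial (Fin n) ℂ :=
  Polynomial.aeval (MvPolynomial.X i) (weierstrassCubic L.g₂ L.g₃) *
    ∏ j ∈ Finset.univ.erase i, (MvPolynomial.X i - MvPolynomial.X j)

/-- C y_i = y_i² ∏ (x_i - x_j), and y_i² = p(x_i) on the Weierstrass cubic. -/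
theorem eval_paramYPoly {a : Fin n → EllipticTorus L} (ha : IsLiouvilleTuple L a) (i j : Fin n) :
    MvPolynomial.eval (fun i => weierstrassX L (a i)) (paramYPoly L i) =
      paramC L a j * weierstrassY L (a i) := by
  have h1 : MvPolynomial.eval (fun i => weierstrassX L (a i))
      (Polynomial.aeval (MvPolynomial.X i) (weierstrassCubic L.g₂ L.g₃)) =
      weierstrassY L (a i) ^ 2 := by
    rw [eval_weierstrassCubic_weierstrassX (ha.1 i)]
    simp [weierstrassCubic, Polynomial.aeval_def, MvPolynomial.algebraMap_eq]
  rw [← ha.paramC_eq i j, paramYPoly, map_mul, h1, paramC, MvPolynomial.eval_prod]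
  simp only [map_sub, MvPolynomial.eval_X]
  ring

/-- In each monomial, one factor C for every y_i turns it into a polynomial in the x_j; after
symmetrisation this is a polynomial in B. Allowing every N ≥ d lets sums, and later numerators and
denominators, share one exponent. -/
theorem exists_sum_perm_eval (hn : 1 ≤ n) (L : PeriodPair)
    (p : MvPolynomial (Fin n × Fin 2) ℂ) : ∃ d : ℕ, ∀ N ≥ d, ∃ P : MvPolynomial (Fin 2) ℂ,
      ∀ a : Fin n → EllipticTorus L, IsLiouvilleTuple L a → ∀ i,
        paramC L a i ^ N * ∑ σ : Equiv.Perm (Fin n),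
          MvPolynomial.eval (liouvilleCoord L (a ∘ σ)) p =
        MvPolynomial.eval ![paramB L a, paramC L a i] P := by
  induction p using MvPolynomial.induction_on' with
  | add p q hp hq =>
    obtain ⟨d₁, hp⟩ := hp
    obtain ⟨d₂, hq⟩ := hq
    refine ⟨max d₁ d₂, fun N hN => ?_⟩
    obtain ⟨P, hP⟩ := hp N ((le_max_left _ _).trans hN)
    obtain ⟨Q, hQ⟩ := hq N ((le_max_right _ _).trans hN)
    refine ⟨P + Q, fun a ha i => ?_⟩
    rw [map_add, ← hP a ha i, ← hQ a ha i, ← mul_add, ← Finset.sum_add_distrib]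
    simp only [map_add]
  | monomial u c =>
    let h : MvPolynomial (Fin n) ℂ := MvPolynomial.C c *
      ∏ i, (MvPolynomial.X i ^ u (i, 0) * paramYPoly L i ^ u (i, 1))
    have hh : ∀ a : Fin n → EllipticTorus L, IsLiouvilleTuple L a → ∀ i,
        MvPolynomial.eval (fun i => weierstrassX L (a i)) h =
          paramC L a i ^ (∑ j, u (j, 1)) * MvPolynomial.eval (liouvilleCoord L a)
            (MvPolynomial.monomial u c) := by
      intro a ha i
      rw [MvPolynomial.eval_monomial, Finsupp.prod_fintype _ _ (by simp), Fintype.prod_prod_type]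
      simp only [h, map_mul, MvPolynomial.eval_C, MvPolynomial.eval_prod, map_pow,
        MvPolynomial.eval_X, eval_paramYPoly ha _ i, mul_pow, Finset.prod_mul_distrib,
        Finset.prod_pow_eq_pow_sum, Fin.prod_univ_two, liouvilleCoord, Matrix.cons_val_zero,
        Matrix.cons_val_one]
      ring
    have hsymm : (∑ σ : Equiv.Perm (Fin n), MvPolynomial.rename σ h).IsSymmetric := by
      intro τ
      rw [map_sum]
      simp only [MvPolynomial.rename_rename]
      exact Equiv.sum_comp (Equiv.mulLeft τ) fun σ : Equiv.Perm (Fin n) => MvPolynomial.rename σ h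
    obtain ⟨r, hr⟩ := exists_eval_symmetric hn L hsymm
    refine ⟨∑ j, u (j, 1), fun N hN => ⟨MvPolynomial.X 1 ^ (N - ∑ j, u (j, 1)) *
      Polynomial.aeval (MvPolynomial.X 0) r, fun a ha i => ?_⟩⟩
    have hr' : MvPolynomial.eval ![paramB L a, paramC L a i]
        (Polynomial.aeval (MvPolynomial.X 0) r) = r.eval (paramB L a) := by
      have := Polynomial.hom_eval₂ r (algebraMap ℂ (MvPolynomial (Fin 2) ℂ))
        (MvPolynomial.eval ![paramB L a, paramC L a i]) (MvPolynomial.X 0)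
      rw [Polynomial.aeval_def, this, MvPolynomial.eval_X, Polynomial.eval]
      congr 1
      ext c
      simp [MvPolynomial.algebraMap_eq]
    rw [map_mul, map_pow, MvPolynomial.eval_X, hr', ← hr a ha, map_sum]
    simp only [Matrix.cons_val_one, Matrix.cons_val_fin_one]
    nth_rewrite 1 [← Nat.sub_add_cancel hN]
    rw [pow_add, mul_assoc, Finset.mul_sum]
    congr 1
    refine Finset.sum_congr rfl fun σ _ => ?_
    rw [MvPolynomial.eval_rename, ← ha.paramC_eq (σ i) i, ← paramC_comp_perm]
    exact (hh _ (ha.comp_perm σ) i).symm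

theorem exists_eval_invariant (hn : 1 ≤ n) (L : PeriodPair)
    {p : MvPolynomial (Fin n × Fin 2) ℂ}
    (hp : ∀ σ : Equiv.Perm (Fin n), MvPolynomial.rename (Prod.map σ id) p = p) :
    ∃ d : ℕ, ∀ N ≥ d, ∃ P : MvPolynomial (Fin 2) ℂ,
      ∀ a : Fin n → EllipticTorus L, IsLiouvilleTuple L a → ∀ i,
        paramC L a i ^ N * MvPolynomial.eval (liouvilleCoord L a) p =
        MvPolynomial.eval ![paramB L a, paramC L a i] P := by
  obtain ⟨d, hd⟩ := exists_sum_perm_eval hn L p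
  refine ⟨d, fun N hN => ?_⟩
  obtain ⟨P, hP⟩ := hd N hN
  refine ⟨MvPolynomial.C ((n.factorial : ℂ)⁻¹) * P, fun a ha i => ?_⟩
  have hinv : ∀ σ : Equiv.Perm (Fin n), MvPolynomial.eval (liouvilleCoord L (a ∘ σ)) p =
      MvPolynomial.eval (liouvilleCoord L a) p := by
    intro σ
    nth_rewrite 2 [← hp σ]
    rw [MvPolynomial.eval_rename]
    rfl
  have h := hP a ha i
  simp only [hinv, Finset.sum_const, Finset.card_univ, Fintype.card_perm, Fintype.card_fin,
    nsmul_eq_mul] at h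
  rw [map_mul, MvPolynomial.eval_C, ← h]
  have := Nat.cast_ne_zero (R := ℂ).mpr n.factorial_ne_zero
  field_simp

theorem isOpenImmersion_liouvilleMap (hn : 1 ≤ n) :
    (liouvilleStructure n L).IsOpenImmersion (doubleCoverStructure (lamePolyAt n L))
      (liouvilleMap hn) := by
  refine VarietyStructure.isOpenImmersion_of_forms
    (fun s => ⟨0, fun _ => 1, ⟨1, fun σ => by simp, fun a ha => by simp⟩, one_ne_zero⟩)
    (liouvilleMap_injective hn) ?_ ?_
  · rintro s d _ ⟨p, rfl⟩ _ ⟨q, rfl⟩ hs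
    have key : ∀ r : MvPolynomial (Fin 2) ℂ, ∃ r' : MvPolynomial (Fin n × Fin 2) ℂ,
        (∀ σ : Equiv.Perm (Fin n), MvPolynomial.rename (Prod.map σ id) r' = r') ∧
        ∀ (a : Fin n → EllipticTorus L) (ha : symPoint a ∈ liouvilleCurve n L),
          MvPolynomial.eval ![(liouvilleMap hn ⟨symPoint a, ha⟩).1.1,
            (liouvilleMap hn ⟨symPoint a, ha⟩).1.2] r =
            MvPolynomial.eval (liouvilleCoord L a) r' := by
      intro r
      refine ⟨MvPolynomial.bind₁ (paramPoly n) r, fun σ => ?_, fun a ha => ?_⟩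
      · rw [MvPolynomial.rename_bind₁]
        simp only [rename_paramPoly]
      · rw [liouvilleMap_symPoint hn a ha ⟨0, hn⟩,
          ← eval_paramPoly hn (symPoint_mem_liouvilleCurve.mp ha) ⟨0, hn⟩]
        exact (MvPolynomial.eval₂Hom_bind₁ (RingHom.id ℂ) _ _ r).symm
    obtain ⟨p', hp', hpe⟩ := key p
    obtain ⟨q', hq', hqe⟩ := key q
    exact ⟨0, _, ⟨p', hp', hpe⟩, _, ⟨q', hq', hqe⟩, hs, fun t ht => ⟨ht, rfl⟩⟩
  · rintro s d f ⟨p, hp, hpe⟩ g ⟨q, hq, hqe⟩ hs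
    obtain ⟨d₁, h₁⟩ := exists_eval_invariant hn L hp
    obtain ⟨d₂, h₂⟩ := exists_eval_invariant hn L hq
    obtain ⟨P, hP⟩ := h₁ (max d₁ d₂) (le_max_left _ _)
    obtain ⟨Q, hQ⟩ := h₂ (max d₁ d₂) (le_max_right _ _)
    have hval : ∀ (a : Fin n → EllipticTorus L) (ha : symPoint a ∈ liouvilleCurve n L),
        ![(liouvilleMap hn ⟨symPoint a, ha⟩).1.1, (liouvilleMap hn ⟨symPoint a, ha⟩).1.2] =
          ![paramB L a, paramC L a ⟨0, hn⟩] := by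
      intro a ha
      rw [liouvilleMap_symPoint hn a ha ⟨0, hn⟩]
    -- The extra factor C confines the nonvanishing locus of the denominator to the image C ≠ 0.
    refine ⟨0, _, ⟨MvPolynomial.X 1 * P, rfl⟩, _, ⟨MvPolynomial.X 1 * Q, rfl⟩, ?_, ?_⟩
    · obtain ⟨a, ha, hLa, rfl⟩ := exists_eq_symPoint s
      have hC := hLa.paramC_ne_zero ⟨0, hn⟩
      simp only [hval, map_mul, MvPolynomial.eval_X, Matrix.cons_val_one,
        Matrix.cons_val_fin_one, ← hQ a hLa]
      rw [hqe a ha] at hs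
      exact mul_ne_zero hC (mul_ne_zero (pow_ne_zero _ hC) hs)
    · intro y hy
      have hyC : y.1.2 ≠ 0 := by
        intro h0
        refine hy ?_
        simp [h0]
      obtain ⟨t, rfl⟩ : y ∈ Set.range (liouvilleMap hn) := by
        rw [range_liouvilleMap]
        exact hyC
      obtain ⟨a, ha, hLa, rfl⟩ := exists_eq_symPoint t
      have hC := hLa.paramC_ne_zero ⟨0, hn⟩
      simp only [hval, map_mul, MvPolynomial.eval_X, Matrix.cons_val_one,
        Matrix.cons_val_fin_one, ← hQ a hLa, ← hP a hLa] at hy ⊢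
      refine ⟨_, rfl, ?_, ?_⟩
      · rw [hqe a ha]
        exact right_ne_zero_of_mul (right_ne_zero_of_mul hy)
      · rw [hqe a ha, hpe a ha, mul_div_mul_left _ _ hC, mul_div_mul_left _ _ (pow_ne_zero _ hC)]
        rfl

end liouvilleMap

end

/-! ### The main theorem -/

theorem mainTheorem9 (n : ℕ) (hn : 1 ≤ n) :
    -- Part (1): the projective compactification of `X_n`, for every lattice.
    (∀ L : PeriodPair,
      (lamePolyAt n L).natDegree = 2 * n + 1 ∧
      -- The projective variety is an irreducible curve.
      @IrreducibleSpace (hypModel n (lamePolyAt n L)) (hypStructure n (lamePolyAt n L)).top ∧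
      @topologicalKrullDim (hypModel n (lamePolyAt n L))
        (hypStructure n (lamePolyAt n L)).top = 1 ∧
      ∃ (α : doubleCover (lamePolyAt n L) → hypModel n (lamePolyAt n L))
        (β : doubleCover (X * (lamePolyAt n L).reverse) → hypModel n (lamePolyAt n L))
        (π : hypModel n (lamePolyAt n L) → ProjLine)
        (ι : hypModel n (lamePolyAt n L) → hypModel n (lamePolyAt n L))
        (φ : liouvilleCurve n L → hypModel n (lamePolyAt n L)),
        -- It is covered by the affine charts `C² = ℓ_n(B)` and `v² = u · u^{2n+1} ℓ_n(1/u)`.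
        (∀ p, (α p : ℙ ℂ (HypCoord n → ℂ)) = finitePoint n p) ∧
        (∀ p, (β p : ℙ ℂ (HypCoord n → ℂ)) = pointNearInfinity n p) ∧
        (doubleCoverStructure _).IsOpenImmersion (hypStructure n _) α ∧
        (doubleCoverStructure _).IsOpenImmersion (hypStructure n _) β ∧
        (∃ h : ((0, 0) : ℂ × ℂ) ∈ doubleCover (X * (lamePolyAt n L).reverse),
          (Set.range α)ᶜ = {β ⟨(0, 0), h⟩}) ∧
        -- It is a double cover of the projective line through `B`, with involution `C ↦ -C`.
        (hypStructure n _).IsMorphism projLineStructure π ∧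
        (hypStructure n _).IsMorphism (hypStructure n _) ι ∧
        Function.Involutive ι ∧
        (∀ p, π (α p) = linePoint p.1.1) ∧
        (∀ p, (ι (α p) : ℙ ℂ (HypCoord n → ℂ)) = finitePoint n (p.1.1, -p.1.2)) ∧
        Function.Surjective π ∧
        (∀ P Q, π P = π Q ↔ Q = P ∨ Q = ι P) ∧
        -- `X_n` is identified with a dense open subvariety, through `B = (2n-1) ∑ x_i` and
        -- `C = y_i ∏_{j ≠ i} (x_i - x_j)`.
        (∀ (a : Fin n → EllipticTorus L) (ha : symPoint a ∈ liouvilleCurve n L) (i : Fin n),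
          ∃ h : (paramB L a, paramC L a i) ∈ doubleCover (lamePolyAt n L),
            φ ⟨symPoint a, ha⟩ = α ⟨(paramB L a, paramC L a i), h⟩) ∧
        (liouvilleStructure n L).IsOpenImmersion (hypStructure n _) φ ∧
        @Dense _ (hypStructure n (lamePolyAt n L)).top (Set.range φ) ∧
        Set.range φ = α '' {p | p.1.2 ≠ 0} ∧
        Set.range φ = {P | ι P ≠ P}) ∧
    -- Part (2): the discriminant.
    (lamePoly n).natDegree = 2 * n + 1 ∧
    (lamePoly n).discr ≠ 0 ∧
    MvPolynomial.IsWeightedHomogeneous ![2, 3] (lamePoly n).discr (2 * n * (2 * n + 1)) ∧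
    (∀ L : PeriodPair, (lamePolyAt n L).discr = invariantsAt L (lamePoly n).discr) ∧
    ∃ f : ModularForm 𝒮ℒ (4 * n * (2 * n + 1)),
      f ≠ 0 ∧ ∀ τ : UpperHalfPlane, f τ = invariantsAt (latticeOf τ) (lamePoly n).discr := by
  refine ⟨fun L => ?_, natDegree_lamePoly n hn, discr_lamePoly_ne_zero n hn,
    isWeightedHomogeneous_discr_lamePoly n hn, fun L => evalInvariants_discr n hn L.g₂ L.g₃,
    exists_modularForm_discr_lamePoly n hn⟩
  have hf : (lamePolyAt n L).natDegree = 2 * n + 1 := natDegree_lameEllAt n hn L.g₂ L.g₃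
  have hφ : (liouvilleStructure n L).IsOpenImmersion (hypStructure n _)
      (hypChart hf ∘ liouvilleMap hn) :=
    (isOpenImmersion_hypChart hf).comp (isOpenImmersion_liouvilleMap hn)
  have hrange : Set.range (hypChart (n := n) hf ∘ liouvilleMap (L := L) hn) =
      hypChart hf '' {p | p.1.2 ≠ 0} := by
    rw [Set.range_comp, range_liouvilleMap]
  refine ⟨hf, irreducibleSpace_hypModel hf, topologicalKrullDim_hypModel hf, hypChart hf,
    hypChartInfinity hf, hypProjection, hypInvolution, hypChart hf ∘ liouvilleMap hn,
    fun _ => rfl, fun _ => rfl, isOpenImmersion_hypChart hf, isOpenImmersion_hypChartInfinity hf,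
    ⟨zero_mem_doubleCover_reverse _, compl_range_hypChart hf⟩, isMorphism_hypProjection hf,
    isMorphism_hypInvolution, hypInvolution_involutive hf, hypProjection_hypChart hf,
    fun p => congrArg Subtype.val (hypInvolution_hypChart hf p), hypProjection_surjective hf,
    hypProjection_eq_iff hf, fun a ha i => ?_, hφ, ?_, hrange,
    hrange.trans (setOf_hypInvolution_ne hf).symm⟩
  · have h := liouvilleMap_symPoint hn a ha i
    exact ⟨h ▸ (liouvilleMap hn ⟨symPoint a, ha⟩).2, congrArg (hypChart hf) (Subtype.ext h)⟩
  · let := (hypStructure n (lamePolyAt n L)).top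
    have := irreducibleSpace_hypModel hf
    -- In an irreducible space a nonempty open set is dense; a point of it lies over any B that is
    -- not a root of ℓ_n.
    refine hφ.isOpen_range.dense ?_
    obtain ⟨B, hB⟩ := Infinite.exists_notMem_finset (lamePolyAt n L).roots.toFinset
    obtain ⟨C, hC⟩ := exists_mem_doubleCover (lamePolyAt n L) B
    rw [hrange]
    refine ⟨_, ⟨(B, C), hC⟩, ?_, rfl⟩
    rintro rfl
    have h0 : (lamePolyAt n L) ≠ 0 := by
      intro h
      rw [h, natDegree_zero] at hf
      omega
    have hC' : (0 : ℂ) ^ 2 = (lamePolyAt n L).eval B := hC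
    refine hB (Multiset.mem_toFinset.mpr ((mem_roots h0).mpr ?_))
    rw [IsRoot.def, ← hC', zero_pow two_ne_zero]
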